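/- **Setting.** Fix finitely many disjoint logical domains $D_s$ (some objects of which are named by constants) and finitely many predicates; the randvars are the ground atoms $P(o_1,\dots,o_k)$, each predicate having a fixed finite non-empty range. A *dtree* is a rooted tree whose leaves hold factors, each applied to a list of randvars. For a node $t$ let $rv(t)$ be the set of randvars in the leaves below $t$, let $\mathit{acutset}(t)$ be the union of the cutsets of its proper ancestors, and put $\mathit{cutset}(t)=\bigcup_{t_1\ne t_2} rv(t_1)\cap rv(t_2)\setminus \mathit{acutset}(t)$ (over children $t_1,t_2$ of $t$) and $\mathit{context}(t)=rv(t)\cap \mathit{acutset}(t)$. Then $\mathit{cluster}(t)=rv(t)$ for a leaf, and $\mathit{cutset}(t)\cup\mathit{context}(t)$ otherwise. A (non-counted) *FO-dtree* $T$ is a rooted tree whose leaves hold factors applied to atoms over constants and representative objects, and whose inner nodes are ordinary nodes or DPG nodes $\forall \mathbf x : C$. A DPG node belongs to a set $\mathbf X$ of $k\ge 1$ logvars with a common domain, represented by $\mathbf x=\{x_1,\dots,x_k\}$; the constraint $C$ says that the $x_i$ are distinct from each other, from all representative objects of the same domain that are introduced above the node, and from some given set of constants. Its only child has $k!$ children,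 one for each permutation of $\mathbf x$, which arise from one subtree by permuting $\mathbf x$. Every leaf below the DPG node contains all of $\mathbf x$, and only representative objects introduced above a leaf occur in it. For given domain sizes, $T$ stands for the dtree obtained by replacing the child of each DPG node by its instances for all $k$-subsets of the objects allowed by $C$. At a node, representative objects introduced above it count as fixed objects, and those introduced at or below it (at a DPG node also its own $\mathbf x$, but not at its child) as logvars; the cluster of a node of $T$ consists of the PRVs (atoms in the leaves below it) that have a grounding in the cluster of a corresponding node of the dtree. **Theorem 1 (liftable FO-dtrees).** Let $T$ be a non-counted FO-dtree such that, for all domain sizes, every PRV in the cluster of every node contains at most one logvar, i.e. the clusters consist only of (representative) ground randvars and $1$-logvar PRVs; such a tree is called *liftable*. Then $T$ has a (domain-)lifted inference solution: 1. There is a number $w$ such that, for all domain sizes and every node $t$ of the dtree that $T$ stands for, $\mathit{cluster}(t)$ can be partitioned into at most $w$ single randvars and at most $w$ groups of $k$-tuples of randvars, with $k\le w$, such that for all real potential functions the tuples of each group are interchangeable in the subproblem of $t$ (the product of all factors below $t$ with the randvars in $rv(t)\setminus\mathit{cluster}(t)$ summed out): permuting the values of the tuples of a group does not change its value. So a domain-independent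 number of ground and counting randvars suffices. 2. There are a program, for a machine with registers for natural numbers (assignment, increment, decrement, zero test, bounded loops) and for real numbers ($0$, $1$, lookup of a potential, $+$, $\cdot$, $/$), and a polynomial $q$, both depending only on $T$, such that for all domain sizes and all real potential functions the program, started with the domain sizes as input, computes the sum, over all joint values of the randvars, of the product of all factors of the dtree that $T$ stands for, in at most $q\big((|D_s|)_s\big)$ steps. -/

import Mathlib

namespace FODtrees

/-! ## Decomposition trees of propositional factor graphs -/

/-- A decomposition tree over the random variables `V`. A leaf holds the factor named `f`, applied
to a list of random variables. Every node carries a label of type `L`. -/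
inductive DTree (L V : Type) : Type 1
  | leaf (l : L) (f : ℕ) (args : List V) : DTree L V
  | node (l : L) (ι : Type) [Fintype ι] (ch : ι → DTree L V) : DTree L V

namespace DTree

variable {L V : Type}

/-- The label of the root. -/
def label : DTree L V → L
  | leaf l _ _ => l
  | node l _ _ => l

/-- The random variables under a node. -/
def rv : DTree L V → Set V
  | leaf _ _ args => {v | v ∈ args}
  | node _ _ ch => ⋃ i, (ch i).rv

/-- The random variables that occur under two different children. -/
def shared : DTree L V → Set V
  | leaf _ _ _ => ∅
  | node _ _ ch => {v | ∃ i j, i ≠ j ∧ v ∈ (ch i).rv ∩ (ch j).rv}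

/-- The cutset of a node; `acut` is the union of the cutsets of its ancestors. -/
def cutset (D : DTree L V) (acut : Set V) : Set V := D.shared \ acut

/-- The context of a node; `acut` is the union of the cutsets of its ancestors. -/
def context (D : DTree L V) (acut : Set V) : Set V := D.rv ∩ acut

/-- The cluster of a node; `acut` is the union of the cutsets of its ancestors. -/
def cluster : DTree L V → Set V → Set V
  | leaf l f args, _ => (leaf l f args).rv
  | node l ι ch, acut => (node l ι ch).cutset acut ∪ (node l ι ch).context acut

/-- All nodes of the tree, each as the subtree below it together with the union of the cutsets of
its ancestors, where `acut` is that union for the root. -/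
def nodes : DTree L V → Set V → Set (DTree L V × Set V)
  | leaf l f args, acut => {(leaf l f args, acut)}
  | node l ι ch, acut =>
      {(node l ι ch, acut)} ∪ ⋃ i, (ch i).nodes (acut ∪ (node l ι ch).cutset acut)

/-- The product of all factors in the tree, for the potential functions `Φ` (`Φ f` is the potential
function of the factor named `f`) under the assignment `τ`. -/
noncomputable def weight (Φ : ℕ → List ℕ → ℝ) (τ : V → ℕ) : DTree L V → ℝ
  | leaf _ f args => Φ f (args.map τ)
  | node _ _ ch => ∏ i, (ch i).weight Φ τ

/-- The product of all factors in the tree, where the random variables in `S` are summed out and all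
others have the value that `ω` gives them; the range of `v` is `{0, …, r v - 1}`. -/
noncomputable def sumOut [Fintype V] (r : V → ℕ) (Φ : ℕ → List ℕ → ℝ) (D : DTree L V)
    (S : Set V) (ω : V → ℕ) : ℝ := by
  classical
  exact ∑ τ ∈ Fintype.piFinset (fun v => if v ∈ S then Finset.range (r v) else {ω v}),
    D.weight Φ τ

/-- The sum, over all joint values of the random variables in the tree, of the product of all
factors. (The random variables that do not occur in the tree are irrelevant and set to `0`.) -/
noncomputable def sumProduct [Fintype V] (r : V → ℕ) (Φ : ℕ → List ℕ → ℝ) (D : DTree L V) : ℝ :=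
  D.sumOut r Φ D.rv (fun _ => 0)

/-- The tuples `(tup a 0, …, tup a (k - 1))`, `a < N`, of random variables are interchangeable in
the function `F` of the assignment: permuting the values of the tuples does not change `F`. -/
def Interchangeable {N k : ℕ} (tup : Fin N → Fin k → V) (F : (V → ℕ) → ℝ) : Prop :=
  ∀ (π : Equiv.Perm (Fin N)) (ω ω' : V → ℕ),
    (∀ a b, ω' (tup a b) = ω (tup (π a) b)) →
    (∀ v, (∀ a b, v ≠ tup a b) → ω' v = ω v) → F ω' = F ω

end DTree

/-! ## Parametrized random variables -/

/-- A vocabulary: logical domains, with the domain objects that are named by constants, and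
predicates, whose ground atoms are the random variables. -/
structure Vocabulary where
  /-- number of (pairwise disjoint) domains -/
  numDoms : ℕ
  /-- number of constants that name objects of a domain -/
  numConsts : Fin numDoms → ℕ
  /-- number of predicates -/
  numPreds : ℕ
  /-- number of arguments of a predicate -/
  arity : Fin numPreds → ℕ
  /-- number of values of the random variables of a predicate -/
  range : Fin numPreds → ℕ
  range_pos : ∀ p, 0 < range p

variable {σ : Vocabulary}

/-- The objects of the domain `s`: those that are named by constants, and `n s` further ones. -/
abbrev Dom (σ : Vocabulary) (n : Fin σ.numDoms → ℕ) (s : Fin σ.numDoms) : Type :=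
  Fin (σ.numConsts s) ⊕ Fin (n s)

/-- The size of the domain `s`. -/
def domSize (σ : Vocabulary) (n : Fin σ.numDoms → ℕ) (s : Fin σ.numDoms) : ℕ :=
  σ.numConsts s + n s

/-- The objects of all domains. -/
abbrev Obj (σ : Vocabulary) (n : Fin σ.numDoms → ℕ) : Type := Σ s, Dom σ n s

/-- The random variables `P(o₁, …, oₖ)`. -/
abbrev RandVar (σ : Vocabulary) (n : Fin σ.numDoms → ℕ) : Type :=
  Σ p : Fin σ.numPreds, Fin (σ.arity p) → Obj σ n

/-- Arguments of predicates: constants, and `m` placeholders (representative objects, or logical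
variables). -/
abbrev Arg (σ : Vocabulary) (m : ℕ) : Type := (Σ s, Fin (σ.numConsts s)) ⊕ Fin m

/-- An atom `P(t₁, …, tₖ)` over `m` placeholders. -/
structure Atom (σ : Vocabulary) (m : ℕ) where
  pred : Fin σ.numPreds
  args : Fin (σ.arity pred) → Arg σ m

/-- The value of an argument when the placeholders are replaced by the objects `η`. -/
def evalArg {n : Fin σ.numDoms → ℕ} {m : ℕ} (η : Fin m → Obj σ n) : Arg σ m → Obj σ n
  | .inl c => ⟨c.1, .inl c.2⟩
  | .inr i => η i

/-- The random variable obtained by replacing the placeholders by the objects `η`. -/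
def Atom.ground {n : Fin σ.numDoms → ℕ} {m : ℕ} (a : Atom σ m) (η : Fin m → Obj σ n) :
    RandVar σ n :=
  ⟨a.pred, fun j => evalArg η (a.args j)⟩

/-- The number of logical variables in an atom that occurs below a node with `m₀` representative
objects in scope: the first `m₀` placeholders stand for these, and all later ones are bound at or
below that node, hence are logical variables there. -/
noncomputable def Atom.numLogvars {m : ℕ} (a : Atom σ m) (m₀ : ℕ) : ℕ :=
  {i : Fin m | m₀ ≤ (i : ℕ) ∧ ∃ j, a.args j = Sum.inr i}.ncard

/-! ## First-order decomposition trees -/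

/-- First-order decomposition trees with `m` representative objects in scope, numbered from the
root downwards.

* `leaf f as` holds the factor `f(as)`.
* `node j ch` is an ordinary inner node with `j` children.
* `dpg s k excl body` is a decomposition into partial groundings `∀ x : C` with respect to `k`
  logical variables of the domain `s`, represented by `x = {x₀, …, xₖ₋₁}`. The constraint `C` says
  that the `xᵢ` are distinct from each other, from the other representative objects in scope, and
  from the constants in `excl`. The single child of this node has `k!` children, namely `body`, in
  which the `xᵢ` have the numbers `m, …, m + k - 1`, and what becomes of `body` when they are
  permuted. -/
inductive FODTree (σ : Vocabulary) : ℕ → Type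
  | leaf {m : ℕ} (f : ℕ) (as : List (Atom σ m)) : FODTree σ m
  | node {m : ℕ} (j : ℕ) (ch : Fin j → FODTree σ m) : FODTree σ m
  | dpg {m : ℕ} (s : Fin σ.numDoms) (k : ℕ) (excl : Finset (Fin (σ.numConsts s)))
      (body : FODTree σ (m + k)) : FODTree σ m

/-- Inner nodes have at least one child, decompositions into partial groundings are with respect to
at least one logical variable, and every leaf contains all representative objects in scope. -/
def FODTree.WellFormed : {m : ℕ} → FODTree σ m → Prop
  | m, .leaf _ as => ∀ i : Fin m, ∃ a ∈ as, ∃ j, a.args j = Sum.inr i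
  | _, .node j ch => 0 < j ∧ ∀ i, (ch i).WellFormed
  | _, .dpg _ k _ body => 0 < k ∧ body.WellFormed

/-- A parametrized random variable: an atom over any number of placeholders. -/
abbrev PRV (σ : Vocabulary) : Type := Σ m, Atom σ m

/-- A parametrized random variable together with a grounding substitution. -/
structure PRVInst (σ : Vocabulary) (n : Fin σ.numDoms → ℕ) where
  m : ℕ
  atom : Atom σ m
  subst : Fin m → Obj σ n

/-- The objects that may replace the representative objects of a decomposition into partial
groundings, when `η` are the objects that have replaced the representative objects in scope. -/
def candidates {n : Fin σ.numDoms → ℕ} {m : ℕ} (η : Fin m → Obj σ n) (s : Fin σ.numDoms)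
    (excl : Finset (Fin (σ.numConsts s))) : Finset (Dom σ n s) :=
  Finset.univ.filter fun u => (∀ c ∈ excl, u ≠ .inl c) ∧ ∀ i, η i ≠ ⟨s, u⟩

/-- The `k`-subsets of the candidates. -/
abbrev Subsets {n : Fin σ.numDoms → ℕ} {m : ℕ} (η : Fin m → Obj σ n) (s : Fin σ.numDoms)
    (excl : Finset (Fin (σ.numConsts s))) (k : ℕ) : Type :=
  {x : Finset (Dom σ n s) // x ∈ (candidates η s excl).powersetCard k}

/-- The substitution `η`, extended by an enumeration of the set `x`. -/
def extend {n : Fin σ.numDoms → ℕ} {m k : ℕ} (η : Fin m → Obj σ n) {s : Fin σ.numDoms}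
    {x : Finset (Dom σ n s)} (e : Fin k ≃ x) : Fin (m + k) → Obj σ n :=
  Fin.append η (fun i => ⟨s, (e i : Dom σ n s)⟩)

/-- The parametrized random variables in the leaves of the tree, with all grounding substitutions
that extend `η` and satisfy the constraints. -/
def FODTree.prvs {n : Fin σ.numDoms → ℕ} :
    {m : ℕ} → FODTree σ m → (Fin m → Obj σ n) → Set (PRVInst σ n)
  | m, .leaf _ as, η => {b | ∃ a ∈ as, b = ⟨m, a, η⟩}
  | _, .node _ ch, η => ⋃ i, (ch i).prvs η
  | _, .dpg s k excl body, η =>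
      ⋃ (x : Subsets η s excl k) (e : Fin k ≃ x.1), body.prvs (extend η e)

/-- What a node of the grounded tree remembers of the first-order node that it comes from. -/
structure Label (σ : Vocabulary) (n : Fin σ.numDoms → ℕ) where
  /-- number of representative objects in scope -/
  scope : ℕ
  /-- the parametrized random variables below the node, with their groundings -/
  prvs : Set (PRVInst σ n)

/-- The decomposition tree that a first-order tree stands for, when the representative objects in
scope are replaced by `η`. A decomposition into partial groundings becomes a node with one child for
each `k`-subset `x` of the candidates, and that child has one child for each of the `k!`
enumerations of `x`. -/
def FODTree.ground {n : Fin σ.numDoms → ℕ} :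
    {m : ℕ} → FODTree σ m → (Fin m → Obj σ n) → DTree (Label σ n) (RandVar σ n)
  | m, .leaf f as, η => .leaf ⟨m, FODTree.prvs (.leaf f as) η⟩ f (as.map fun a => a.ground η)
  | m, .node j ch, η =>
      .node ⟨m, FODTree.prvs (.node j ch) η⟩ (Fin j) fun i => (ch i).ground η
  | m, .dpg s k excl body, η =>
      .node ⟨m, FODTree.prvs (.dpg s k excl body) η⟩ (Subsets η s excl k) fun x =>
        .node ⟨m + k, ⋃ e : Fin k ≃ x.1, body.prvs (extend η e)⟩ (Fin k ≃ x.1) fun e =>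
          body.ground (extend η e)

/-- The decomposition tree of a closed first-order tree. -/
def FODTree.toDTree (T : FODTree σ 0) (n : Fin σ.numDoms → ℕ) :
    DTree (Label σ n) (RandVar σ n) :=
  T.ground Fin.elim0

/-- The first-order cluster of a node: the parametrized random variables below the node that have
a grounding in the cluster of the node. -/
def foCluster {n : Fin σ.numDoms → ℕ} (D : DTree (Label σ n) (RandVar σ n))
    (acut : Set (RandVar σ n)) : Set (PRV σ) :=
  {a | ∃ η, ⟨a.1, a.2, η⟩ ∈ D.label.prvs ∧ a.2.ground η ∈ D.cluster acut}

/-- All clusters consist of ground or representative random variables and of parametrized random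
variables with one logical variable, whatever the domain sizes are. -/
def FODTree.Liftable (T : FODTree σ 0) : Prop :=
  ∀ n : Fin σ.numDoms → ℕ, ∀ N ∈ (T.toDTree n).nodes ∅,
    ∀ a ∈ foCluster N.1 N.2, a.2.numLogvars N.1.label.scope ≤ 1

/-- The cluster of the node `D` is partitioned into at most `w` single random variables and at most
`w` groups of tuples of at most `w` random variables each, such that the tuples of a group are
interchangeable in the subproblem of the node (the product of all factors below the node, where all
random variables outside the cluster are summed out), whatever the potential functions are. Thus
the cluster can be rewritten into at most `w` random variables and at most `w` counting random
variables, one for each group. -/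
def HasCountingPartition {n : Fin σ.numDoms → ℕ} (w : ℕ) (D : DTree (Label σ n) (RandVar σ n))
    (acut : Set (RandVar σ n)) : Prop :=
  ∃ (u g : ℕ) (N k : Fin g → ℕ) (single : Fin u → RandVar σ n)
    (tup : (i : Fin g) → Fin (N i) → Fin (k i) → RandVar σ n),
    u ≤ w ∧ g ≤ w ∧ (∀ i, k i ≤ w) ∧
    Set.BijOn (Sum.elim single fun t : (Σ i, Fin (N i) × Fin (k i)) => tup t.1 t.2.1 t.2.2)
      Set.univ (D.cluster acut) ∧
    (∀ i a a' b, (tup i a b).1 = (tup i a' b).1) ∧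
    ∀ (Φ : ℕ → List ℕ → ℝ) (i : Fin g), DTree.Interchangeable (tup i)
      (D.sumOut (fun v => σ.range v.1) Φ (D.rv \ D.cluster acut))

/-! ## Programs and their running time -/

/-- Programs for a machine with registers for natural numbers and registers for real numbers. -/
inductive Prog : Type
  /-- natural register `r` becomes the constant `c` -/
  | const (r c : ℕ)
  /-- natural register `r` becomes natural register `r'` -/
  | copy (r r' : ℕ)
  | succ (r : ℕ)
  | pred (r : ℕ)
  /-- real register `x` becomes `0` -/
  | zero (x : ℕ)
  /-- real register `x` becomes `1` -/
  | one (x : ℕ)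
  /-- real register `x` becomes the entry of the potential function `f` at the values `vs` -/
  | load (x f : ℕ) (vs : List ℕ)
  /-- real register `x` becomes the sum of the real registers `y` and `z`; similarly below -/
  | add (x y z : ℕ)
  | mul (x y z : ℕ)
  | div (x y z : ℕ)
  | seq (p q : Prog)
  /-- `p` if natural register `r` is zero, `q` otherwise -/
  | ifZero (r : ℕ) (p q : Prog)
  /-- `p`, as many times as natural register `r` says at the beginning -/
  | loop (r : ℕ) (p : Prog)

/-- The contents of the registers. -/
structure State where
  nat : ℕ → ℕ
  real : ℕ → ℝ

/-- The state after running a program, and the number of steps; every instruction, every test and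
every pass through a loop counts as one step. -/
noncomputable def Prog.run (Φ : ℕ → List ℕ → ℝ) : Prog → State → State × ℕ
  | .const r c, S => (⟨Function.update S.nat r c, S.real⟩, 1)
  | .copy r r', S => (⟨Function.update S.nat r (S.nat r'), S.real⟩, 1)
  | .succ r, S => (⟨Function.update S.nat r (S.nat r + 1), S.real⟩, 1)
  | .pred r, S => (⟨Function.update S.nat r (S.nat r - 1), S.real⟩, 1)
  | .zero x, S => (⟨S.nat, Function.update S.real x 0⟩, 1)
  | .one x, S => (⟨S.nat, Function.update S.real x 1⟩, 1)
  | .load x f vs, S => (⟨S.nat, Function.update S.real x (Φ f vs)⟩, 1)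
  | .add x y z, S => (⟨S.nat, Function.update S.real x (S.real y + S.real z)⟩, 1)
  | .mul x y z, S => (⟨S.nat, Function.update S.real x (S.real y * S.real z)⟩, 1)
  | .div x y z, S => (⟨S.nat, Function.update S.real x (S.real y / S.real z)⟩, 1)
  | .seq p q, S => ((q.run Φ (p.run Φ S).1).1, (p.run Φ S).2 + (q.run Φ (p.run Φ S).1).2)
  | .ifZero r p q, S =>
      if S.nat r = 0 then ((p.run Φ S).1, (p.run Φ S).2 + 1)
      else ((q.run Φ S).1, (q.run Φ S).2 + 1)
  | .loop r p, S =>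
      (fun c : State × ℕ => ((p.run Φ c.1).1, c.2 + (p.run Φ c.1).2 + 1))^[S.nat r] (S, 1)

/-- The initial state: the first natural registers hold the domain sizes, all others hold zero. -/
def startState (σ : Vocabulary) (n : Fin σ.numDoms → ℕ) : State where
  nat r := if h : r < σ.numDoms then domSize σ n ⟨r, h⟩ else 0
  real _ := 0

end FODtrees

/-!
The children of a node of a liftable tree share only random variables with at most one object that
is not fixed at the node, where the constants and the representative objects in scope are fixed; the
same holds for all random variables in the cluster of the node. Everything else follows from
symmetry and from this one fact (`IsScope.cluster_subset_near`, `separated_of_hasLiftableClusters`).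

**Counting partitions.** A permutation of the domains that leaves the fixed objects of a node alone
maps the subtree below the node, and the cutsets above it, to themselves up to the order of children
(`renames_ground`, `exists_symmetric_of_mem_nodes`). The atoms of the cluster over fixed objects are
the single random variables. Each other atom of the cluster contains exactly one further object `u`,
and the atoms that belong to the same `u` form a tuple; a permutation of the tuples of one domain
comes from a permutation of the domain, hence does not change the value of the subproblem
(`hasCountingPartition`).

**Program.** Sums over random variables are replaced by averages over uniformly distributed
assignments, so that random variables that do not occur in a subtree do no harm, the averages of
factors without common averaged random variables multiply (`average_prod`), and averages can be
taken in stages (`average_average`). At a node, name the fixed objects by a finite set `N` that does not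
depend on the domain sizes. The type of an unnamed object consists of its domain and of the values
of the atoms over this object and named ones. The claim `Computes t` says: the average of the factors
below `t` over all random variables with at least two unnamed objects is a function, computable in
polynomial time, of the numbers of unnamed objects of each type; it is proved by induction on `t`.

The essential case is a decomposition into partial groundings (`computes_dpg`). Its children share
only random variables that are not averaged, so the average is a product over the `k`-subsets of the
candidates. A factor depends only on the types of the elements of the subset, and the number of
subsets with given types is a product of binomial coefficients, which becomes an exponent. For one
subset (`exists_value_of_kinds`), its elements receive names. The random variables with at least two
objects that are unnamed even then are averaged by the induction hypothesis; the remaining ones are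
the values of atoms over names, which form a finite set of cases, and refinements of the types of
unnamed objects, which enter only through histograms. The number of refinements with a given
histogram is a quotient of products of factorials (`card_refinements`), and there are polynomially
many histograms.

At the root this gives the average of the product of all factors, which is the required sum up to a
factor that does not depend on the potential functions. The factor is obtained by running the same
computation for potential functions for which the sum is `1` (`sumProduct_eq_div`).
-/

namespace FODtrees

/-! ### Functions that programs compute in polynomial time -/

open Polynomial in
/-- The program `P` computes the function `g` of the natural registers `loc i`: it writes the value
into the natural register `b`, changes no natural register below `b` and no real register, and, if
all arguments are at most `M`, then it needs at most `q M` steps. -/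
structure NatSpec {ι : Type} (P : Prog) (g : (ι → ℕ) → ℕ) (loc : ι → ℕ) (b : ℕ) (q : ℕ[X]) :
    Prop where
  keep : ∀ Φ S r, r < b → (P.run Φ S).1.nat r = S.nat r
  real : ∀ Φ S, (P.run Φ S).1.real = S.real
  val : ∀ Φ S, (P.run Φ S).1.nat b = g fun i => S.nat (loc i)
  cost : ∀ Φ S M, (∀ i, S.nat (loc i) ≤ M) → (P.run Φ S).2 ≤ q.eval M

/-- The program `P` computes the function `f` of the natural registers `loc i` and of the potential
functions: it writes the value into the real register `y`, changes no natural register below `b` and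
no real register below `y`, and, if all arguments are at most `M`, then it needs at most `q M`
steps. -/
structure RealSpec {ι : Type} (P : Prog) (f : (ι → ℕ) → (ℕ → List ℕ → ℝ) → ℝ) (loc : ι → ℕ)
    (b y : ℕ) (q : Polynomial ℕ) : Prop where
  keep : ∀ Φ S r, r < b → (P.run Φ S).1.nat r = S.nat r
  keepReal : ∀ Φ S x, x < y → (P.run Φ S).1.real x = S.real x
  val : ∀ Φ S, (P.run Φ S).1.real y = f (fun i => S.nat (loc i)) Φ
  cost : ∀ Φ S M, (∀ i, S.nat (loc i) ≤ M) → (P.run Φ S).2 ≤ q.eval M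

/-- Polynomial-time computability of a function of natural numbers. The value is polynomially
bounded as well, so that it may serve as the number of passes through a loop. -/
def NatComputable {ι : Type} (g : (ι → ℕ) → ℕ) : Prop :=
  ∃ q : Polynomial ℕ, (∀ ρ M, (∀ i, ρ i ≤ M) → g ρ ≤ q.eval M) ∧
    ∀ (loc : ι → ℕ) (b : ℕ), (∀ i, loc i < b) → ∃ P, NatSpec P g loc b q

/-- Computability of a real function of natural numbers and of the potential functions, in time
polynomial in the natural numbers. -/
def RealComputable {ι : Type} (f : (ι → ℕ) → (ℕ → List ℕ → ℝ) → ℝ) : Prop :=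
  ∃ q : Polynomial ℕ, ∀ (loc : ι → ℕ) (b y : ℕ), (∀ i, loc i < b) → ∃ P, RealSpec P f loc b y q

/-- A loop invariant, and the running time of a loop whose passes keep the invariant. -/
theorem run_loop (Φ : ℕ → List ℕ → ℝ) (p : Prog) (r : ℕ) (S : State) (I : ℕ → State → Prop)
    (h0 : I 0 S) (hs : ∀ i S', i < S.nat r → I i S' → I (i + 1) (p.run Φ S').1) :
    I (S.nat r) ((Prog.loop r p).run Φ S).1 ∧
      ∀ B, (∀ i S', i < S.nat r → I i S' → (p.run Φ S').2 ≤ B) →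
        ((Prog.loop r p).run Φ S).2 ≤ S.nat r * (B + 1) + 1 := by
  have key : ∀ j, j ≤ S.nat r →
      I j ((fun c : State × ℕ => ((p.run Φ c.1).1, c.2 + (p.run Φ c.1).2 + 1))^[j] (S, 1)).1 ∧
      ∀ B, (∀ i S', i < S.nat r → I i S' → (p.run Φ S').2 ≤ B) →
        ((fun c : State × ℕ => ((p.run Φ c.1).1, c.2 + (p.run Φ c.1).2 + 1))^[j] (S, 1)).2
          ≤ j * (B + 1) + 1 := by
    intro j
    induction j with
    | zero => intro _; exact ⟨h0, fun B _ => by simp⟩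
    | succ j ih =>
      intro hj
      obtain ⟨h1, h2⟩ := ih (by omega)
      rw [Function.iterate_succ_apply']
      refine ⟨hs j _ (by omega) h1, fun B hB => ?_⟩
      have := h2 B hB
      have := hB j _ (by omega) h1
      simp only [add_mul, one_mul]
      omega
  exact key _ le_rfl

namespace NatComputable

variable {ι κ : Type}

theorem var (i : ι) : NatComputable fun ρ : ι → ℕ => ρ i := by
  refine ⟨Polynomial.X + 1, fun ρ M h => by simpa using (h i).trans (Nat.le_succ M), fun loc b _ =>
    ⟨.copy b (loc i), ⟨fun Φ S r hr => ?_, fun Φ S => rfl, fun Φ S => ?_, fun Φ S M h => ?_⟩⟩⟩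
  · simp [Prog.run, Function.update_of_ne hr.ne]
  · simp [Prog.run]
  · simp [Prog.run]

theorem const (c : ℕ) : NatComputable fun _ : ι → ℕ => c := by
  refine ⟨Polynomial.C (c + 1), fun ρ M h => by simp, fun loc b _ =>
    ⟨.const b c, ⟨fun Φ S r hr => ?_, fun Φ S => rfl, fun Φ S => ?_, fun Φ S M h => ?_⟩⟩⟩
  · simp [Prog.run, Function.update_of_ne hr.ne]
  · simp [Prog.run]
  · simp [Prog.run]

/-- A loop whose only instruction changes the result register. -/
theorem iterate {g h : (ι → ℕ) → ℕ} (hg : NatComputable g) (hh : NatComputable h) (op : ℕ → ℕ)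
    (instr : ℕ → Prog) (hop : ∀ Φ S b, (instr b).run Φ S =
      (⟨Function.update S.nat b (op (S.nat b)), S.real⟩, 1)) (hle : ∀ x, op x ≤ x + 1) :
    NatComputable fun ρ => op^[h ρ] (g ρ) := by
  obtain ⟨q, hq, hg⟩ := hg
  obtain ⟨q', hq', hh⟩ := hh
  have hle' : ∀ k x, op^[k] x ≤ x + k := by
    intro k
    induction k with
    | zero => simp
    | succ k ih =>
      intro x
      rw [Function.iterate_succ_apply]
      have := ih (op x)
      have := hle x
      omega
  refine ⟨q + q' + q' * 2 + 1, fun ρ M hM => ?_, fun loc b hb => ?_⟩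
  · have := hq ρ M hM
    have := hq' ρ M hM
    have := hle' (h ρ) (g ρ)
    simp only [Polynomial.eval_add]
    omega
  obtain ⟨P, hP⟩ := hg loc b hb
  obtain ⟨P', hP'⟩ := hh loc (b + 1) fun i => (hb i).trans (Nat.lt_succ_self b)
  have inv : ∀ Φ S, _ := fun Φ S => run_loop Φ (instr b) (b + 1)
    (P'.run Φ (P.run Φ S).1).1 (fun i S' => (∀ r < b, S'.nat r = S.nat r) ∧ S'.real = S.real ∧
      S'.nat b = op^[i] (g fun i => S.nat (loc i))) (by
        refine ⟨fun r hr => ?_, ?_, ?_⟩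
        · rw [hP'.keep _ _ _ (hr.trans (Nat.lt_succ_self b)), hP.keep _ _ _ hr]
        · rw [hP'.real, hP.real]
        · rw [hP'.keep _ _ _ (Nat.lt_succ_self b), hP.val, Function.iterate_zero_apply]) (by
        rintro i S' - ⟨h1, h2, h3⟩
        rw [hop]
        refine ⟨fun r hr => ?_, h2, ?_⟩
        · simp [Function.update_of_ne hr.ne, h1 r hr]
        · simp only [Function.update_self, h3, Function.iterate_succ_apply'])
  have hcnt : ∀ Φ S, (P'.run Φ (P.run Φ S).1).1.nat (b + 1) = h fun i => S.nat (loc i) := by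
    intro Φ S
    rw [hP'.val]
    congr 1
    funext i
    exact hP.keep _ _ _ (hb i)
  refine ⟨.seq (.seq P P') (.loop (b + 1) (instr b)), ⟨fun Φ S => (inv Φ S).1.1,
    fun Φ S => (inv Φ S).1.2.1, fun Φ S => ?_, fun Φ S M hM => ?_⟩⟩
  · rw [← hcnt Φ S]; exact (inv Φ S).1.2.2
  · have h1 := (inv Φ S).2 1 fun i S' _ _ => by rw [hop]
    rw [hcnt] at h1
    have h2 := hq' _ M hM
    have h3 := hP.cost Φ S M hM
    have h4 := hP'.cost Φ (P.run Φ S).1 M fun i => by rw [hP.keep _ _ _ (hb i)]; exact hM i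
    simp only [Prog.run, Polynomial.eval_add, Polynomial.eval_mul, Polynomial.eval_ofNat,
      Polynomial.eval_one] at h1 ⊢
    omega

theorem add {g h : (ι → ℕ) → ℕ} (hg : NatComputable g) (hh : NatComputable h) :
    NatComputable fun ρ => g ρ + h ρ := by
  simpa [Nat.succ_iterate] using
    hg.iterate hh Nat.succ Prog.succ (fun _ _ _ => rfl) fun x => le_rfl

theorem tsub {g h : (ι → ℕ) → ℕ} (hg : NatComputable g) (hh : NatComputable h) :
    NatComputable fun ρ => g ρ - h ρ := by
  simpa [Nat.pred_iterate] using
    hg.iterate hh Nat.pred Prog.pred (fun _ _ _ => rfl) fun x => (Nat.pred_le x).trans x.le_succ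

end NatComputable

/-- The values `ρ`, together with the value `i` of one more variable. -/
def consEnv {ι : Type} (i : ℕ) (ρ : ι → ℕ) : Option ι → ℕ := fun o => o.elim i ρ

/-- Several functions of natural numbers can be computed one after the other, into consecutive
registers. -/
theorem exists_prog_tuple {ι : Type} (r : ℕ) (g : Fin r → (ι → ℕ) → ℕ)
    (hg : ∀ j, NatComputable (g j)) :
    ∃ q : Polynomial ℕ, (∀ ρ M, (∀ i, ρ i ≤ M) → ∀ j, g j ρ ≤ q.eval M) ∧
      ∀ (loc : ι → ℕ) (b : ℕ), (∀ i, loc i < b) → ∃ P : Prog, ∀ Φ S,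
        (∀ r < b, (P.run Φ S).1.nat r = S.nat r) ∧ (P.run Φ S).1.real = S.real ∧
        (∀ j : Fin r, (P.run Φ S).1.nat (b + j) = g j fun i => S.nat (loc i)) ∧
        ∀ M, (∀ i, S.nat (loc i) ≤ M) → (P.run Φ S).2 ≤ q.eval M := by
  induction r with
  | zero =>
    refine ⟨1, fun ρ M _ j => j.elim0, fun loc b hb => ⟨.const b 0, fun Φ S =>
      ⟨fun r hr => ?_, rfl, fun j => j.elim0, fun M _ => by simp [Prog.run]⟩⟩⟩
    simp [Prog.run, Function.update_of_ne hr.ne]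
  | succ r ih =>
    obtain ⟨q, hq, ih⟩ := ih (fun j => g j.castSucc) fun j => hg _
    obtain ⟨q', hq', hr⟩ := hg (Fin.last r)
    refine ⟨q + q', fun ρ M hM j => ?_, fun loc b hb => ?_⟩
    · rw [Polynomial.eval_add]
      induction j using Fin.lastCases with
      | last => exact (hq' ρ M hM).trans (Nat.le_add_left _ _)
      | cast j => exact (hq ρ M hM j).trans (Nat.le_add_right _ _)
    obtain ⟨P, hP⟩ := ih loc b hb
    obtain ⟨P', hP'⟩ := hr loc (b + r) fun i => (hb i).trans_le (Nat.le_add_right _ _)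
    refine ⟨.seq P P', fun Φ S => ?_⟩
    obtain ⟨h1, h2, h3, h4⟩ := hP Φ S
    have hloc : (fun i => (P.run Φ S).1.nat (loc i)) = fun i => S.nat (loc i) :=
      funext fun i => h1 _ (hb i)
    refine ⟨fun k hk => ?_, ?_, fun j => ?_, fun M hM => ?_⟩
    · simp only [Prog.run]
      rw [hP'.keep _ _ _ (by omega), h1 _ hk]
    · simp only [Prog.run]
      rw [hP'.real, h2]
    · simp only [Prog.run]
      induction j using Fin.lastCases with
      | last => rw [Fin.val_last, hP'.val, hloc]
      | cast j => rw [Fin.val_castSucc, hP'.keep _ _ _ (by have := j.2; omega)]; exact h3 j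
    · simp only [Prog.run, Polynomial.eval_add]
      exact add_le_add (h4 M hM) (hP'.cost Φ _ M fun i => by rw [h1 _ (hb i)]; exact hM i)

namespace NatComputable

variable {ι κ : Type}

theorem rename {g : (κ → ℕ) → ℕ} (hg : NatComputable g) (e : κ → ι) :
    NatComputable fun ρ => g fun j => ρ (e j) := by
  obtain ⟨q, hq, hg⟩ := hg
  refine ⟨q, fun ρ M hM => hq _ M fun j => hM _, fun loc b hb => ?_⟩
  obtain ⟨P, hP⟩ := hg (fun j => loc (e j)) b fun j => hb _
  exact ⟨P, ⟨hP.keep, hP.real, hP.val, fun Φ S M hM => hP.cost Φ S M fun j => hM _⟩⟩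

/-- A sum with a computable number of summands. -/
theorem sum_range {g : (ι → ℕ) → ℕ} {f : (Option ι → ℕ) → ℕ} (hg : NatComputable g)
    (hf : NatComputable f) : NatComputable fun ρ => ∑ i ∈ Finset.range (g ρ), f (consEnv i ρ) := by
  obtain ⟨q, hq, hg⟩ := hg
  obtain ⟨q', hq', hf⟩ := hf
  have hval : ∀ ρ M, (∀ i, ρ i ≤ M) → ∀ i < g ρ, f (consEnv i ρ) ≤ (q'.comp (.X + q)).eval M := by
    intro ρ M hM i hi
    rw [Polynomial.eval_comp]
    refine hq' _ _ fun o => ?_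
    have := hq ρ M hM
    cases o with
    | none => simp [consEnv]; omega
    | some j => have := hM j; simp [consEnv]; omega
  refine ⟨q * (3 * (q'.comp (.X + q)) + 2 + 1) + q + 4, fun ρ M hM => ?_, fun loc b hb => ?_⟩
  · have h1 := Finset.sum_le_card_nsmul (Finset.range (g ρ)) (fun i => f (consEnv i ρ))
      ((q'.comp (.X + q)).eval M) fun i hi => hval ρ M hM i (Finset.mem_range.1 hi)
    have h2 := Nat.mul_le_mul_right ((q'.comp (.X + q)).eval M) (hq ρ M hM)
    simp only [Finset.card_range, smul_eq_mul, Polynomial.eval_add, Polynomial.eval_mul,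
      Polynomial.eval_ofNat] at h1 h2 ⊢
    nlinarith
  -- Register `b` holds the sum, `b + 1` the number of passes, `b + 2` the index.
  obtain ⟨P, hP⟩ := hg loc (b + 1) fun i => (hb i).trans (Nat.lt_succ_self b)
  obtain ⟨P', hP'⟩ := hf (fun o => o.elim (b + 2) loc) (b + 3) fun o => by
    cases o with
    | none => simp
    | some j => have := hb j; simp; omega
  have inner : ∀ Φ S, _ := fun Φ S => run_loop Φ (.succ b) (b + 3) (P'.run Φ S).1
    (fun i S' => (∀ r < b + 3, r ≠ b → S'.nat r = S.nat r) ∧ S'.real = S.real ∧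
      S'.nat b = S.nat b + i) (by
        refine ⟨fun r hr _ => hP'.keep _ _ _ hr, hP'.real _ _, hP'.keep _ _ _ (by omega)⟩) (by
        rintro i S' - ⟨h1, h2, h3⟩
        refine ⟨fun r hr hrb => ?_, h2, ?_⟩
        · simp [Prog.run, Function.update_of_ne hrb, h1 r hr hrb]
        · simp only [Prog.run, Function.update_self, h3, add_assoc])
  set body : Prog := .seq (.seq P' (.loop (b + 3) (.succ b))) (.succ (b + 2)) with hbody
  have hbody_run : ∀ Φ S, (∀ r < b + 2, r ≠ b → (body.run Φ S).1.nat r = S.nat r) ∧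
      (body.run Φ S).1.real = S.real ∧ (body.run Φ S).1.nat (b + 2) = S.nat (b + 2) + 1 ∧
      (body.run Φ S).1.nat b =
        S.nat b + f (consEnv (S.nat (b + 2)) fun i => S.nat (loc i)) := by
    intro Φ S
    obtain ⟨⟨h1, h2, h3⟩, -⟩ := inner Φ S
    refine ⟨fun r hr hrb => ?_, h2, ?_, ?_⟩
    · simp only [hbody, Prog.run, Function.update_of_ne hr.ne]
      exact h1 r (by omega) hrb
    · simp only [hbody, Prog.run, Function.update_self]
      rw [← h1 (b + 2) (by omega) (by omega)]
      rfl
    · simp only [hbody, Prog.run]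
      rw [Function.update_of_ne (by omega)]
      refine h3.trans ?_
      rw [hP'.val]
      congr 2
      funext o
      cases o <;> rfl
  have hstart : ∀ Φ S r, r ≤ b →
      ((Prog.seq (.const b 0) (.seq P (.const (b + 2) 0))).run Φ S).1.nat r
      = if r = b then 0 else S.nat r := by
    intro Φ S r hr
    simp only [Prog.run]
    rw [Function.update_of_ne (by omega), hP.keep _ _ _ (by omega)]
    by_cases h : r = b <;> simp [h]
  have hcnt : ∀ Φ S, ((Prog.seq (.const b 0) (.seq P (.const (b + 2) 0))).run Φ S).1.nat (b + 1)
      = g fun i => S.nat (loc i) := by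
    intro Φ S
    simp only [Prog.run]
    rw [Function.update_of_ne (by omega), hP.val]
    congr 1
    funext i
    exact Function.update_of_ne (hb i).ne _ _
  have outer : ∀ Φ S, _ := fun Φ S => run_loop Φ body (b + 1)
    ((Prog.seq (.const b 0) (.seq P (.const (b + 2) 0))).run Φ S).1
    (fun i S' => (∀ r < b, S'.nat r = S.nat r) ∧ S'.real = S.real ∧ S'.nat (b + 2) = i ∧
      S'.nat b = ∑ i ∈ Finset.range i, f (consEnv i fun i => S.nat (loc i))) (by
        refine ⟨fun r hr => ?_, ?_, ?_, ?_⟩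
        · rw [hstart _ _ _ hr.le, if_neg hr.ne]
        · simp only [Prog.run]
          rw [hP.real]
        · simp [Prog.run]
        · rw [hstart _ _ _ le_rfl]; simp) (by
        rintro i S' - ⟨h1, h2, h3, h4⟩
        obtain ⟨g1, g2, g3, g4⟩ := hbody_run Φ S'
        refine ⟨fun r hr => ?_, ?_, ?_, ?_⟩
        · rw [g1 r (by omega) (by omega), h1 r hr]
        · rw [g2, h2]
        · rw [g3, h3]
        · rw [g4, h4, h3, Finset.sum_range_succ]
          congr 3
          funext j
          exact h1 _ (hb j))
  refine ⟨.seq (.seq (.const b 0) (.seq P (.const (b + 2) 0))) (.loop (b + 1) body),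
    ⟨fun Φ S => (outer Φ S).1.1, fun Φ S => (outer Φ S).1.2.1, fun Φ S => ?_, fun Φ S M hM => ?_⟩⟩
  · rw [← hcnt Φ S]; exact (outer Φ S).1.2.2.2
  · have h1 := (outer Φ S).2 (3 * (q'.comp (.X + q)).eval M + 2) (by
      rintro i S' hi ⟨h1, -, h3, -⟩
      rw [hcnt] at hi
      have e1 : (fun j => S'.nat (loc j)) = fun j => S.nat (loc j) := funext fun j => h1 _ (hb j)
      have e2 := (inner Φ S').2 1 fun i S' _ _ => le_rfl
      have e3 : (P'.run Φ S').1.nat (b + 3) = f (consEnv i fun j => S.nat (loc j)) := by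
        rw [hP'.val]
        congr 1
        funext o
        cases o with
        | none => exact h3
        | some j => exact h1 _ (hb j)
      rw [e3] at e2
      have e4 := hval _ M hM i hi
      have e5 := hP'.cost Φ S' ((Polynomial.X + q).eval M) fun o => by
        have := hq _ M hM
        rw [Polynomial.eval_add, Polynomial.eval_X]
        cases o with
        | none => simp only [Option.elim_none, h3]; omega
        | some j => simp only [Option.elim_some, h1 _ (hb j)]; have := hM j; omega
      rw [← Polynomial.eval_comp] at e5
      simp only [hbody, Prog.run] at e2 ⊢
      omega)
    rw [hcnt] at h1
    have h2 := hq _ M hM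
    have h3 := hP.cost Φ ((Prog.const b 0).run Φ S).1 M fun i => by
      simp only [Prog.run]
      rw [Function.update_of_ne (hb i).ne]
      exact hM i
    have h4 := Nat.mul_le_mul_right (3 * (q'.comp (.X + q)).eval M + 2 + 1) h2
    simp only [Prog.run, Polynomial.eval_add, Polynomial.eval_mul, Polynomial.eval_ofNat,
      Polynomial.eval_one] at h1 h3 h4 ⊢
    omega

theorem mul {g h : (ι → ℕ) → ℕ} (hg : NatComputable g) (hh : NatComputable h) :
    NatComputable fun ρ => g ρ * h ρ := by
  simpa [consEnv] using hg.sum_range (hh.rename some)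

theorem sum {α : Type} (s : Finset α) {f : α → (ι → ℕ) → ℕ} (hf : ∀ a ∈ s, NatComputable (f a)) :
    NatComputable fun ρ => ∑ a ∈ s, f a ρ := by
  classical
  induction s using Finset.induction_on with
  | empty => simpa using const 0
  | insert a s ha ih =>
    simp only [Finset.sum_insert ha]
    exact (hf a (by simp)).add (ih fun b hb => hf b (by simp [hb]))

theorem prod {α : Type} (s : Finset α) {f : α → (ι → ℕ) → ℕ} (hf : ∀ a ∈ s, NatComputable (f a)) :
    NatComputable fun ρ => ∏ a ∈ s, f a ρ := by
  classical
  induction s using Finset.induction_on with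
  | empty => simpa using const 1
  | insert a s ha ih =>
    simp only [Finset.prod_insert ha]
    exact (hf a (by simp)).mul (ih fun b hb => hf b (by simp [hb]))

/-- The test whether two numbers are equal. -/
theorem ite_eq {g h : (ι → ℕ) → ℕ} (hg : NatComputable g) (hh : NatComputable h) :
    NatComputable fun ρ => if g ρ = h ρ then 1 else 0 := by
  convert (const 1).tsub ((hg.tsub hh).add (hh.tsub hg)) using 2 with ρ
  split_ifs <;> omega

theorem choose {g : (ι → ℕ) → ℕ} (hg : NatComputable g) (c : ℕ) :
    NatComputable fun ρ => (g ρ).choose c := by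
  induction c generalizing ι with
  | zero => simpa using const 1
  | succ c ih =>
    have hsum : ∀ n : ℕ, n.choose (c + 1) = ∑ i ∈ Finset.range n, i.choose c := fun n => by
      induction n with
      | zero => simp
      | succ n ih => rw [Finset.sum_range_succ, ← ih, Nat.choose_succ_succ, add_comm]
    simpa [consEnv, hsum] using hg.sum_range (ih (var (none : Option ι)))

end NatComputable

namespace RealComputable

variable {ι κ : Type}

/-- Instructions that change the result register only. -/
theorem instr (a : (ℕ → List ℕ → ℝ) → ℝ) (p : ℕ → Prog)
    (hp : ∀ Φ S y, (p y).run Φ S = (⟨S.nat, Function.update S.real y (a Φ)⟩, 1)) :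
    RealComputable fun (_ : ι → ℕ) Φ => a Φ := by
  refine ⟨1, fun loc b y _ => ⟨p y, ⟨fun Φ S r hr => ?_, fun Φ S x hx => ?_, fun Φ S => ?_,
    fun Φ S M h => ?_⟩⟩⟩
  · simp [hp]
  · simp [hp, Function.update_of_ne hx.ne]
  · simp [hp]
  · simp [hp]

theorem zero : RealComputable fun (_ : ι → ℕ) _ => 0 := instr _ .zero fun _ _ _ => rfl

theorem one : RealComputable fun (_ : ι → ℕ) _ => 1 := instr _ .one fun _ _ _ => rfl

theorem load (f : ℕ) (vs : List ℕ) : RealComputable fun (_ : ι → ℕ) Φ => Φ f vs :=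
  instr (fun Φ => Φ f vs) (fun y => .load y f vs) fun _ _ _ => rfl

/-- The arithmetical instructions. -/
theorem binop {f g : (ι → ℕ) → (ℕ → List ℕ → ℝ) → ℝ} (hf : RealComputable f)
    (hg : RealComputable g) (op : ℝ → ℝ → ℝ) (p : ℕ → ℕ → ℕ → Prog)
    (hp : ∀ Φ S x y z, (p x y z).run Φ S =
      (⟨S.nat, Function.update S.real x (op (S.real y) (S.real z))⟩, 1)) :
    RealComputable fun ρ Φ => op (f ρ Φ) (g ρ Φ) := by
  obtain ⟨q, hf⟩ := hf
  obtain ⟨q', hg⟩ := hg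
  refine ⟨q + q' + 1, fun loc b y hb => ?_⟩
  obtain ⟨P, hP⟩ := hf loc b y hb
  obtain ⟨P', hP'⟩ := hg loc b (y + 1) hb
  have hloc : ∀ Φ S, (fun i => (P.run Φ S).1.nat (loc i)) = fun i => S.nat (loc i) :=
    fun Φ S => funext fun i => hP.keep _ _ _ (hb i)
  refine ⟨.seq (.seq P P') (p y y (y + 1)), ⟨fun Φ S r hr => ?_, fun Φ S x hx => ?_,
    fun Φ S => ?_, fun Φ S M hM => ?_⟩⟩
  · simp only [Prog.run, hp]
    rw [hP'.keep _ _ _ hr, hP.keep _ _ _ hr]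
  · simp only [Prog.run, hp, Function.update_of_ne hx.ne]
    rw [hP'.keepReal _ _ _ (by omega), hP.keepReal _ _ _ hx]
  · simp only [Prog.run, hp, Function.update_self]
    rw [hP'.keepReal _ _ _ (by omega), hP.val, hP'.val, hloc]
  · have h1 := hP.cost Φ S M hM
    have h2 := hP'.cost Φ (P.run Φ S).1 M fun i => by rw [hP.keep _ _ _ (hb i)]; exact hM i
    simp only [Prog.run, hp, Polynomial.eval_add, Polynomial.eval_one]
    omega

section Arithmetic

variable {f g : (ι → ℕ) → (ℕ → List ℕ → ℝ) → ℝ}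

theorem add (hf : RealComputable f) (hg : RealComputable g) :
    RealComputable fun ρ Φ => f ρ Φ + g ρ Φ := hf.binop hg (· + ·) .add fun _ _ _ _ _ => rfl

theorem mul (hf : RealComputable f) (hg : RealComputable g) :
    RealComputable fun ρ Φ => f ρ Φ * g ρ Φ := hf.binop hg (· * ·) .mul fun _ _ _ _ _ => rfl

theorem div (hf : RealComputable f) (hg : RealComputable g) :
    RealComputable fun ρ Φ => f ρ Φ / g ρ Φ := hf.binop hg (· / ·) .div fun _ _ _ _ _ => rfl

end Arithmetic

theorem rename {f : (κ → ℕ) → (ℕ → List ℕ → ℝ) → ℝ} (hf : RealComputable f) (e : κ → ι) :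
    RealComputable fun ρ => f fun j => ρ (e j) := by
  obtain ⟨q, hf⟩ := hf
  refine ⟨q, fun loc b y hb => ?_⟩
  obtain ⟨P, hP⟩ := hf (fun j => loc (e j)) b y fun j => hb _
  exact ⟨P, ⟨hP.keep, hP.keepReal, hP.val, fun Φ S M hM => hP.cost Φ S M fun j => hM _⟩⟩

theorem comp [Finite κ] {f : (κ → ℕ) → (ℕ → List ℕ → ℝ) → ℝ} (hf : RealComputable f)
    {h : κ → (ι → ℕ) → ℕ} (hh : ∀ j, NatComputable (h j)) :
    RealComputable fun ρ => f fun j => h j ρ := by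
  obtain ⟨r, ⟨e⟩⟩ := Finite.exists_equiv_fin κ
  obtain ⟨q, hq, hh⟩ := exists_prog_tuple r (fun j => h (e.symm j)) fun j => hh _
  obtain ⟨q', hf⟩ := hf
  refine ⟨q + q'.comp q, fun loc b y hb => ?_⟩
  obtain ⟨P, hP⟩ := hh loc b hb
  obtain ⟨P', hP'⟩ := hf (fun j => b + e j) (b + r) y fun j => by have := (e j).2; omega
  have hv : ∀ Φ S j, (P.run Φ S).1.nat (b + e j) = h j fun i => S.nat (loc i) := fun Φ S j => by
    simpa using (hP Φ S).2.2.1 (e j)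
  refine ⟨.seq P P', ⟨fun Φ S k hk => ?_, fun Φ S x hx => ?_, fun Φ S => ?_, fun Φ S M hM => ?_⟩⟩
  · simp only [Prog.run]
    rw [hP'.keep _ _ _ (by omega), (hP Φ S).1 _ hk]
  · simp only [Prog.run]
    rw [hP'.keepReal _ _ _ hx, (hP Φ S).2.1]
  · simp only [Prog.run]
    rw [hP'.val]
    simp only [hv]
  · have h1 := (hP Φ S).2.2.2 M hM
    have h2 := hP'.cost Φ (P.run Φ S).1 (q.eval M) fun j => by
      rw [hv]
      simpa using hq _ M hM (e j)
    simp only [Prog.run, Polynomial.eval_add, Polynomial.eval_comp]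
    omega

/-- Accumulation, with a binary operation, of a computable number of values. -/
theorem fold {g : (ι → ℕ) → ℕ} {f : (Option ι → ℕ) → (ℕ → List ℕ → ℝ) → ℝ} (hg : NatComputable g)
    (hf : RealComputable f) (e : ℝ) (op : ℝ → ℝ → ℝ) (p₀ : ℕ → Prog) (p : ℕ → ℕ → ℕ → Prog)
    (hp₀ : ∀ Φ S x, (p₀ x).run Φ S = (⟨S.nat, Function.update S.real x e⟩, 1))
    (hp : ∀ Φ S x y z, (p x y z).run Φ S =
      (⟨S.nat, Function.update S.real x (op (S.real y) (S.real z))⟩, 1))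
    (F : (ι → ℕ) → (ℕ → List ℕ → ℝ) → ℕ → ℝ) (hF0 : ∀ ρ Φ, F ρ Φ 0 = e)
    (hF : ∀ ρ Φ i, F ρ Φ (i + 1) = op (F ρ Φ i) (f (consEnv i ρ) Φ)) :
    RealComputable fun ρ Φ => F ρ Φ (g ρ) := by
  obtain ⟨q, hq, hg⟩ := hg
  obtain ⟨q', hf⟩ := hf
  refine ⟨q * (q'.comp (.X + q) + 2 + 1) + q + 4, fun loc b y hb => ?_⟩
  -- Register `b` holds the number of passes, `b + 1` the index.
  obtain ⟨P, hP⟩ := hg loc b hb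
  obtain ⟨P', hP'⟩ := hf (fun o => o.elim (b + 1) loc) (b + 2) (y + 1) fun o => by
    cases o with
    | none => simp
    | some j => have := hb j; simp; omega
  set body : Prog := .seq (.seq P' (p y y (y + 1))) (.succ (b + 1)) with hbody
  have hbody_run : ∀ Φ S, (∀ r < b + 1, (body.run Φ S).1.nat r = S.nat r) ∧
      (∀ x < y, (body.run Φ S).1.real x = S.real x) ∧
      (body.run Φ S).1.nat (b + 1) = S.nat (b + 1) + 1 ∧
      (body.run Φ S).1.real y =
        op (S.real y) (f (consEnv (S.nat (b + 1)) fun i => S.nat (loc i)) Φ) := by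
    intro Φ S
    refine ⟨fun r hr => ?_, fun x hx => ?_, ?_, ?_⟩
    · simp only [hbody, Prog.run, hp, Function.update_of_ne hr.ne]
      exact hP'.keep _ _ _ (by omega)
    · simp only [hbody, Prog.run, hp, Function.update_of_ne hx.ne]
      exact hP'.keepReal _ _ _ (by omega)
    · simp only [hbody, Prog.run, hp, Function.update_self]
      rw [hP'.keep _ _ _ (by omega)]
    · simp only [hbody, Prog.run, hp, Function.update_self]
      rw [hP'.val, hP'.keepReal _ _ _ (by omega)]
      congr 2
      funext o
      cases o <;> rfl
  set start : Prog := .seq (p₀ y) (.seq P (.const (b + 1) 0)) with hstart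
  have hcnt : ∀ Φ S, (start.run Φ S).1.nat b = g fun i => S.nat (loc i) := by
    intro Φ S
    simp only [hstart, Prog.run, hp₀]
    rw [Function.update_of_ne (by omega), hP.val]
  have outer : ∀ Φ S, _ := fun Φ S => run_loop Φ body b (start.run Φ S).1
    (fun i S' => (∀ r < b, S'.nat r = S.nat r) ∧ (∀ x < y, S'.real x = S.real x) ∧
      S'.nat (b + 1) = i ∧ S'.real y = F (fun i => S.nat (loc i)) Φ i) (by
        refine ⟨fun r hr => ?_, fun x hx => ?_, ?_, ?_⟩
        · simp only [hstart, Prog.run, hp₀]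
          rw [Function.update_of_ne (by omega), hP.keep _ _ _ hr]
        · simp only [hstart, Prog.run, hp₀]
          rw [hP.real]
          exact Function.update_of_ne hx.ne _ _
        · simp [hstart, Prog.run]
        · simp only [hstart, Prog.run, hp₀]
          rw [hP.real, hF0]
          exact Function.update_self _ _ _) (by
        rintro i S' - ⟨h1, h2, h3, h4⟩
        obtain ⟨g1, g2, g3, g4⟩ := hbody_run Φ S'
        refine ⟨fun r hr => ?_, fun x hx => ?_, ?_, ?_⟩
        · rw [g1 r (by omega), h1 r hr]
        · rw [g2 x hx, h2 x hx]
        · rw [g3, h3]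
        · rw [g4, h4, h3, hF]
          congr 3
          funext j
          exact h1 _ (hb j))
  refine ⟨.seq start (.loop b body), ⟨fun Φ S => (outer Φ S).1.1, fun Φ S => (outer Φ S).1.2.1,
    fun Φ S => ?_, fun Φ S M hM => ?_⟩⟩
  · rw [← hcnt Φ S]; exact (outer Φ S).1.2.2.2
  · have h1 := (outer Φ S).2 ((q'.comp (.X + q)).eval M + 2) (by
      rintro i S' hi ⟨h1, -, h3, -⟩
      rw [hcnt] at hi
      have e5 := hP'.cost Φ S' ((Polynomial.X + q).eval M) fun o => by
        have := hq _ M hM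
        rw [Polynomial.eval_add, Polynomial.eval_X]
        cases o with
        | none => simp only [Option.elim_none, h3]; omega
        | some j => simp only [Option.elim_some, h1 _ (hb j)]; have := hM j; omega
      rw [← Polynomial.eval_comp] at e5
      simp only [hbody, Prog.run, hp]
      omega)
    rw [hcnt] at h1
    have h2 := hq _ M hM
    have h3 := hP.cost Φ ((p₀ y).run Φ S).1 M fun i => by
      rw [hp₀]
      exact hM i
    have h4 := Nat.mul_le_mul_right ((q'.comp (.X + q)).eval M + 2 + 1) h2
    simp only [hstart, Prog.run, hp₀, Polynomial.eval_add, Polynomial.eval_mul,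
      Polynomial.eval_ofNat, Polynomial.eval_one] at h1 h3 h4 ⊢
    omega

theorem sum_range {g : (ι → ℕ) → ℕ} {f : (Option ι → ℕ) → (ℕ → List ℕ → ℝ) → ℝ}
    (hg : NatComputable g) (hf : RealComputable f) :
    RealComputable fun ρ Φ => ∑ i ∈ Finset.range (g ρ), f (consEnv i ρ) Φ :=
  fold hg hf 0 (· + ·) .zero .add (fun _ _ _ => rfl) (fun _ _ _ _ _ => rfl)
    (fun ρ Φ n => ∑ i ∈ Finset.range n, f (consEnv i ρ) Φ) (fun _ _ => by simp)
    fun _ _ _ => Finset.sum_range_succ _ _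

theorem prod_range {g : (ι → ℕ) → ℕ} {f : (Option ι → ℕ) → (ℕ → List ℕ → ℝ) → ℝ}
    (hg : NatComputable g) (hf : RealComputable f) :
    RealComputable fun ρ Φ => ∏ i ∈ Finset.range (g ρ), f (consEnv i ρ) Φ :=
  fold hg hf 1 (· * ·) .one .mul (fun _ _ _ => rfl) (fun _ _ _ _ _ => rfl)
    (fun ρ Φ n => ∏ i ∈ Finset.range n, f (consEnv i ρ) Φ) (fun _ _ => by simp)
    fun _ _ _ => Finset.prod_range_succ _ _

theorem natCast {g : (ι → ℕ) → ℕ} (hg : NatComputable g) :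
    RealComputable fun ρ _ => (g ρ : ℝ) := by
  simpa using sum_range hg one

theorem pow {f : (ι → ℕ) → (ℕ → List ℕ → ℝ) → ℝ} (hf : RealComputable f) {g : (ι → ℕ) → ℕ}
    (hg : NatComputable g) : RealComputable fun ρ Φ => f ρ Φ ^ g ρ := by
  simpa [consEnv] using prod_range hg (hf.rename some)

/-- Factorials are not polynomially bounded; they are available as real values only, and cannot
serve as numbers of passes through a loop. -/
theorem factorial {g : (ι → ℕ) → ℕ} (hg : NatComputable g) :
    RealComputable fun ρ _ => ((g ρ).factorial : ℝ) := by
  have := prod_range hg (natCast ((NatComputable.var none).add (.const 1)))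
  simpa [consEnv, ← Finset.prod_range_add_one_eq_factorial] using this

theorem sum {α : Type} (s : Finset α) {f : α → (ι → ℕ) → (ℕ → List ℕ → ℝ) → ℝ}
    (hf : ∀ a ∈ s, RealComputable (f a)) : RealComputable fun ρ Φ => ∑ a ∈ s, f a ρ Φ := by
  classical
  induction s using Finset.induction_on with
  | empty => simpa using zero
  | insert a s ha ih =>
    simp only [Finset.sum_insert ha]
    exact (hf a (by simp)).add (ih fun b hb => hf b (by simp [hb]))

theorem prod {α : Type} (s : Finset α) {f : α → (ι → ℕ) → (ℕ → List ℕ → ℝ) → ℝ}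
    (hf : ∀ a ∈ s, RealComputable (f a)) : RealComputable fun ρ Φ => ∏ a ∈ s, f a ρ Φ := by
  classical
  induction s using Finset.induction_on with
  | empty => simpa using one
  | insert a s ha ih =>
    simp only [Finset.prod_insert ha]
    exact (hf a (by simp)).mul (ih fun b hb => hf b (by simp [hb]))

/-- A sum over all vectors of natural numbers with computable bounds for the entries. -/
theorem sum_piFinset [Fintype κ] [DecidableEq κ] {g : κ → (ι → ℕ) → ℕ}
    {f : (ι ⊕ κ → ℕ) → (ℕ → List ℕ → ℝ) → ℝ}
    (hg : ∀ j, NatComputable (g j)) (hf : RealComputable f) :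
    RealComputable fun ρ Φ =>
      ∑ k ∈ Fintype.piFinset fun j => Finset.range (g j ρ), f (Sum.elim ρ k) Φ := by
  classical
  have key : ∀ (κ : Type) [Fintype κ], ∀ (ι : Type) (g : κ → (ι → ℕ) → ℕ)
      (f : (ι ⊕ κ → ℕ) → (ℕ → List ℕ → ℝ) → ℝ), (∀ j, NatComputable (g j)) → RealComputable f →
      RealComputable fun ρ Φ =>
        ∑ k ∈ Fintype.piFinset fun j => Finset.range (g j ρ), f (Sum.elim ρ k) Φ := by
    refine Fintype.induction_empty_option ?_ ?_ ?_
    · intro α β _ e ih ι g f hg hf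
      convert ih ι (fun j => g (e j)) (fun ρ => f fun j => ρ (j.map id e.symm)) (fun j => hg _)
        (hf.rename _) using 3 with ρ Φ
      refine Finset.sum_nbij' (fun k => k ∘ e) (fun k => k ∘ e.symm) ?_ ?_ ?_ ?_ ?_
      · intro k hk
        simp only [Fintype.mem_piFinset, Finset.mem_range] at hk ⊢
        exact fun j => hk _
      · intro k hk
        simp only [Fintype.mem_piFinset, Finset.mem_range] at hk ⊢
        exact fun j => by simpa using hk (e.symm j)
      · intro k _
        simp [Function.comp_assoc]
      · intro k _
        simp [Function.comp_assoc]
      · intro k _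
        congr 1
        funext j
        cases j <;> simp
    · intro ι g f hg hf
      have := hf.rename (ι := ι) (Sum.elim id PEmpty.elim)
      convert this using 3 with ρ Φ
      simp only [Fintype.piFinset_of_isEmpty, Finset.univ_unique, Finset.sum_singleton]
      congr 1
      funext j
      rcases j with j | ⟨⟨⟩⟩
      rfl
    · intro α _ ih ι g f hg hf
      have := sum_range (hg none) (ih (Option ι) (fun j ρ => g (some j) fun i => ρ (some i))
        (fun ρ => f fun j => ρ (j.elim (fun i => .inl (some i))
          fun o => o.elim (.inl none) .inr)) (fun j => (hg _).rename _) (hf.rename _))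
      convert this using 3 with ρ Φ
      simp only [consEnv, Option.elim_some]
      rw [Finset.sum_sigma']
      refine Finset.sum_nbij' (fun k => ⟨k none, fun j => k (some j)⟩)
        (fun k o => o.elim k.1 k.2) ?_ ?_ ?_ ?_ ?_
      · intro k hk
        simp only [Fintype.mem_piFinset, Finset.mem_range, Finset.mem_sigma] at hk ⊢
        exact ⟨hk _, fun j => hk _⟩
      · rintro ⟨i, k⟩ hk
        simp only [Fintype.mem_piFinset, Finset.mem_range, Finset.mem_sigma] at hk ⊢
        intro o
        cases o
        exacts [hk.1, hk.2 _]
      · intro k _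
        funext o
        cases o <;> rfl
      · intro k _
        rfl
      · intro k _
        congr 1
        funext j
        rcases j with j | _ | j <;> rfl
  convert key κ ι g f hg hf

/-- The potential functions may be fixed, if their values are `0` and `1`. -/
theorem specialize {f : (ι → ℕ) → (ℕ → List ℕ → ℝ) → ℝ} (hf : RealComputable f)
    (Φ₀ : ℕ → List ℕ → ℝ) (hΦ₀ : ∀ i vs, Φ₀ i vs = 0 ∨ Φ₀ i vs = 1) :
    RealComputable fun ρ _ => f ρ Φ₀ := by
  have key : ∀ P : Prog, ∃ P' : Prog, ∀ Φ, P'.run Φ = P.run Φ₀ := by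
    intro P
    induction P with
    | load x i vs =>
      rcases hΦ₀ i vs with h | h
      · exact ⟨.zero x, fun Φ => by funext S; simp [Prog.run, h]⟩
      · exact ⟨.one x, fun Φ => by funext S; simp [Prog.run, h]⟩
    | seq p q hp hq =>
      obtain ⟨p', hp⟩ := hp
      obtain ⟨q', hq⟩ := hq
      exact ⟨.seq p' q', fun Φ => by funext S; simp [Prog.run, hp, hq]⟩
    | ifZero r p q hp hq =>
      obtain ⟨p', hp⟩ := hp
      obtain ⟨q', hq⟩ := hq
      exact ⟨.ifZero r p' q', fun Φ => by funext S; simp [Prog.run, hp, hq]⟩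
    | loop r p hp =>
      obtain ⟨p', hp⟩ := hp
      exact ⟨.loop r p', fun Φ => by funext S; simp [Prog.run, hp]⟩
    | const r c => exact ⟨.const r c, fun _ => rfl⟩
    | copy r r' => exact ⟨.copy r r', fun _ => rfl⟩
    | succ r => exact ⟨.succ r, fun _ => rfl⟩
    | pred r => exact ⟨.pred r, fun _ => rfl⟩
    | zero x => exact ⟨.zero x, fun _ => rfl⟩
    | one x => exact ⟨.one x, fun _ => rfl⟩
    | add x y z => exact ⟨.add x y z, fun _ => rfl⟩
    | mul x y z => exact ⟨.mul x y z, fun _ => rfl⟩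
    | div x y z => exact ⟨.div x y z, fun _ => rfl⟩
  obtain ⟨q, hf⟩ := hf
  refine ⟨q, fun loc b y hb => ?_⟩
  obtain ⟨P, hP⟩ := hf loc b y hb
  obtain ⟨P', h⟩ := key P
  refine ⟨P', ⟨fun Φ => ?_, fun Φ => ?_, fun Φ => ?_, fun Φ => ?_⟩⟩ <;> rw [h]
  exacts [hP.keep Φ₀, hP.keepReal Φ₀, hP.val Φ₀, hP.cost Φ₀]

end RealComputable

/-! ### Averages over assignments -/

section Average

open scoped Classical BigOperators

variable {V : Type} [Fintype V] {D : V → Type} [∀ v, Fintype (D v)]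

/-- The average of `f` over all assignments that agree with `ω` outside `S`. -/
noncomputable def average (S : Set V) (f : (∀ v, D v) → ℝ) (ω : ∀ v, D v) : ℝ :=
  𝔼 τ, f (S.piecewise τ ω)

/-- The function `f` of the assignment depends only on the values of the variables in `S`. -/
def DependsOnly (f : (∀ v, D v) → ℝ) (S : Set V) : Prop :=
  ∀ ω ω', (∀ v ∈ S, ω v = ω' v) → f ω = f ω'

theorem average_congr {S : Set V} {f g : (∀ v, D v) → ℝ} {ω : ∀ v, D v}
    (h : ∀ τ, (∀ v ∉ S, τ v = ω v) → f τ = g τ) : average S f ω = average S g ω :=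
  Finset.expect_congr rfl fun _ _ => h _ fun _ hv => Set.piecewise_eq_of_notMem _ _ _ hv

theorem average_congr_right {S : Set V} {f : (∀ v, D v) → ℝ} {ω ω' : ∀ v, D v}
    (h : ∀ v ∉ S, ω v = ω' v) : average S f ω = average S f ω' := by
  refine Finset.expect_congr rfl fun τ _ => congrArg f (funext fun v => ?_)
  by_cases hv : v ∈ S
  · simp [hv]
  · simp [hv, h v hv]

variable [∀ v, Nonempty (D v)]

/-- Mixing two independent uniform assignments gives a uniform assignment. -/
theorem expect_expect_piecewise (S : Set V) (f : (∀ v, D v) → ℝ) :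
    𝔼 τ, 𝔼 τ', f (S.piecewise τ' τ) = 𝔼 τ, f τ := by
  rw [← Finset.expect_product']
  have hinv : Function.Involutive fun p : (∀ v, D v) × (∀ v, D v) =>
      (S.piecewise p.2 p.1, S.piecewise p.1 p.2) := by
    rintro ⟨τ, τ'⟩
    refine Prod.ext (funext fun v => ?_) (funext fun v => ?_) <;>
      by_cases hv : v ∈ S <;> simp [hv]
  rw [Finset.univ_product_univ, Fintype.expect_equiv (Function.Involutive.toPerm _ hinv)
    (fun p => f (S.piecewise p.2 p.1)) (fun p => f p.1) fun p => rfl,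
    ← Finset.univ_product_univ, Finset.expect_product]
  exact Finset.expect_congr rfl fun τ _ => Fintype.expect_const (f τ)

theorem average_eq_of_forall {S : Set V} {f : (∀ v, D v) → ℝ} {ω : ∀ v, D v} {c : ℝ}
    (h : ∀ τ, (∀ v ∉ S, τ v = ω v) → f τ = c) : average S f ω = c :=
  (average_congr h).trans (Fintype.expect_const c)

theorem average_average {S S' : Set V} (h : S' ⊆ S) (f : (∀ v, D v) → ℝ) (ω : ∀ v, D v) :
    average S (average S' f) ω = average S f ω := by
  unfold average
  rw [← expect_expect_piecewise S' fun τ => f (S.piecewise τ ω)]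
  refine Finset.expect_congr rfl fun τ _ => Finset.expect_congr rfl fun τ' _ =>
    congrArg f (funext fun v => ?_)
  by_cases hv : v ∈ S'
  · simp [hv, h hv]
  · by_cases hv' : v ∈ S <;> simp [hv, hv']

theorem average_mul {S A B : Set V} {f g : (∀ v, D v) → ℝ} (hf : DependsOnly f A)
    (hg : DependsOnly g B) (h : ∀ v ∈ A, v ∈ B → v ∉ S) (ω : ∀ v, D v) :
    average S (fun ω => f ω * g ω) ω = average S f ω * average S g ω := by
  unfold average
  rw [Fintype.expect_mul_expect,
    ← expect_expect_piecewise B fun τ => f (S.piecewise τ ω) * g (S.piecewise τ ω)]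
  refine Finset.expect_congr rfl fun τ _ => Finset.expect_congr rfl fun τ' _ => ?_
  congr 1
  · refine hf _ _ fun v hv => ?_
    by_cases hS : v ∈ S
    · have hB : v ∉ B := fun hB => h v hv hB hS
      simp [hS, hB]
    · simp [hS]
  · refine hg _ _ fun v hv => ?_
    by_cases hS : v ∈ S <;> simp [hS, hv]

omit [Fintype V] [∀ v, Fintype (D v)] [∀ v, Nonempty (D v)] in
theorem DependsOnly.prod {κ : Type} (s : Finset κ) {f : κ → (∀ v, D v) → ℝ} {A : κ → Set V}
    (hf : ∀ i ∈ s, DependsOnly (f i) (A i)) :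
    DependsOnly (fun ω => ∏ i ∈ s, f i ω) (⋃ i ∈ s, A i) := fun ω ω' h =>
  Finset.prod_congr rfl fun i hi => hf i hi ω ω' fun v hv => h v (Set.mem_biUnion hi hv)

/-- Functions that share no averaged variable are independent. -/
theorem average_prod {κ : Type} (s : Finset κ) {S : Set V} {f : κ → (∀ v, D v) → ℝ}
    {A : κ → Set V} (hf : ∀ i, DependsOnly (f i) (A i))
    (h : ∀ i j, i ≠ j → ∀ v ∈ A i, v ∈ A j → v ∉ S) (ω : ∀ v, D v) :
    average S (fun ω => ∏ i ∈ s, f i ω) ω = ∏ i ∈ s, average S (f i) ω := by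
  induction s using Finset.induction_on with
  | empty => simp [average]
  | insert a s ha ih =>
    simp only [Finset.prod_insert ha, ← ih]
    refine average_mul (hf a) (DependsOnly.prod s fun i _ => hf i) (fun v hv hv' => ?_) ω
    obtain ⟨i, hi, hvi⟩ := Set.mem_iUnion₂.1 hv'
    exact h a i (fun e => ha (e ▸ hi)) v hv hvi

/-- The restriction of a uniform assignment along an injective map is uniform. -/
theorem expect_comp_injective {V' : Type} [Fintype V'] {j : V' → V} (hj : Function.Injective j)
    (f : (∀ w, D (j w)) → ℝ) :
    𝔼 τ : ∀ v, D v, f (fun w => τ (j w)) = 𝔼 τ' : ∀ w, D (j w), f τ' := by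
  let e := Equiv.piEquivPiSubtypeProd (fun v => v ∈ Set.range j) D
  rw [Fintype.expect_equiv e (fun τ => f fun w => τ (j w))
      (fun p => f fun w => p.1 ⟨j w, w, rfl⟩) fun τ => rfl,
    ← Finset.univ_product_univ, Finset.expect_product]
  let e' := Equiv.piCongrLeft (fun v : Set.range j => D v) (Equiv.ofInjective j hj)
  refine (Fintype.expect_equiv e' f _ fun τ => ?_).symm
  · refine Eq.trans (congrArg f (funext fun w => ?_)) (Fintype.expect_const
      (ι := ∀ i : {x // x ∉ Set.range j}, D i) (f fun w => e' τ ⟨j w, w, rfl⟩)).symm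
    exact (Equiv.piCongrLeft_apply_apply (fun v : Set.range j => D v) (Equiv.ofInjective j hj)
      τ w).symm

/-- An average over the values of the variables `j w`, which are given by a value of type `A` and by
one value of type `B` for each element of `X`. -/
theorem average_eq_sum_div {V' A B X : Type} [Fintype V'] [Fintype A] [Fintype B] [Fintype X]
    {j : V' → V} (hj : Function.Injective j) (e : (∀ w, D (j w)) ≃ A × (X → B)) {S : Set V}
    {f : (∀ v, D v) → ℝ} {ω : ∀ v, D v} (H : A × (X → B) → ℝ)
    (h : ∀ τ, f (S.piecewise τ ω) = H (e fun w => τ (j w))) :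
    average S f ω = (∑ a, ∑ c, H (a, c)) /
      ((Fintype.card A : ℝ) * (Fintype.card B : ℝ) ^ Fintype.card X) := by
  rw [average, Finset.expect_congr rfl fun τ _ => h τ, expect_comp_injective hj fun τ => H (e τ),
    Fintype.expect_equiv e (fun τ => H (e τ)) H fun _ => rfl, Fintype.expect_eq_sum_div_card,
    Fintype.sum_prod_type, Fintype.card_prod, Fintype.card_fun]
  push_cast
  rfl

end Average

/-! ### Histograms -/

section Histogram

open scoped Classical

variable {X X' T U : Type}

/-- The number of objects of each type. -/
noncomputable def hist (b : X → T) (t : T) : ℕ := Nat.card {x // b x = t}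

theorem hist_comp_equiv (b : X → T) (e : X' ≃ X) : hist (fun x => b (e x)) = hist b :=
  funext fun _ => Nat.card_congr (e.subtypeEquiv fun _ => Iff.rfl)

theorem hist_map [Finite X] [Fintype T] (b : X → T) (φ : T → U) (u : U) :
    hist (fun x => φ (b x)) u = ∑ t with φ t = u, hist b t := by
  have := Fintype.ofFinite X
  simp only [hist, Nat.card_eq_fintype_card, Fintype.card_subtype]
  rw [Finset.card_eq_sum_card_fiberwise (f := b) (t := Finset.univ.filter fun t => φ t = u)]
  · refine Finset.sum_congr rfl fun t ht => congrArg _ (Finset.ext fun x => ?_)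
    have := (Finset.mem_filter.1 ht).2
    simp only [Finset.mem_filter, Finset.mem_univ, true_and]
    constructor
    · exact fun h => h.2
    · rintro rfl
      exact ⟨this, rfl⟩
  · intro x hx
    simpa using hx

/-- Families with equal histograms agree up to a bijection. -/
theorem exists_equiv_of_hist_eq [Finite X] [Finite X'] {b : X → T} {b' : X' → T}
    (h : hist b = hist b') : ∃ e : X ≃ X', ∀ x, b' (e x) = b x := by
  have e : ∀ t, Nonempty ({x // b x = t} ≃ {x // b' x = t}) := fun t =>
    ⟨(Finite.equivFinOfCardEq (congrFun h t)).trans (Finite.equivFin _).symm⟩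
  exact ⟨Equiv.ofFiberEquiv fun t => (e t).some, fun x => Equiv.ofFiberEquiv_map _ x⟩

theorem sum_hist [Finite X] [Fintype T] (b : X → T) : ∑ t, hist b t = Nat.card X := by
  have := hist_map b (fun _ => ()) ()
  simp only [Finset.filter_true] at this
  rw [← this]
  exact Nat.card_congr (Equiv.subtypeUnivEquiv fun _ => rfl)

theorem exists_hist_eq (μ : T → ℕ) [Finite T] : ∃ (X : Type) (_ : Finite X) (b : X → T),
    hist b = μ :=
  ⟨Σ t, Fin (μ t), inferInstance, fun x => x.1, funext fun t => by
    rw [hist, Nat.card_congr (Equiv.sigmaSubtype t), Nat.card_fin]⟩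

/-- The number of refinements of a type map with given numbers of objects of each refined type. -/
theorem card_refinements [Fintype X] [Fintype T] [Fintype U] (b : X → T) (k : T × U → ℕ)
    (hk : ∀ t, ∑ u, k (t, u) = hist b t) :
    Fintype.card {c : X → U // hist (fun x => (b x, c x)) = k} * ∏ j, (k j).factorial =
      ∏ t, (hist b t).factorial := by
  -- The permutations of `X` that preserve `b` are counted according to the refinement `c` to which
  -- they pull back a fixed one, `c₀`.
  have hstab : ∀ {T : Type} [Fintype T] (b : X → T),
      Nat.card {σ : Equiv.Perm X // b ∘ σ = b} = ∏ t, (hist b t).factorial := fun b => by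
    rw [Nat.card_eq_fintype_card]
    simp [DomMulAct.stabilizer_card, hist, Nat.card_eq_fintype_card]
  obtain ⟨c₀, hc₀⟩ : ∃ c₀ : X → U, hist (fun x => (b x, c₀ x)) = k := by
    obtain ⟨Y, _, p, hp⟩ := exists_hist_eq k
    obtain ⟨e, he⟩ : ∃ e : X ≃ Y, ∀ x, (p (e x)).1 = b x := by
      refine exists_equiv_of_hist_eq (b' := fun y => (p y).1) (funext fun t => ?_)
      rw [hist_map p Prod.fst, hp, ← hk]
      refine (Finset.sum_nbij (fun u => (t, u)) ?_ ?_ ?_ ?_)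
      · simp
      · intro u _ u' _ h
        exact (Prod.ext_iff.1 h).2
      · rintro ⟨t', u⟩ h
        have : t' = t := by simpa using h
        exact ⟨u, by simp [this]⟩
      · simp
    refine ⟨fun x => (p (e x)).2, ?_⟩
    rw [← hp, ← hist_comp_equiv p e]
    congr 1
    funext x
    rw [← he]
  have hcount : ∀ c : {c : X → U // hist (fun x => (b x, c x)) = k},
      Nat.card {σ : Equiv.Perm X // ∀ x, (b (σ x), c₀ (σ x)) = (b x, c.1 x)} =
        ∏ j, (k j).factorial := by
    intro c
    obtain ⟨σ₀, hσ₀⟩ := exists_equiv_of_hist_eq (c.2.trans hc₀.symm)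
    refine Eq.trans ?_ ((hstab fun x => (b x, c₀ x)).trans (by rw [hc₀]))
    refine Nat.card_congr ((Equiv.mulRight σ₀⁻¹).subtypeEquiv fun σ => ?_)
    rw [funext_iff]
    constructor
    · intro h x
      have := h (σ₀⁻¹ x)
      rw [← hσ₀] at this
      simpa using this
    · intro h x
      have := h (σ₀ x)
      rw [← hσ₀]
      simpa using this
  rw [← hstab b, ← smul_eq_mul, ← Finset.card_univ, ← Finset.sum_const,
    ← Finset.sum_congr rfl fun c _ => hcount c, ← Nat.card_sigma]
  refine Nat.card_congr ⟨fun p => ⟨p.2.1, funext fun x => (Prod.ext_iff.1 (p.2.2 x)).1⟩,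
    fun σ => ⟨⟨fun x => c₀ (σ.1 x), ?_⟩, ⟨σ.1, fun x => by rw [← congrFun σ.2 x]; rfl⟩⟩, ?_, ?_⟩
  · rw [← hc₀, ← hist_comp_equiv (fun x => (b x, c₀ x)) σ.1]
    congr 1
    funext x
    rw [← congrFun σ.2 x]
    rfl
  · rintro ⟨⟨c, hc⟩, σ, hσ⟩
    obtain rfl : c = fun x => c₀ (σ x) := funext fun x => ((Prod.ext_iff.1 (hσ x)).2).symm
    rfl
  · intro σ
    rfl

/-- The sum, over all refinements of a type map, of a function of the histogram, is a sum over
histograms. -/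
theorem sum_refinements [Fintype X] [Fintype T] [Fintype U] (b : X → T)
    (F : (T × U → ℕ) → ℝ) :
    ∑ c : X → U, F (hist fun x => (b x, c x)) =
      ∑ k ∈ Fintype.piFinset fun j : T × U => Finset.range (hist b j.1 + 1),
        (∏ t, if ∑ u, k (t, u) = hist b t then 1 else 0 : ℕ) *
          ((∏ t, ((hist b t).factorial : ℝ)) / ∏ j, ((k j).factorial : ℝ)) * F k := by
  have hsum : ∀ c : X → U, ∀ t, ∑ u, hist (fun x => (b x, c x)) (t, u) = hist b t := fun c t => by
    have := hist_map (fun x => (b x, c x)) Prod.fst t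
    refine Eq.trans ?_ this.symm
    refine (Finset.sum_nbij (fun u => (t, u)) ?_ ?_ ?_ ?_)
    · simp
    · intro u _ u' _ h
      exact (Prod.ext_iff.1 h).2
    · rintro ⟨t', u⟩ h
      have : t' = t := by simpa using h
      exact ⟨u, by simp [this]⟩
    · simp
  rw [← Finset.sum_fiberwise_of_maps_to (g := fun c : X → U => hist fun x => (b x, c x))
    (t := Fintype.piFinset fun j : T × U => Finset.range (hist b j.1 + 1))]
  · refine Finset.sum_congr rfl fun k _ => ?_
    rw [Finset.sum_congr rfl fun c hc => by rw [(Finset.mem_filter.1 hc).2], Finset.sum_const,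
      nsmul_eq_mul]
    congr 1
    by_cases hk : ∀ t, ∑ u, k (t, u) = hist b t
    · rw [Finset.prod_congr rfl fun t _ => if_pos (hk t)]
      have hne : (∏ j, ((k j).factorial : ℝ)) ≠ 0 :=
        Finset.prod_ne_zero_iff.2 fun j _ => Nat.cast_ne_zero.2 (Nat.factorial_ne_zero _)
      rw [Finset.prod_const_one, Nat.cast_one, one_mul, eq_div_iff hne]
      have := card_refinements b k hk
      rw [Fintype.card_subtype] at this
      exact_mod_cast this
    · obtain ⟨t, ht⟩ := not_forall.1 hk
      rw [Finset.prod_eq_zero (Finset.mem_univ t) (if_neg ht), Nat.cast_zero, zero_mul,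
        Nat.cast_eq_zero, Finset.card_eq_zero, Finset.filter_eq_empty_iff]
      rintro c - rfl
      exact ht (hsum c t)
  · intro c _
    rw [Fintype.mem_piFinset]
    rintro ⟨t, u⟩
    rw [Finset.mem_range, Nat.lt_succ_iff, ← hsum c t]
    exact Finset.single_le_sum (f := fun u => hist (fun x => (b x, c x)) (t, u))
      (fun _ _ => Nat.zero_le _) (Finset.mem_univ u)

/-- The sum, over all refinements of a type map, of a computable function of the histogram of the
types that the refinement leads to, is a computable function of the histogram. -/
theorem RealComputable.sum_refinements {T' : Type} [Fintype T] [Fintype U] [Fintype T']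
    (φ : T × U → T') {F : (T' → ℕ) → (ℕ → List ℕ → ℝ) → ℝ} (hF : RealComputable F) :
    ∃ G : (T → ℕ) → (ℕ → List ℕ → ℝ) → ℝ, RealComputable G ∧
      ∀ (X : Type) [Fintype X] (b : X → T) (Φ : ℕ → List ℕ → ℝ),
        ∑ c : X → U, F (hist fun x => φ (b x, c x)) Φ = G (hist b) Φ := by
  -- A range of summation must be a box, so the compatibility of `k` with `h` is a factor `0` or `1`.
  refine ⟨fun h Φ => ∑ k ∈ Fintype.piFinset fun j : T × U => Finset.range (h j.1 + 1),
        (∏ t, if ∑ u, k (t, u) = h t then 1 else 0 : ℕ) *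
          ((∏ t, ((h t).factorial : ℝ)) / ∏ j, ((k j).factorial : ℝ)) *
          F (fun t' => ∑ j with φ j = t', k j) Φ, ?_, fun X _ b Φ => ?_⟩
  · have hk : ∀ j, NatComputable fun ρ : T ⊕ (T × U) → ℕ => ρ (.inr j) := fun j => .var _
    have ht : ∀ t, NatComputable fun ρ : T ⊕ (T × U) → ℕ => ρ (.inl t) := fun j => .var _
    refine sum_piFinset (g := fun j ρ => ρ j.1 + 1) (f := fun ρ Φ =>
      (∏ t, if ∑ u, ρ (.inr (t, u)) = ρ (.inl t) then 1 else 0 : ℕ) *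
          ((∏ t, ((ρ (.inl t)).factorial : ℝ)) / ∏ j, ((ρ (.inr j)).factorial : ℝ)) *
          F (fun t' => ∑ j with φ j = t', ρ (.inr j)) Φ)
      (fun j => (NatComputable.var _).add (.const 1)) ?_
    refine ((natCast ?_).mul (div ?_ ?_)).mul ?_
    · exact NatComputable.prod _ fun t _ => (NatComputable.sum _ fun u _ => hk _).ite_eq (ht t)
    · exact RealComputable.prod _ fun t _ => factorial (ht t)
    · exact RealComputable.prod _ fun j _ => factorial (hk j)
    · exact hF.comp fun t' => NatComputable.sum _ fun j _ => hk j
  · refine Eq.trans ?_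
      (FODtrees.sum_refinements b fun k => F (fun t' => ∑ j with φ j = t', k j) Φ)
    refine Finset.sum_congr rfl fun c _ => ?_
    congr 1
    funext t'
    exact hist_map (fun x => (b x, c x)) φ t'

/-- The number of subsets of a finite set that have a given number of elements of each type. -/
theorem card_subsets_with_types [Fintype T] (b : X → T) (s : Finset X) (μ : T → ℕ) :
    (s.powerset.filter fun x => ∀ t, (x.filter fun y => b y = t).card = μ t).card =
      ∏ t, ((s.filter fun y => b y = t).card).choose (μ t) := by
  simp only [← Finset.card_powersetCard, ← Fintype.card_piFinset]
  refine Finset.card_nbij' (fun x t => x.filter fun y => b y = t)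
    (fun x => Finset.univ.biUnion x) ?_ ?_ ?_ ?_
  · intro x hx
    simp only [Finset.coe_filter, Finset.mem_powerset, Set.mem_ofPred_eq] at hx
    simp only [Finset.mem_coe, Fintype.mem_piFinset, Finset.mem_powersetCard]
    exact fun t => ⟨Finset.filter_subset_filter _ hx.1, hx.2 t⟩
  · intro x hx
    simp only [Finset.mem_coe, Fintype.mem_piFinset, Finset.mem_powersetCard] at hx
    simp only [Finset.coe_filter, Finset.mem_powerset, Set.mem_ofPred_eq]
    refine ⟨Finset.biUnion_subset.2 fun t _ => (hx t).1.trans (Finset.filter_subset _ _),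
      fun t => ?_⟩
    rw [← (hx t).2]
    congr 1
    ext y
    simp only [Finset.mem_filter, Finset.mem_biUnion, Finset.mem_univ, true_and]
    constructor
    · rintro ⟨⟨t', h⟩, rfl⟩
      rwa [(Finset.mem_filter.1 ((hx t').1 h)).2]
    · exact fun h => ⟨⟨t, h⟩, (Finset.mem_filter.1 ((hx t).1 h)).2⟩
  · intro x _
    ext y
    simp
  · intro x hx
    simp only [Finset.mem_coe, Fintype.mem_piFinset, Finset.mem_powersetCard] at hx
    funext t
    ext y
    simp only [Finset.mem_filter, Finset.mem_biUnion, Finset.mem_univ, true_and]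
    constructor
    · rintro ⟨⟨t', h⟩, rfl⟩
      rwa [(Finset.mem_filter.1 ((hx t').1 h)).2]
    · exact fun h => ⟨⟨t, h⟩, (Finset.mem_filter.1 ((hx t).1 h)).2⟩

end Histogram

/-! ### Atoms over a finite set of names -/

section Patterns

open scoped Classical BigOperators

variable {σ : Vocabulary} {n : Fin σ.numDoms → ℕ} {α β : Type}

/-- Atoms over an arbitrary type; the atoms over the objects are the random variables. -/
abbrev Pattern (σ : Vocabulary) (α : Type) : Type :=
  Σ p : Fin σ.numPreds, Fin (σ.arity p) → α

/-- The atom that arises by renaming the arguments. -/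
abbrev Pattern.rename (f : α → β) (a : Pattern σ α) : Pattern σ β := ⟨a.1, fun j => f (a.2 j)⟩

/-- Values of all atoms over a type. -/
abbrev Assignment (σ : Vocabulary) (α : Type) : Type := ∀ a : Pattern σ α, Fin (σ.range a.1)

instance (σ : Vocabulary) (p : Fin σ.numPreds) : Nonempty (Fin (σ.range p)) :=
  ⟨⟨0, σ.range_pos p⟩⟩

/-- The assignment to atoms over `α` that reads the values of the renamed atoms. -/
def Assignment.pull (f : α → β) (ω : Assignment σ β) : Assignment σ α :=
  fun a => ω (Pattern.rename f a)

/-- Atoms over `α` and one further object, `none`, that do contain this object. -/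
abbrev OpenPattern (σ : Vocabulary) (α : Type) : Type :=
  {a : Pattern σ (Option α) // ∃ j, a.2 j = none}

/-- Values of all atoms over `α` and one further object that contain this object. -/
abbrev OpenAssignment (σ : Vocabulary) (α : Type) : Type :=
  ∀ a : OpenPattern σ α, Fin (σ.range a.1.1)

/-- The objects without a name. -/
abbrev Unnamed (ν : α → β) : Type := {u : β // u ∉ Set.range ν}

/-- The type of an object relative to named objects: its domain, and the values of all atoms that
contain this object and otherwise only named ones. -/
abbrev ObjType (σ : Vocabulary) (α : Type) : Type :=
  Fin σ.numDoms × OpenAssignment σ α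

/-- The naming `ν`, extended by a name for the object `u`. -/
def withObj (ν : α → β) (u : β) : Option α → β := fun o => o.elim u ν

/-- The type of the object `u`, when `ν` names objects, in the assignment `ω`. -/
def objType (ν : α → Obj σ n) (ω : Assignment σ (Obj σ n)) (u : Obj σ n) : ObjType σ α :=
  (u.1, fun a => ω (Pattern.rename (withObj ν u) a.1))

/-- The numbers of unnamed objects of each type. -/
noncomputable def typeHist (ν : α → Obj σ n) (ω : Assignment σ (Obj σ n)) : ObjType σ α → ℕ :=
  hist fun u : Unnamed ν => objType ν ω u.1

theorem Pattern.rename_injective {f : α → β} (hf : Function.Injective f) :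
    Function.Injective (Pattern.rename (σ := σ) f) := by
  rintro ⟨p, x⟩ ⟨q, y⟩ h
  obtain rfl : p = q := congrArg Sigma.fst h
  have h2 := eq_of_heq (Sigma.mk.inj h).2
  obtain rfl : x = y := funext fun j => hf (congrFun h2 j)
  rfl

theorem withObj_injective {ν : α → β} (hν : Function.Injective ν) {u : β}
    (hu : u ∉ Set.range ν) : Function.Injective (withObj ν u) := by
  rintro (_ | a) (_ | b) h
  · rfl
  · exact (hu ⟨b, h.symm⟩).elim
  · exact (hu ⟨a, h⟩).elim
  · rw [hν h]

/-- Atoms over the names, and atoms over the names and one unnamed object, are different random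
variables. -/
theorem sumElim_rename_injective {ν : α → β} (hν : Function.Injective ν) :
    Function.Injective (Sum.elim (Pattern.rename (σ := σ) ν)
      fun p : OpenPattern σ α × Unnamed ν =>
        Pattern.rename (withObj ν p.2.1) p.1.1) := by
  rintro (a | ⟨⟨⟨p, x⟩, j, hj⟩, u, hu⟩) (b | ⟨⟨⟨q, y⟩, i, hi⟩, v, hv⟩) h
  · rw [Pattern.rename_injective hν h]
  · obtain ⟨p, x⟩ := a
    obtain rfl : p = q := congrArg Sigma.fst h
    have h2 := congrFun (eq_of_heq (Sigma.mk.inj h).2) i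
    change ν (x i) = withObj ν v (y i) at h2
    rw [show y i = none from hi] at h2
    exact (hv ⟨_, h2⟩).elim
  · obtain ⟨q, y⟩ := b
    obtain rfl : p = q := congrArg Sigma.fst h
    have h2 := congrFun (eq_of_heq (Sigma.mk.inj h).2) j
    change withObj ν u (x j) = ν (y j) at h2
    rw [show x j = none from hj] at h2
    exact (hu ⟨_, h2.symm⟩).elim
  · obtain rfl : p = q := congrArg Sigma.fst h
    have h2 := congrFun (eq_of_heq (Sigma.mk.inj h).2) j
    change withObj ν u (x j) = withObj ν v (y j) at h2
    rw [show x j = none from hj] at h2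
    obtain rfl : u = v := by
      cases hy : y j with
      | none => rw [hy] at h2; exact h2
      | some b => rw [hy] at h2; exact (hu ⟨b, h2.symm⟩).elim
    have h3 := Pattern.rename_injective (withObj_injective hν hu) h
    simp only [Sum.inr.injEq, Prod.mk.injEq, and_true, Subtype.mk.injEq]
    exact h3

/-- Averaging a function of the values of the atoms over the names, and of the numbers of unnamed
objects of each type, when the set of the averaged random variables is invariant under
permutations of the unnamed objects. -/
theorem exists_average_eq (N : Type) [Finite N] (S₀ : Set (Pattern σ N))
    (S₁ : Set (OpenPattern σ N))
    {F : Assignment σ N → (ObjType σ N → ℕ) → (ℕ → List ℕ → ℝ) → ℝ}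
    (hF : ∀ A, RealComputable (F A)) :
    ∃ G : Assignment σ N → (ObjType σ N → ℕ) → (ℕ → List ℕ → ℝ) → ℝ,
      (∀ A, RealComputable (G A)) ∧
      ∀ (n : Fin σ.numDoms → ℕ) (ν : N → Obj σ n) (S : Set (RandVar σ n)), Function.Injective ν →
        (∀ a, Pattern.rename ν a ∈ S ↔ a ∈ S₀) →
        (∀ a : OpenPattern σ N, ∀ u ∉ Set.range ν,
          Pattern.rename (withObj ν u) a.1 ∈ S ↔ a ∈ S₁) →
        ∀ (ω : Assignment σ (Obj σ n)) (Φ : ℕ → List ℕ → ℝ),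
          average S (fun ω' => F (Assignment.pull ν ω') (typeHist ν ω') Φ) ω =
            G (Assignment.pull ν ω) (typeHist ν ω) Φ := by
  have := Fintype.ofFinite N
  -- Resampling turns the type `p.1` of an object into `φ p`, when `p.2` are the new values.
  let φ : ObjType σ N × OpenAssignment σ N → ObjType σ N := fun p => (p.1.1, S₁.piecewise p.2 p.1.2)
  choose G' hG' hG'F using fun A =>
    RealComputable.sum_refinements (U := OpenAssignment σ N) φ (hF A)
  refine ⟨fun A h Φ => (∑ A', G' (S₀.piecewise A' A) h Φ) /
    ((Fintype.card (Assignment σ N) : ℝ) * (Fintype.card (OpenAssignment σ N) : ℝ) ^ ∑ t, h t),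
    fun A => ?_, ?_⟩
  · exact (RealComputable.sum _ fun A' _ => hG' _).div (.mul (.natCast (.const _))
      (.pow (.natCast (.const _)) (.sum _ fun t _ => .var t)))
  intro n ν S hν h₀ h₁ ω Φ
  -- Only the random variables in the range of `j` matter; they are independent.
  let j : Pattern σ N ⊕ OpenPattern σ N × Unnamed ν → RandVar σ n := Sum.elim (Pattern.rename ν)
    fun p => Pattern.rename (withObj ν p.2.1) p.1.1
  let H : Assignment σ N × (Unnamed ν → OpenAssignment σ N) → ℝ := fun p =>
    F (S₀.piecewise p.1 (Assignment.pull ν ω))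
      (hist fun u : Unnamed ν => φ (objType ν ω u.1, p.2 u)) Φ
  let e : (∀ w, Fin (σ.range (j w).1)) ≃ Assignment σ N × (Unnamed ν → OpenAssignment σ N) :=
    { toFun := fun τ => (fun a => τ (.inl a), fun u a => τ (.inr (a, u)))
      invFun := fun p w => match w with
        | .inl a => p.1 a
        | .inr q => p.2 q.2 q.1
      left_inv := fun τ => by funext w; rcases w with a | ⟨a, u⟩ <;> rfl
      right_inv := fun p => rfl }
  have h1 : ∀ τ : Assignment σ (Obj σ n), F (Assignment.pull ν (S.piecewise τ ω))
      (typeHist ν (S.piecewise τ ω)) Φ = H (e fun w => τ (j w)) := by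
    intro τ
    have e1 : Assignment.pull ν (S.piecewise τ ω) =
        S₀.piecewise (fun a => τ (j (.inl a))) (Assignment.pull ν ω) := by
      funext a
      by_cases ha : a ∈ S₀
      · exact (S.piecewise_eq_of_mem _ _ ((h₀ a).2 ha)).trans
          (S₀.piecewise_eq_of_mem (fun a => τ (j (.inl a))) (Assignment.pull ν ω) ha).symm
      · exact (S.piecewise_eq_of_notMem _ _ (mt (h₀ a).1 ha)).trans
          (S₀.piecewise_eq_of_notMem (fun a => τ (j (.inl a))) (Assignment.pull ν ω) ha).symm
    have e2 : (fun u : Unnamed ν => objType ν (S.piecewise τ ω) u.1) =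
        fun u : Unnamed ν => φ (objType ν ω u.1, fun a => τ (j (.inr (a, u)))) := by
      funext u
      refine Prod.ext rfl (funext fun a => ?_)
      by_cases ha : a ∈ S₁
      · exact (S.piecewise_eq_of_mem _ _ ((h₁ a u.1 u.2).2 ha)).trans
          (S₁.piecewise_eq_of_mem (fun a => τ (j (.inr (a, u)))) (objType ν ω u.1).2 ha).symm
      · exact (S.piecewise_eq_of_notMem _ _ (mt (h₁ a u.1 u.2).1 ha)).trans
          (S₁.piecewise_eq_of_notMem (fun a => τ (j (.inr (a, u)))) (objType ν ω u.1).2 ha).symm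
    simp only [H, e, typeHist]
    rw [e1]
    exact congrArg (fun b => F _ (hist b) Φ) e2
  have hj : Function.Injective j := sumElim_rename_injective hν
  rw [average_eq_sum_div (D := fun v : RandVar σ n => Fin (σ.range v.1)) hj e H h1]
  congr 1
  · exact Finset.sum_congr rfl fun A' _ => hG'F (S₀.piecewise A' (Assignment.pull ν ω))
      (Unnamed ν) (fun u => objType ν ω u.1) Φ
  · rw [typeHist, sum_hist, Nat.card_eq_fintype_card]

end Patterns

/-! ### Random variables with at most one unnamed object -/

section Near

variable {σ : Vocabulary} {α β : Type}

/-- The atoms that contain at most one object outside `K`. -/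
def Near (K : Set α) : Set (Pattern σ α) :=
  {v | ∀ i j, v.2 i ∉ K → v.2 j ∉ K → v.2 i = v.2 j}

theorem Near.mono {K K' : Set α} (h : K ⊆ K') : Near (σ := σ) K ⊆ Near K' :=
  fun _ hv i j hi hj => hv i j (fun h' => hi (h h')) fun h' => hj (h h')

theorem rename_mem_near {f : α → β} (hf : Function.Injective f) {K : Set α} {K' : Set β}
    (hK : ∀ x, f x ∈ K' ↔ x ∈ K) (a : Pattern σ α) : Pattern.rename f a ∈ Near K' ↔ a ∈ Near K := by
  simp only [Near, Set.mem_ofPred_eq, hK, hf.eq_iff]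

theorem rename_mem_near_range (f : α → β) (a : Pattern σ α) :
    Pattern.rename f a ∈ Near (Set.range f) := fun i _ hi => (hi ⟨a.2 i, rfl⟩).elim

theorem rename_withObj_mem_near (f : α → β) (u : β) (a : Pattern σ (Option α)) :
    Pattern.rename (withObj f u) a ∈ Near (Set.range f) := by
  have key : ∀ i, withObj f u (a.2 i) ∉ Set.range f → withObj f u (a.2 i) = u := by
    intro i hi
    cases h : a.2 i with
    | none => rfl
    | some b => rw [h] at hi; exact (hi ⟨b, rfl⟩).elim
  exact fun i j hi hj => (key i hi).trans (key j hj).symm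

/-- An atom with at most one unnamed object is a renamed atom over the names, or over the names and
one further object. -/
theorem exists_rename_of_mem_near {f : α → β} {v : Pattern σ β} (hv : v ∈ Near (Set.range f)) :
    (∃ b, v = Pattern.rename f b) ∨
      ∃ u ∉ Set.range f, ∃ b : OpenPattern σ α, v = Pattern.rename (withObj f u) b.1 := by
  obtain ⟨p, x⟩ := v
  by_cases h : ∀ i, x i ∈ Set.range f
  · choose y hy using h
    exact .inl ⟨⟨p, y⟩, by simp [Pattern.rename, hy]⟩
  · obtain ⟨i, hi⟩ := not_forall.1 h
    have key : ∀ j, ∃ o, withObj f (x i) o = x j := fun j => by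
      by_cases hj : x j ∈ Set.range f
      · obtain ⟨a, ha⟩ := hj
        exact ⟨some a, ha⟩
      · exact ⟨none, hv i j hi hj⟩
    choose y hy using key
    refine .inr ⟨x i, hi, ⟨⟨p, y⟩, i, ?_⟩, by simp [Pattern.rename, hy]⟩
    have := hy i
    cases h : y i with
    | none => exact h
    | some b => rw [h] at this; exact (hi ⟨b, this⟩).elim

end Near

/-! ### Factors below a node of a decomposition tree -/

section Trees

variable {σ : Vocabulary} {n : Fin σ.numDoms → ℕ} {L V : Type}

theorem DTree.weight_congr (Φ : ℕ → List ℕ → ℝ) {τ τ' : V → ℕ} (D : DTree L V)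
    (h : ∀ v ∈ D.rv, τ v = τ' v) : D.weight Φ τ = D.weight Φ τ' := by
  induction D with
  | leaf l f args =>
    simp only [DTree.weight]
    rw [List.map_congr_left h]
  | node l ι ch ih =>
    simp only [DTree.weight]
    exact Finset.prod_congr rfl fun i _ => ih i fun v hv => h v (Set.mem_iUnion_of_mem i hv)

/-- The product of all factors in the tree, as a function of an assignment. -/
noncomputable def treeValue (D : DTree L (RandVar σ n)) (Φ : ℕ → List ℕ → ℝ)
    (ω : Assignment σ (Obj σ n)) : ℝ :=
  D.weight Φ fun v => (ω v : ℕ)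

theorem treeValue_dependsOnly (D : DTree L (RandVar σ n)) (Φ : ℕ → List ℕ → ℝ) :
    DependsOnly (treeValue D Φ) D.rv := fun _ _ h =>
  D.weight_congr Φ fun v hv => congrArg Fin.val (h v hv)

/-- If the children share only random variables that are not averaged, then the average of the
product of all factors is a product of averages. -/
theorem average_treeValue_node {l : L} {ι : Type} [Fintype ι] {ch : ι → DTree L (RandVar σ n)}
    {S : Set (RandVar σ n)} (h : ∀ i j, i ≠ j → (ch i).rv ∩ (ch j).rv ⊆ Sᶜ)
    (Φ : ℕ → List ℕ → ℝ) (ω : Assignment σ (Obj σ n)) :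
    average S (treeValue (.node l ι ch) Φ) ω = ∏ i, average S (treeValue (ch i) Φ) ω :=
  average_prod Finset.univ (fun i => treeValue_dependsOnly (ch i) Φ)
    (fun i j hij _ hi hj => h i j hij ⟨hi, hj⟩) ω

/-- The objects that are named by constants or represent one of the objects in scope. -/
def fixedObjs {m : ℕ} (η : Fin m → Obj σ n) : Set (Obj σ n) :=
  (Set.range fun c : Σ s, Fin (σ.numConsts s) => (⟨c.1, .inl c.2⟩ : Obj σ n)) ∪ Set.range η

/-- Wherever a node of the grounded tree branches, the branches share only random variables with at
most one object that is not fixed there. This is what liftability amounts to. -/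
def Separated : {m : ℕ} → FODTree σ m → (Fin m → Obj σ n) → Prop
  | _, .leaf _ _, _ => True
  | _, .node _ ch, η =>
      (∀ i i', i ≠ i' → ((ch i).ground η).rv ∩ ((ch i').ground η).rv ⊆ Near (fixedObjs η)) ∧
        ∀ i, Separated (ch i) η
  | _, .dpg s k excl body, η =>
      (∀ x y : Subsets η s excl k, x ≠ y → ∀ (e : Fin k ≃ x.1) (e' : Fin k ≃ y.1),
        (body.ground (extend η e)).rv ∩ (body.ground (extend η e')).rv ⊆ Near (fixedObjs η)) ∧
      ∀ (x : Subsets η s excl k) (e : Fin k ≃ x.1),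
        (∀ e' : Fin k ≃ x.1, e ≠ e' → (body.ground (extend η e)).rv ∩
          (body.ground (extend η e')).rv ⊆ Near (fixedObjs (extend η e))) ∧
        Separated body (extend η e)

end Trees

/-! ### The value of a subtree as a function of histograms -/

section Frames

variable {σ : Vocabulary} {n : Fin σ.numDoms → ℕ} {N : Type}

/-- A naming of distinct objects, among them all constants, by the elements of `N`; `δ` says to
which domains the named objects belong. -/
structure IsFrame (γ : (Σ s, Fin (σ.numConsts s)) → N) (δ : N → Fin σ.numDoms)
    (ν : N → Obj σ n) : Prop where
  injective : Function.Injective ν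
  dom : ∀ a, (ν a).1 = δ a
  const : ∀ c, ν (γ c) = ⟨c.1, .inl c.2⟩

theorem IsFrame.fixedObjs_subset {γ : (Σ s, Fin (σ.numConsts s)) → N} {δ : N → Fin σ.numDoms}
    {ν : N → Obj σ n} (h : IsFrame γ δ ν) {m : ℕ} (θ : Fin m → N) :
    fixedObjs (fun i => ν (θ i)) ⊆ Set.range ν := by
  rintro _ (⟨c, rfl⟩ | ⟨i, rfl⟩)
  exacts [⟨γ c, h.const c⟩, ⟨θ i, rfl⟩]

/-- The average of the factors below a node over all random variables with at least two unnamed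
objects is a function, computable in polynomial time, of the numbers of unnamed objects of each
type. It depends on the names of the representative objects in scope, and on the values of the
random variables without unnamed objects, which vary in a finite set that does not depend on the
domain sizes. -/
def Computes {m : ℕ} (t : FODTree σ m) : Prop :=
  ∀ (N : Type) [Finite N] (γ : (Σ s, Fin (σ.numConsts s)) → N) (δ : N → Fin σ.numDoms)
    (θ : Fin m → N) (A : Assignment σ N),
    ∃ f : (ObjType σ N → ℕ) → (ℕ → List ℕ → ℝ) → ℝ, RealComputable f ∧
      ∀ (n : Fin σ.numDoms → ℕ) (ν : N → Obj σ n) (ω : Assignment σ (Obj σ n))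
        (Φ : ℕ → List ℕ → ℝ), IsFrame γ δ ν → Separated t (fun i => ν (θ i)) →
        Assignment.pull ν ω = A →
        average (Near (Set.range ν))ᶜ (treeValue (t.ground fun i => ν (θ i)) Φ) ω =
          f (typeHist ν ω) Φ

theorem computes_leaf {m : ℕ} (f : ℕ) (as : List (Atom σ m)) : Computes (.leaf f as) := by
  intro N _ γ δ θ A
  let name : Arg σ m → N := Sum.elim γ θ
  refine ⟨fun _ Φ => Φ f (as.map fun a => A ⟨a.pred, fun j => name (a.args j)⟩), .load _ _, ?_⟩
  rintro n ν ω Φ hν - rfl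
  have hground : ∀ a : Atom σ m, a.ground (fun i => ν (θ i)) =
      Pattern.rename ν ⟨a.pred, fun j => name (a.args j)⟩ := by
    intro a
    simp only [Atom.ground, Pattern.rename]
    congr 1
    funext j
    cases h : a.args j with
    | inl c => exact (hν.const c).symm
    | inr i => rfl
  refine average_eq_of_forall fun τ hτ => ?_
  simp only [treeValue, FODTree.ground, DTree.weight, List.map_map]
  congr 1
  refine List.map_congr_left fun a _ => ?_
  simp only [Function.comp_apply]
  rw [hground, hτ _ (fun h => h (rename_mem_near_range ν _))]
  rfl

theorem computes_node {m j : ℕ} {ch : Fin j → FODTree σ m} (ih : ∀ i, Computes (ch i)) :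
    Computes (.node j ch) := by
  intro N _ γ δ θ A
  choose f hf hval using fun i => ih i N γ δ θ A
  refine ⟨fun h Φ => ∏ i, f i h Φ, RealComputable.prod _ fun i _ => hf i, ?_⟩
  intro n ν ω Φ hν hsep hA
  rw [FODTree.ground, average_treeValue_node]
  · exact Finset.prod_congr rfl fun i _ => hval i n ν ω Φ hν (hsep.2 i) hA
  · intro i i' hi
    rw [compl_compl]
    exact (hsep.1 i i' hi).trans (Near.mono (hν.fixedObjs_subset θ))

end Frames

/-! ### Naming further objects -/

section Naming

open scoped Classical

variable {σ : Vocabulary} {n : Fin σ.numDoms → ℕ} {N T : Type} {k : ℕ}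

/-- What is known of an object: its name, or its type if it has no name. -/
noncomputable def objKind (ν : N → Obj σ n) (ω : Assignment σ (Obj σ n)) (u : Obj σ n) :
    N ⊕ ObjType σ N :=
  if h : u ∈ Set.range ν then .inl h.choose else .inr (objType ν ω u)

theorem objKind_eq_inl {ν : N → Obj σ n} (hν : Function.Injective ν)
    {ω : Assignment σ (Obj σ n)} {u : Obj σ n} {c : N} : objKind ν ω u = .inl c ↔ u = ν c := by
  unfold objKind
  split_ifs with h
  · rw [Sum.inl.injEq, ← hν.eq_iff, h.choose_spec]
  · simp only [false_iff]
    rintro rfl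
    exact h ⟨c, rfl⟩

theorem objKind_eq_inr {ν : N → Obj σ n} {ω : Assignment σ (Obj σ n)} {u : Obj σ n}
    {t : ObjType σ N} : objKind ν ω u = .inr t ↔ u ∉ Set.range ν ∧ objType ν ω u = t := by
  unfold objKind
  split_ifs with h <;> simp [h]

/-- When `L` lists the kinds of `k` objects: one new name for each of them that has no name. -/
abbrev WithFresh (L : Fin k → N ⊕ T) : Type := N ⊕ {i : Fin k // (L i).isRight}

/-- The name that the `i`-th of the `k` objects has afterwards. -/
def freshName (L : Fin k → N ⊕ T) (i : Fin k) : WithFresh L :=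
  match h : L i with
  | .inl c => .inl c
  | .inr _ => .inr ⟨i, by simp [h]⟩

/-- The naming `ν`, extended by names for those of the objects `o` that have no name yet. -/
def freshNaming {O : Type} (L : Fin k → N ⊕ T) (ν : N → O) (o : Fin k → O) : WithFresh L → O :=
  Sum.elim ν fun i => o i.1

/-- The objects `o` are distinct, and `L` lists their kinds. -/
structure HasKinds (L : Fin k → N ⊕ ObjType σ N) (ν : N → Obj σ n)
    (ω : Assignment σ (Obj σ n)) (o : Fin k → Obj σ n) : Prop where
  naming : Function.Injective ν
  injective : Function.Injective o
  kind : ∀ i, objKind ν ω (o i) = L i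

/-- The assignment `ω` where all random variables with several unnamed objects have value `0`. These
are going to be averaged, so their values do not matter, but types of objects relative to more names
are determined only when they are fixed. -/
noncomputable def nearPart (ν : N → Obj σ n) (ω : Assignment σ (Obj σ n)) :
    Assignment σ (Obj σ n) :=
  fun v => if v ∈ Near (Set.range ν) then ω v else ⟨0, σ.range_pos v.1⟩

theorem nearPart_rename (ν : N → Obj σ n) (ω : Assignment σ (Obj σ n)) (b : Pattern σ N) :
    nearPart ν ω (Pattern.rename ν b) = ω (Pattern.rename ν b) :=
  if_pos (rename_mem_near_range ν b)

theorem nearPart_rename_withObj (ν : N → Obj σ n) (ω : Assignment σ (Obj σ n)) (u : Obj σ n)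
    {f : Option N → Obj σ n} (hf : f = withObj ν u) (b : Pattern σ (Option N)) :
    nearPart ν ω (Pattern.rename f b) =
      (ω (Pattern.rename (withObj ν u) b) : Fin (σ.range b.1)) := by
  subst hf
  exact if_pos (rename_withObj_mem_near ν u b)

section

variable {L : Fin k → N ⊕ ObjType σ N} {ν : N → Obj σ n} {ω : Assignment σ (Obj σ n)}
  {o : Fin k → Obj σ n}

theorem HasKinds.kind_inr (h : HasKinds L ν ω o) {i : Fin k} (hi : (L i).isRight) :
    o i ∉ Set.range ν ∧ L i = .inr (objType ν ω (o i)) := by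
  obtain ⟨t, ht⟩ := Sum.isRight_iff.1 hi
  obtain ⟨h1, h2⟩ := objKind_eq_inr.1 ((h.kind i).trans ht)
  exact ⟨h1, by rw [ht, h2]⟩

theorem HasKinds.freshNaming_freshName (h : HasKinds L ν ω o) (i : Fin k) :
    freshNaming L ν o (freshName L i) = o i := by
  unfold freshName
  split
  · next c hc => exact ((objKind_eq_inl h.naming).1 ((h.kind i).trans hc)).symm
  · rfl

theorem HasKinds.freshNaming_injective (h : HasKinds L ν ω o) :
    Function.Injective (freshNaming L ν o) := by
  rintro (a | ⟨i, hi⟩) (b | ⟨j, hj⟩) hab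
  · exact congrArg _ (h.naming hab)
  · exact ((h.kind_inr hj).1 ⟨a, hab⟩).elim
  · exact ((h.kind_inr hi).1 ⟨b, hab.symm⟩).elim
  · simp only [Sum.inr.injEq, Subtype.mk.injEq]
    exact h.injective hab

theorem HasKinds.freshNaming_mem_range (h : HasKinds L ν ω o) (a : WithFresh L) :
    freshNaming L ν o a ∈ Set.range ν ↔ a ∈ Set.range Sum.inl := by
  constructor
  · rintro ⟨c, hc⟩
    exact ⟨c, h.freshNaming_injective hc⟩
  · rintro ⟨c, rfl⟩
    exact ⟨c, rfl⟩

theorem HasKinds.withObj_mem_range (h : HasKinds L ν ω o) {u : Obj σ n}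
    (hu : u ∉ Set.range (freshNaming L ν o)) (a : Option (WithFresh L)) :
    withObj (freshNaming L ν o) u a ∈ Set.range ν ↔ a ∈ Set.range fun c => some (Sum.inl c) := by
  constructor
  · rintro ⟨c, hc⟩
    exact ⟨c, withObj_injective h.freshNaming_injective hu hc⟩
  · rintro ⟨c, rfl⟩
    exact ⟨c, rfl⟩

end

/-- After naming, the values of the atoms over the names are determined by their values before and
by the kinds of the newly named objects. -/
theorem exists_pull_freshNaming (A : Assignment σ N) (L : Fin k → N ⊕ ObjType σ N) :
    ∃ A' : Assignment σ (WithFresh L), ∀ (n : Fin σ.numDoms → ℕ) (ν : N → Obj σ n)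
      (ω : Assignment σ (Obj σ n)) (o : Fin k → Obj σ n), Assignment.pull ν ω = A →
      HasKinds L ν ω o → Assignment.pull (freshNaming L ν o) (nearPart ν ω) = A' := by
  have key : ∀ (n n' : Fin σ.numDoms → ℕ) (ν : N → Obj σ n) (ν' : N → Obj σ n')
      (ω : Assignment σ (Obj σ n)) (ω' : Assignment σ (Obj σ n')) (o : Fin k → Obj σ n)
      (o' : Fin k → Obj σ n'), Assignment.pull ν ω = A → Assignment.pull ν' ω' = A →
      HasKinds L ν ω o → HasKinds L ν' ω' o' →
      Assignment.pull (freshNaming L ν o) (nearPart ν ω) =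
        Assignment.pull (freshNaming L ν' o') (nearPart ν' ω') := by
    intro n n' ν ν' ω ω' o o' hA hA' h h'
    funext a
    by_cases ha : a ∈ Near (Set.range Sum.inl)
    · rcases exists_rename_of_mem_near ha with ⟨b, rfl⟩ | ⟨c | ⟨i, hi⟩, hu, b, rfl⟩
      · exact (nearPart_rename ν ω b).trans ((congrFun (hA.trans hA'.symm) b).trans
          (nearPart_rename ν' ω' b).symm)
      · exact (hu ⟨c, rfl⟩).elim
      · have hc : ∀ {O : Type} (ν : N → O) (o : Fin k → O),
            (fun x => freshNaming L ν o (withObj Sum.inl (Sum.inr ⟨i, hi⟩) x)) =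
              withObj ν (o i) := fun ν o => funext fun x => by cases x <;> rfl
        have e : objType ν ω (o i) = objType ν' ω' (o' i) := by
          have := (h.kind_inr hi).2.symm.trans (h'.kind_inr hi).2
          exact Sum.inr.inj this
        have h1 : Assignment.pull (freshNaming L ν o) (nearPart ν ω)
            (Pattern.rename (withObj Sum.inl (Sum.inr ⟨i, hi⟩)) b.1) =
              (objType ν ω (o i)).2 b :=
          nearPart_rename_withObj ν ω (o i) (hc ν o) b.1
        have h2 : Assignment.pull (freshNaming L ν' o') (nearPart ν' ω')
            (Pattern.rename (withObj Sum.inl (Sum.inr ⟨i, hi⟩)) b.1) =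
              (objType ν' ω' (o' i)).2 b :=
          nearPart_rename_withObj ν' ω' (o' i) (hc ν' o') b.1
        rw [h1, h2, e]
    · exact (if_neg (mt (rename_mem_near h.freshNaming_injective h.freshNaming_mem_range a).1
        ha)).trans (if_neg (mt (rename_mem_near h'.freshNaming_injective
          h'.freshNaming_mem_range a).1 ha)).symm
  -- By `key`, any instance determines `A'`; without an instance, `A'` is arbitrary.
  by_cases hex : ∃ (n : Fin σ.numDoms → ℕ) (ν : N → Obj σ n) (ω : Assignment σ (Obj σ n))
      (o : Fin k → Obj σ n), Assignment.pull ν ω = A ∧ HasKinds L ν ω o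
  · obtain ⟨n', ν', ω', o', hA', h'⟩ := hex
    exact ⟨_, fun n ν ω o hA h => key n n' ν ν' ω ω' o o' hA hA' h h'⟩
  · exact ⟨fun a => ⟨0, σ.range_pos a.1⟩, fun n ν ω o hA h => (hex ⟨n, ν, ω, o, hA, h⟩).elim⟩

/-- After naming, the type of an object is determined by its type before. -/
theorem exists_objType_freshNaming (L : Fin k → N ⊕ ObjType σ N) :
    ∃ lift : ObjType σ N → ObjType σ (WithFresh L), ∀ (n : Fin σ.numDoms → ℕ) (ν : N → Obj σ n)
      (ω : Assignment σ (Obj σ n)) (o : Fin k → Obj σ n), HasKinds L ν ω o →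
      ∀ u ∉ Set.range (freshNaming L ν o),
        objType (freshNaming L ν o) (nearPart ν ω) u = lift (objType ν ω u) := by
  have key : ∀ (n n' : Fin σ.numDoms → ℕ) (ν : N → Obj σ n) (ν' : N → Obj σ n')
      (ω : Assignment σ (Obj σ n)) (ω' : Assignment σ (Obj σ n')) (o : Fin k → Obj σ n)
      (o' : Fin k → Obj σ n') (u : Obj σ n) (u' : Obj σ n'),
      HasKinds L ν ω o → HasKinds L ν' ω' o' → u ∉ Set.range (freshNaming L ν o) →
      u' ∉ Set.range (freshNaming L ν' o') → objType ν ω u = objType ν' ω' u' →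
      (objType (freshNaming L ν o) (nearPart ν ω) u).2 =
        (objType (freshNaming L ν' o') (nearPart ν' ω') u').2 := by
    intro n n' ν ν' ω ω' o o' u u' h h' hu hu' e
    funext ⟨a, ha⟩
    by_cases hnear : a ∈ Near (Set.range fun c : N => some (Sum.inl c : WithFresh L))
    · rcases exists_rename_of_mem_near hnear with ⟨b, rfl⟩ | ⟨x, hx, b, rfl⟩
      · obtain ⟨j, hj⟩ := ha
        exact (Option.some_ne_none _ hj).elim
      · obtain rfl : x = none := by
          obtain ⟨j, hj⟩ := ha
          change withObj _ x (b.1.2 j) = none at hj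
          cases hb : b.1.2 j with
          | none => rw [hb] at hj; exact hj
          | some c => rw [hb] at hj; exact (Option.some_ne_none _ hj).elim
        have hc : ∀ {O : Type} (ν : N → O) (o : Fin k → O) (u : O),
            (fun x => withObj (freshNaming L ν o) u
              (withObj (fun c : N => some (Sum.inl c : WithFresh L)) none x)) =
              withObj ν u := fun ν o u => funext fun x => by cases x <;> rfl
        have h1 : (objType (freshNaming L ν o) (nearPart ν ω) u).2 ⟨_, ha⟩ =
            (objType ν ω u).2 b :=
          nearPart_rename_withObj ν ω u (hc ν o u) b.1
        have h2 : (objType (freshNaming L ν' o') (nearPart ν' ω') u').2 ⟨_, ha⟩ =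
            (objType ν' ω' u').2 b :=
          nearPart_rename_withObj ν' ω' u' (hc ν' o' u') b.1
        rw [h1, h2, e]
    · exact (if_neg (mt (rename_mem_near (withObj_injective h.freshNaming_injective hu)
        (h.withObj_mem_range hu) a).1 hnear)).trans (if_neg (mt (rename_mem_near
          (withObj_injective h'.freshNaming_injective hu') (h'.withObj_mem_range hu') a).1
            hnear)).symm
  have hex : ∀ t : ObjType σ N, ∃ B : OpenAssignment σ (WithFresh L),
      ∀ (n : Fin σ.numDoms → ℕ) (ν : N → Obj σ n) (ω : Assignment σ (Obj σ n))
        (o : Fin k → Obj σ n), HasKinds L ν ω o → ∀ u ∉ Set.range (freshNaming L ν o),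
        objType ν ω u = t → (objType (freshNaming L ν o) (nearPart ν ω) u).2 = B := by
    intro t
    by_cases hex : ∃ (n : Fin σ.numDoms → ℕ) (ν : N → Obj σ n) (ω : Assignment σ (Obj σ n))
        (o : Fin k → Obj σ n), HasKinds L ν ω o ∧ ∃ u ∉ Set.range (freshNaming L ν o),
          objType ν ω u = t
    · obtain ⟨n', ν', ω', o', h', u', hu', e'⟩ := hex
      exact ⟨_, fun n ν ω o h u hu e =>
        key n n' ν ν' ω ω' o o' u u' h h' hu hu' (e.trans e'.symm)⟩
    · exact ⟨fun a => ⟨0, σ.range_pos a.1.1⟩, fun n ν ω o h u hu e =>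
        (hex ⟨n, ν, ω, o, h, u, hu, e⟩).elim⟩
  choose B hB using hex
  exact ⟨fun t => (t.1, B t), fun n ν ω o h u hu => Prod.ext rfl (hB _ n ν ω o h u hu rfl)⟩

theorem typeHist_eq_ncard (ν : N → Obj σ n) (ω : Assignment σ (Obj σ n)) (t : ObjType σ N) :
    typeHist ν ω t = {u | objKind ν ω u = .inr t}.ncard := by
  rw [typeHist, hist, ← Nat.card_coe_set_eq]
  refine Nat.card_congr ((Equiv.subtypeSubtypeEquivSubtypeInter _ _).trans
    (Equiv.subtypeEquivRight fun u => objKind_eq_inr.symm))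

/-- After naming, the numbers of unnamed objects of each type are computable. -/
theorem exists_typeHist_freshNaming [Finite N] (L : Fin k → N ⊕ ObjType σ N) :
    ∃ push : ObjType σ (WithFresh L) → (ObjType σ N → ℕ) → ℕ, (∀ t, NatComputable (push t)) ∧
      ∀ (n : Fin σ.numDoms → ℕ) (ν : N → Obj σ n) (ω : Assignment σ (Obj σ n))
        (o : Fin k → Obj σ n), HasKinds L ν ω o →
        typeHist (freshNaming L ν o) (nearPart ν ω) = fun t => push t (typeHist ν ω) := by
  have := Fintype.ofFinite N
  obtain ⟨lift, hlift⟩ := exists_objType_freshNaming L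
  refine ⟨fun t' h => ∑ t with lift t = t', (h t - {i | L i = .inr t}.ncard),
    fun t' => .sum _ fun t _ => (NatComputable.var t).tsub (.const _), ?_⟩
  intro n ν ω o h
  funext t'
  have e : (fun u : Unnamed (freshNaming L ν o) => objType (freshNaming L ν o) (nearPart ν ω) u.1) =
      fun u => lift (objType ν ω u.1) := funext fun u => hlift n ν ω o h u.1 u.2
  rw [typeHist, e, hist_map]
  refine Finset.sum_congr (by ext; simp) fun t _ => ?_
  -- The objects that had the type `t` before are those that are still unnamed, and those listed in
  -- `L`, which is why the latter are subtracted.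
  have hunion : {u | objKind ν ω u = .inr t} =
      {u | u ∉ Set.range (freshNaming L ν o) ∧ objType ν ω u = t} ∪ o '' {i | L i = .inr t} := by
    ext u
    simp only [Set.mem_ofPred_eq, Set.mem_union, Set.mem_image]
    constructor
    · intro hu
      obtain ⟨hu1, hu2⟩ := objKind_eq_inr.1 hu
      by_cases hr : u ∈ Set.range (freshNaming L ν o)
      · obtain ⟨c | i, rfl⟩ := hr
        · exact (hu1 ⟨c, rfl⟩).elim
        · exact .inr ⟨i.1, (h.kind i.1).symm.trans hu, rfl⟩
      · exact .inl ⟨hr, hu2⟩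
    · rintro (⟨hu1, hu2⟩ | ⟨i, hi, rfl⟩)
      · refine objKind_eq_inr.2 ⟨?_, hu2⟩
        rintro ⟨c, rfl⟩
        exact hu1 ⟨.inl c, rfl⟩
      · rw [h.kind, hi]
  have hdisj : Disjoint {u | u ∉ Set.range (freshNaming L ν o) ∧ objType ν ω u = t}
      (o '' {i | L i = .inr t}) := by
    rw [Set.disjoint_left]
    rintro _ ⟨hu, -⟩ ⟨i, hi, rfl⟩
    exact hu ⟨freshName L i, h.freshNaming_freshName i⟩
  rw [typeHist_eq_ncard, hunion, Set.ncard_union_eq hdisj,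
    Set.ncard_image_of_injective _ h.injective,
    Nat.add_sub_cancel, hist, ← Nat.card_coe_set_eq]
  exact Nat.card_congr (Equiv.subtypeSubtypeEquivSubtypeInter
    (fun u => u ∉ Set.range (freshNaming L ν o)) fun u => objType ν ω u = t)

end Naming

/-! ### Decompositions into partial groundings -/

section Groundings

open scoped Classical

variable {σ : Vocabulary} {N : Type} {m k : ℕ} {s : Fin σ.numDoms}

/-- The value of the part of a decomposition into partial groundings that belongs to one set `x`
of representative objects depends only on the kinds of the elements of `x` and on the numbers of
unnamed objects of each type: the elements of `x` are named, and the random variables that have at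
most one unnamed object from now on, but had several before, are averaged. -/
theorem exists_value_of_kinds {body : FODTree σ (m + k)} (ih : Computes body) [Finite N]
    (γ : (Σ s, Fin (σ.numConsts s)) → N) (δ : N → Fin σ.numDoms) (θ : Fin m → N)
    (A : Assignment σ N) (L : Fin k → N ⊕ ObjType σ N) :
    ∃ f : (ObjType σ N → ℕ) → (ℕ → List ℕ → ℝ) → ℝ, RealComputable f ∧
      ∀ (n : Fin σ.numDoms → ℕ) (ν : N → Obj σ n) (ω : Assignment σ (Obj σ n))
        (Φ : ℕ → List ℕ → ℝ), IsFrame γ δ ν → Assignment.pull ν ω = A →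
        ∀ (l : Label σ n) (x : Finset (Dom σ n s)) (e₀ : Fin k ≃ x),
          (∀ i, objKind ν ω ⟨s, e₀ i⟩ = L i) →
          (∀ e : Fin k ≃ x, (∀ e' : Fin k ≃ x, e ≠ e' →
            (body.ground (extend (fun i => ν (θ i)) e)).rv ∩
              (body.ground (extend (fun i => ν (θ i)) e')).rv ⊆
                Near (fixedObjs (extend (fun i => ν (θ i)) e))) ∧
            Separated body (extend (fun i => ν (θ i)) e)) →
          average (Near (Set.range ν))ᶜ (treeValue (.node l (Fin k ≃ x) fun e =>
            body.ground (extend (fun i => ν (θ i)) e)) Φ) ω = f (typeHist ν ω) Φ := by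
  let γ' : (Σ s, Fin (σ.numConsts s)) → WithFresh L := fun c => .inl (γ c)
  let δ' : WithFresh L → Fin σ.numDoms := Sum.elim δ fun _ => s
  -- The enumerations of `x` are `e₀`, preceded by a permutation `p`, and `θ' p` names the objects in
  -- scope below the corresponding child.
  let θ' : Equiv.Perm (Fin k) → Fin (m + k) → WithFresh L := fun p =>
    Fin.append (fun i => .inl (θ i)) fun i => freshName L (p i)
  choose f hf hval using fun p A' => ih (WithFresh L) γ' δ' (θ' p) A'
  obtain ⟨G, hG, hGval⟩ := exists_average_eq (σ := σ) (WithFresh L) (Near (Set.range Sum.inl))ᶜ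
    {a | a.1 ∉ Near (Set.range fun c : N => some (Sum.inl c : WithFresh L))}
    (F := fun A' h Φ => ∏ p, f p A' h Φ) fun A' => .prod _ fun p _ => hf p A'
  obtain ⟨A', hA'⟩ := exists_pull_freshNaming A L
  obtain ⟨push, hpush, hhist⟩ := exists_typeHist_freshNaming L
  refine ⟨fun h Φ => G A' (fun t => push t h) Φ, (hG A').comp hpush, ?_⟩
  intro n ν ω Φ hν hA l x e₀ hL hsep
  let o : Fin k → Obj σ n := fun i => ⟨s, e₀ i⟩
  have ho : Function.Injective o := fun i j hij =>
    e₀.injective (Subtype.ext (eq_of_heq (Sigma.mk.inj hij).2))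
  have hkinds : HasKinds L ν ω o := ⟨hν.injective, ho, hL⟩
  have hν' : IsFrame γ' δ' (freshNaming L ν o) :=
    ⟨hkinds.freshNaming_injective, fun a => by cases a; exacts [hν.dom _, rfl], hν.const⟩
  have hext : ∀ e : Fin k ≃ x, extend (fun i => ν (θ i)) e =
      fun i => freshNaming L ν o (θ' (e.trans e₀.symm) i) := by
    intro e
    funext i
    induction i using Fin.addCases with
    | left i => simp [extend, θ', freshNaming]
    | right i => simp [extend, θ', hkinds.freshNaming_freshName, o]
  have hsub : Near (σ := σ) (Set.range ν) ⊆ Near (Set.range (freshNaming L ν o)) := by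
    refine Near.mono ?_
    rintro _ ⟨c, rfl⟩
    exact ⟨.inl c, rfl⟩
  change _ = G A' (fun t => push t (typeHist ν ω)) Φ
  rw [← hA' n ν ω o hA hkinds, ← hhist n ν ω o hkinds]
  rw [← hGval n (freshNaming L ν o) (Near (Set.range ν))ᶜ hν'.injective
    (fun a => not_congr (rename_mem_near hν'.injective hkinds.freshNaming_mem_range a))
    (fun a u hu => not_congr (rename_mem_near (withObj_injective hν'.injective hu)
      (hkinds.withObj_mem_range hu) a.1)) (nearPart ν ω) Φ]
  have hω : ∀ v ∉ (Near (Set.range ν))ᶜ, ω v = nearPart ν ω v := fun v hv =>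
    (if_pos (not_not.1 hv)).symm
  -- The average is taken in two stages, the inner one over the random variables with at least two
  -- objects that have no name even after those of `x` have received names.
  rw [average_congr_right hω, ← average_average (Set.compl_subset_compl.2 hsub)]
  refine average_congr fun τ _ => ?_
  rw [average_treeValue_node]
  · refine Fintype.prod_bijective (fun e : Fin k ≃ x => e.trans e₀.symm)
      ⟨fun e e' h => ?_, fun p => ⟨p.trans e₀, ?_⟩⟩ _ _ fun e => ?_
    · ext i
      have := congrArg (fun p : Equiv.Perm (Fin k) => e₀ (p i)) h
      simpa using congrArg Subtype.val this
    · ext i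
      simp
    · rw [hext e]
      refine hval (e.trans e₀.symm) _ n _ τ Φ hν' ?_ rfl
      rw [← hext e]
      exact (hsep e).2
  · intro e e' hee'
    rw [compl_compl]
    refine ((hsep e).1 e' hee').trans (Near.mono ?_)
    rw [hext e]
    exact hν'.fixedObjs_subset _

/-- The number of objects of a given kind that may become representative objects, if `h` gives the
numbers of unnamed objects of each type. -/
noncomputable def numCandidates (γ : (Σ s, Fin (σ.numConsts s)) → N) (δ : N → Fin σ.numDoms)
    (θ : Fin m → N) (s : Fin σ.numDoms) (excl : Finset (Fin (σ.numConsts s)))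
    (h : ObjType σ N → ℕ) : N ⊕ ObjType σ N → ℕ
  | .inl c => if δ c = s ∧ (∀ a ∈ excl, c ≠ γ ⟨s, a⟩) ∧ ∀ i, θ i ≠ c then 1 else 0
  | .inr t => if t.1 = s then h t else 0

theorem numCandidates_computable (γ : (Σ s, Fin (σ.numConsts s)) → N) (δ : N → Fin σ.numDoms)
    (θ : Fin m → N) (s : Fin σ.numDoms) (excl : Finset (Fin (σ.numConsts s)))
    (κ : N ⊕ ObjType σ N) : NatComputable fun h => numCandidates γ δ θ s excl h κ := by
  cases κ with
  | inl c => exact .const _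
  | inr t =>
    by_cases ht : t.1 = s
    · simpa [numCandidates, ht] using NatComputable.var t
    · simpa [numCandidates, ht] using NatComputable.const 0

theorem card_candidates_of_kind {n : Fin σ.numDoms → ℕ} {γ : (Σ s, Fin (σ.numConsts s)) → N}
    {δ : N → Fin σ.numDoms} {ν : N → Obj σ n} (hν : IsFrame γ δ ν) (θ : Fin m → N)
    (ω : Assignment σ (Obj σ n)) (excl : Finset (Fin (σ.numConsts s))) (κ : N ⊕ ObjType σ N) :
    ((candidates (fun i => ν (θ i)) s excl).filter fun u => objKind ν ω ⟨s, u⟩ = κ).card =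
      numCandidates γ δ θ s excl (typeHist ν ω) κ := by
  cases κ with
  | inl c =>
    simp only [objKind_eq_inl hν.injective, numCandidates]
    split_ifs with h
    · obtain ⟨hs, hex, hθ⟩ := h
      obtain ⟨u, hu⟩ : ∃ u : Dom σ n s, (⟨s, u⟩ : Obj σ n) = ν c := by
        rw [← hν.dom] at hs
        subst hs
        exact ⟨_, rfl⟩
      rw [Finset.card_eq_one]
      refine ⟨u, ?_⟩
      ext v
      simp only [candidates, Finset.mem_filter, Finset.mem_univ, true_and, Finset.mem_singleton]
      constructor
      · rintro ⟨-, hv⟩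
        exact eq_of_heq (Sigma.mk.inj (hv.trans hu.symm)).2
      · rintro rfl
        refine ⟨⟨fun a ha hv => ?_, fun i hi => ?_⟩, hu⟩
        · subst hv
          exact hex a ha (hν.injective (hu.symm.trans (hν.const ⟨s, a⟩).symm))
        · exact hθ i (hν.injective (hi.trans hu))
    · rw [Finset.card_eq_zero, Finset.filter_eq_empty_iff]
      intro u hu huc
      simp only [candidates, Finset.mem_filter, Finset.mem_univ, true_and] at hu
      refine h ⟨?_, fun a ha hc => hu.1 a ha ?_, fun i hi => hu.2 i ?_⟩
      · rw [← hν.dom, ← huc]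
      · subst hc
        exact eq_of_heq (Sigma.mk.inj (huc.trans (hν.const ⟨s, a⟩))).2
      · rw [hi, huc]
  | inr t =>
    simp only [numCandidates]
    split_ifs with h
    · rw [typeHist_eq_ncard, ← Set.ncard_coe_finset,
        ← Set.ncard_image_of_injective _ (f := fun u : Dom σ n s => (⟨s, u⟩ : Obj σ n))
          fun u v huv => eq_of_heq (Sigma.mk.inj huv).2]
      congr 1
      ext u
      simp only [Set.mem_image, Finset.coe_filter, Set.mem_ofPred_eq]
      constructor
      · rintro ⟨v, ⟨-, hv⟩, rfl⟩
        exact hv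
      · intro hu
        obtain ⟨hu1, hu2⟩ := objKind_eq_inr.1 hu
        obtain ⟨s', u⟩ := u
        obtain rfl : s' = s := by rw [← h, ← hu2]; rfl
        refine ⟨u, ⟨?_, hu⟩, rfl⟩
        simp only [candidates, Finset.mem_filter, Finset.mem_univ, true_and]
        refine ⟨fun a _ ha => hu1 ⟨γ ⟨s', a⟩, ?_⟩, fun i hi => hu1 ⟨θ i, hi⟩⟩
        rw [hν.const, ha]
    · rw [Finset.card_eq_zero, Finset.filter_eq_empty_iff]
      intro u _ hu
      obtain ⟨hu1, hu2⟩ := objKind_eq_inr.1 hu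
      exact h (by rw [← hu2]; rfl)

theorem computes_dpg {excl : Finset (Fin (σ.numConsts s))} {body : FODTree σ (m + k)}
    (ih : Computes body) : Computes (.dpg s k excl body) := by
  intro N _ γ δ θ A
  have := Fintype.ofFinite N
  choose fL hfL hval using exists_value_of_kinds (s := s) ih γ δ θ A
  -- The number of elements of each kind determines the list of the kinds up to the order.
  let f : (N ⊕ ObjType σ N → ℕ) → (ObjType σ N → ℕ) → (ℕ → List ℕ → ℝ) → ℝ := fun μ =>
    if h : ∃ L : Fin k → N ⊕ ObjType σ N, hist L = μ then fL h.choose else fun _ _ => 1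
  have hf : ∀ μ, RealComputable (f μ) := fun μ => by
    simp only [f]
    split_ifs
    exacts [hfL _, .one]
  let M : Finset (N ⊕ ObjType σ N → ℕ) :=
    (Fintype.piFinset fun _ => Finset.range (k + 1)).filter fun μ => ∑ κ, μ κ = k
  refine ⟨fun h Φ => ∏ μ ∈ M, f μ h Φ ^ ∏ κ, (numCandidates γ δ θ s excl h κ).choose (μ κ),
    .prod _ fun μ _ => (hf μ).pow (.prod _ fun κ _ =>
      (numCandidates_computable γ δ θ s excl κ).choose _), ?_⟩
  intro n ν ω Φ hν hsep hA
  rw [FODTree.ground, average_treeValue_node]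
  swap
  · intro x y hxy
    rw [compl_compl]
    rintro v ⟨hx, hy⟩
    obtain ⟨e, he⟩ := Set.mem_iUnion.1 hx
    obtain ⟨e', he'⟩ := Set.mem_iUnion.1 hy
    exact Near.mono (hν.fixedObjs_subset θ) (hsep.1 x y hxy e e' ⟨he, he'⟩)
  let kind : Dom σ n s → N ⊕ ObjType σ N := fun u => objKind ν ω ⟨s, u⟩
  let μ : Finset (Dom σ n s) → N ⊕ ObjType σ N → ℕ := fun x κ =>
    (x.filter fun u => kind u = κ).card
  have hone : ∀ x : Subsets (fun i => ν (θ i)) s excl k,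
      average (Near (Set.range ν))ᶜ (treeValue (.node ⟨m + k, ⋃ e : Fin k ≃ x.1,
        body.prvs (extend (fun i => ν (θ i)) e)⟩ (Fin k ≃ x.1) fun e =>
          body.ground (extend (fun i => ν (θ i)) e)) Φ) ω = f (μ x.1) (typeHist ν ω) Φ := by
    intro x
    have hcard : x.1.card = k := (Finset.mem_powersetCard.1 x.2).2
    have hμ : hist (fun u : x.1 => kind u) = μ x.1 := by
      funext κ
      change Nat.card _ = (x.1.filter fun u => kind u = κ).card
      rw [← Fintype.card_coe, ← Nat.card_eq_fintype_card]
      refine Nat.card_congr ((Equiv.subtypeSubtypeEquivSubtypeInter (fun u => u ∈ x.1)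
        fun u => kind u = κ).trans (Equiv.subtypeEquivRight fun u => ?_))
      rw [Finset.mem_filter]
    have hex : ∃ L : Fin k → N ⊕ ObjType σ N, hist L = μ x.1 :=
      ⟨fun i => kind ((Finset.equivFinOfCardEq hcard).symm i), by
        rw [← hμ, ← hist_comp_equiv (fun u : x.1 => kind u) (Finset.equivFinOfCardEq hcard).symm]⟩
    obtain ⟨e₀, he₀⟩ := exists_equiv_of_hist_eq (b' := fun u : x.1 => kind u)
      (hex.choose_spec.trans hμ.symm)
    have hfμ : f (μ x.1) = fL hex.choose := dif_pos hex
    rw [hfμ]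
    exact hval hex.choose n ν ω Φ hν hA _ x.1 e₀ he₀ fun e => hsep.2 x e
  rw [Finset.prod_congr rfl fun x _ => hone x]
  have hmaps : ∀ x ∈ (candidates (fun i => ν (θ i)) s excl).powersetCard k, μ x ∈ M := by
    intro x hx
    have hsum : ∑ κ, μ x κ = k := by
      rw [← (Finset.mem_powersetCard.1 hx).2, Finset.card_eq_sum_card_fiberwise (f := kind)
        (t := Finset.univ) fun _ _ => Finset.mem_coe.2 (Finset.mem_univ _)]
    refine Finset.mem_filter.2 ⟨Fintype.mem_piFinset.2 fun κ => ?_, hsum⟩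
    rw [Finset.mem_range, Nat.lt_succ_iff, ← hsum]
    exact Finset.single_le_sum (fun _ _ => Nat.zero_le _) (Finset.mem_univ κ)
  rw [Finset.prod_coe_sort ((candidates (fun i => ν (θ i)) s excl).powersetCard k)
    fun x => f (μ x) (typeHist ν ω) Φ, ← Finset.prod_fiberwise_of_maps_to hmaps]
  refine Finset.prod_congr rfl fun μ₀ hμ₀ => ?_
  rw [Finset.prod_congr rfl fun x hx => by rw [(Finset.mem_filter.1 hx).2], Finset.prod_const]
  congr 1
  have hcount := card_subsets_with_types kind (candidates (fun i => ν (θ i)) s excl) μ₀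
  have hprod := hcount.trans (Finset.prod_congr rfl fun κ _ => congrArg (Nat.choose · (μ₀ κ))
    (by convert card_candidates_of_kind hν θ ω excl κ))
  refine Eq.trans ?_ hprod
  congr 1
  ext x
  simp only [Finset.mem_filter, Finset.mem_powersetCard, Finset.mem_powerset, funext_iff, and_assoc]
  refine and_congr_right fun _ => ⟨fun h κ => Eq.trans (by simp only [μ]; congr!) (h.2 κ),
    fun h => ?_⟩
  have h' : ∀ κ, μ x κ = μ₀ κ := fun κ => Eq.trans (by simp only [μ]; congr!) (h κ)
  refine ⟨?_, h'⟩
  rw [← (Finset.mem_filter.1 hμ₀).2, Finset.card_eq_sum_card_fiberwise (f := kind)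
    (t := Finset.univ) fun _ _ => Finset.mem_coe.2 (Finset.mem_univ _)]
  exact Finset.sum_congr rfl fun κ _ => h' κ

theorem computes : ∀ {m : ℕ} (t : FODTree σ m), Computes t
  | _, .leaf f as => computes_leaf f as
  | _, .node _ ch => computes_node fun i => computes (ch i)
  | _, .dpg _ _ _ body => computes_dpg (computes body)

end Groundings

/-! ### Clusters of liftable trees -/

section Liftable

variable {σ : Vocabulary} {n : Fin σ.numDoms → ℕ}

/-- Shared random variables that do not belong to the cutset belong to the context. -/
theorem DTree.shared_subset_cluster {L V ι : Type} [Fintype ι] (l : L) (ch : ι → DTree L V)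
    (acut : Set V) : (DTree.node l ι ch).shared ⊆ (DTree.node l ι ch).cluster acut := by
  intro v hv
  by_cases h : v ∈ acut
  · obtain ⟨i, -, -, hi, -⟩ := hv
    exact .inr ⟨Set.mem_iUnion_of_mem i hi, h⟩
  · exact .inl ⟨hv, h⟩

theorem DTree.cluster_subset_rv {L V : Type} (D : DTree L V) (acut : Set V) :
    D.cluster acut ⊆ D.rv := by
  cases D with
  | leaf l f args => exact subset_rfl
  | node l ι ch =>
    rintro v (⟨⟨i, -, -, hi, -⟩, -⟩ | hv)
    exacts [Set.mem_iUnion_of_mem i hi, hv.1]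

/-- The clusters consist of parametrized random variables with at most one logical variable. -/
def HasLiftableClusters (D : DTree (Label σ n) (RandVar σ n)) (acut : Set (RandVar σ n)) : Prop :=
  ∀ N ∈ D.nodes acut, ∀ a ∈ foCluster N.1 N.2, a.2.numLogvars N.1.label.scope ≤ 1

theorem HasLiftableClusters.child {l : Label σ n} {ι : Type} [Fintype ι]
    {ch : ι → DTree (Label σ n) (RandVar σ n)} {acut : Set (RandVar σ n)}
    (h : HasLiftableClusters (.node l ι ch) acut) (i : ι) :
    HasLiftableClusters (ch i) (acut ∪ (DTree.node l ι ch).cutset acut) :=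
  fun N hN => h N (.inr (Set.mem_iUnion_of_mem i hN))

theorem DTree.self_mem_nodes {L V : Type} (D : DTree L V) (acut : Set V) :
    (D, acut) ∈ D.nodes acut := by
  cases D with
  | leaf l f args => rfl
  | node l ι ch => exact .inl rfl

/-- The label of `D` describes the random variables of `D`, and the objects that count as fixed
at the root of `D` belong to `K`. -/
structure IsScope (D : DTree (Label σ n) (RandVar σ n)) (K : Set (Obj σ n)) : Prop where
  exists_prv : ∀ v ∈ D.rv, ∃ b ∈ D.label.prvs, b.atom.ground b.subst = v
  subst_mem : ∀ b ∈ D.label.prvs, ∀ i : Fin b.m, (i : ℕ) < D.label.scope → b.subst i ∈ K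
  const_mem : ∀ c : Σ s, Fin (σ.numConsts s), (⟨c.1, .inl c.2⟩ : Obj σ n) ∈ K

theorem IsScope.cluster_subset_near {D : DTree (Label σ n) (RandVar σ n)} {K : Set (Obj σ n)}
    (hK : IsScope D K) {acut : Set (RandVar σ n)} (h : HasLiftableClusters D acut) :
    D.cluster acut ⊆ Near K := by
  intro v hv
  obtain ⟨b, hb, rfl⟩ := hK.exists_prv v (D.cluster_subset_rv acut hv)
  have h1 := h _ (D.self_mem_nodes acut) ⟨b.m, b.atom⟩ ⟨b.subst, hb, hv⟩
  rw [Atom.numLogvars, Set.ncard_le_one] at h1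
  have key : ∀ i, (b.atom.ground b.subst).2 i ∉ K →
      ∃ p, b.atom.args i = .inr p ∧ D.label.scope ≤ p := by
    intro i hi
    cases hp : b.atom.args i with
    | inl c =>
      refine (hi ?_).elim
      change evalArg b.subst (b.atom.args i) ∈ K
      rw [hp]
      exact hK.const_mem c
    | inr p =>
      refine ⟨p, rfl, not_lt.1 fun hlt => hi ?_⟩
      change evalArg b.subst (b.atom.args i) ∈ K
      rw [hp]
      exact hK.subst_mem b hb p hlt
  intro i j hi hj
  obtain ⟨p, hp, hp'⟩ := key i hi
  obtain ⟨q, hq, hq'⟩ := key j hj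
  have hpq := h1 p ⟨hp', i, hp⟩ q ⟨hq', j, hq⟩
  change evalArg b.subst (b.atom.args i) = evalArg b.subst (b.atom.args j)
  rw [hp, hq, hpq]

theorem label_ground {m : ℕ} (t : FODTree σ m) (η : Fin m → Obj σ n) :
    (t.ground η).label = ⟨m, t.prvs η⟩ := by
  cases t <;> rfl

theorem exists_prv_of_mem_rv {m : ℕ} (t : FODTree σ m) (η : Fin m → Obj σ n) (v : RandVar σ n)
    (hv : v ∈ (t.ground η).rv) : ∃ b ∈ t.prvs η, b.atom.ground b.subst = v := by
  induction t with
  | leaf f as =>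
    obtain ⟨a, ha, rfl⟩ := List.mem_map.1 hv
    exact ⟨⟨_, a, η⟩, ⟨a, ha, rfl⟩, rfl⟩
  | node j ch ih =>
    obtain ⟨i, hi⟩ := Set.mem_iUnion.1 hv
    obtain ⟨b, hb, h⟩ := ih i η hi
    exact ⟨b, Set.mem_iUnion_of_mem i hb, h⟩
  | dpg s k excl body ih =>
    obtain ⟨x, hx⟩ := Set.mem_iUnion.1 hv
    obtain ⟨e, he⟩ := Set.mem_iUnion.1 hx
    obtain ⟨b, hb, h⟩ := ih _ he
    exact ⟨b, Set.mem_iUnion_of_mem x (Set.mem_iUnion_of_mem e hb), h⟩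

theorem extend_castAdd {m k : ℕ} (η : Fin m → Obj σ n) {s : Fin σ.numDoms}
    {x : Finset (Dom σ n s)} (e : Fin k ≃ x) (i : ℕ) (hi : i < m) (hi' : i < m + k) :
    extend η e ⟨i, hi'⟩ = η ⟨i, hi⟩ :=
  Fin.append_left η _ ⟨i, hi⟩

theorem subst_eq_of_mem_prvs {m : ℕ} (t : FODTree σ m) (η : Fin m → Obj σ n) (b : PRVInst σ n)
    (hb : b ∈ t.prvs η) (i : Fin b.m) (hi : (i : ℕ) < m) : b.subst i = η ⟨i, hi⟩ := by
  induction t with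
  | leaf f as =>
    obtain ⟨a, -, rfl⟩ := hb
    rfl
  | node j ch ih =>
    obtain ⟨i', hi'⟩ := Set.mem_iUnion.1 hb
    exact ih i' η hi' hi
  | dpg s k excl body ih =>
    obtain ⟨x, hx⟩ := Set.mem_iUnion.1 hb
    obtain ⟨e, he⟩ := Set.mem_iUnion.1 hx
    rw [ih _ he (hi.trans_le (Nat.le_add_right _ _)), extend_castAdd]

theorem isScope_ground {m : ℕ} (t : FODTree σ m) (η : Fin m → Obj σ n) :
    IsScope (t.ground η) (fixedObjs η) where
  exists_prv v hv := by
    rw [label_ground]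
    exact exists_prv_of_mem_rv t η v hv
  subst_mem b hb i hi := by
    rw [label_ground] at hb hi
    exact .inr ⟨_, (subst_eq_of_mem_prvs t η b hb i hi).symm⟩
  const_mem c := .inl ⟨c, rfl⟩

/-- The child of a decomposition into partial groundings that belongs to the set `x`. -/
def groundPerms {m k : ℕ} {s : Fin σ.numDoms} (body : FODTree σ (m + k)) (η : Fin m → Obj σ n)
    (x : Finset (Dom σ n s)) : DTree (Label σ n) (RandVar σ n) :=
  .node ⟨m + k, ⋃ e : Fin k ≃ x, body.prvs (extend η e)⟩ (Fin k ≃ x) fun e =>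
    body.ground (extend η e)

theorem fixedObjs_extend {m k : ℕ} {s : Fin σ.numDoms} (η : Fin m → Obj σ n)
    {x : Finset (Dom σ n s)} (e : Fin k ≃ x) :
    fixedObjs (extend η e) = fixedObjs η ∪ Sigma.mk s '' x := by
  rw [fixedObjs, fixedObjs, Set.union_assoc]
  congr 1
  ext o
  constructor
  · rintro ⟨i, rfl⟩
    induction i using Fin.addCases with
    | left i => exact .inl ⟨i, (Fin.append_left η _ i).symm⟩
    | right i => exact .inr ⟨e i, (e i).2, (Fin.append_right η (fun i => ⟨s, e i⟩) i).symm⟩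
  · rintro (⟨i, rfl⟩ | ⟨u, hu, rfl⟩)
    · exact ⟨Fin.castAdd k i, Fin.append_left η _ i⟩
    · refine ⟨Fin.natAdd m (e.symm ⟨u, hu⟩), (Fin.append_right η _ _).trans ?_⟩
      simp

theorem isScope_groundPerms {m k : ℕ} {s : Fin σ.numDoms} (body : FODTree σ (m + k))
    (η : Fin m → Obj σ n) (x : Finset (Dom σ n s)) (e : Fin k ≃ x) :
    IsScope (groundPerms body η x) (fixedObjs (extend η e)) where
  exists_prv v hv := by
    obtain ⟨e', he'⟩ := Set.mem_iUnion.1 hv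
    obtain ⟨b, hb, h⟩ := exists_prv_of_mem_rv body _ v he'
    exact ⟨b, Set.mem_iUnion_of_mem e' hb, h⟩
  subst_mem b hb i hi := by
    obtain ⟨e', he'⟩ := Set.mem_iUnion.1 hb
    rw [fixedObjs_extend, ← fixedObjs_extend η e', subst_eq_of_mem_prvs body _ b he' i hi]
    exact .inr ⟨_, rfl⟩
  const_mem c := .inl ⟨c, rfl⟩

theorem separated_of_hasLiftableClusters {m : ℕ} (t : FODTree σ m) (η : Fin m → Obj σ n)
    (acut : Set (RandVar σ n)) (h : HasLiftableClusters (t.ground η) acut) : Separated t η := by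
  induction t generalizing acut with
  | leaf f as => trivial
  | node j ch ih =>
    refine ⟨fun i i' hi v hv => (isScope_ground (.node j ch) η).cluster_subset_near h
      (DTree.shared_subset_cluster _ _ _ ⟨i, i', hi, hv⟩), fun i => ih i η _ (h.child i)⟩
  | dpg s k excl body ih =>
    refine ⟨fun x y hxy e e' v hv => (isScope_ground (.dpg s k excl body) η).cluster_subset_near h
      (DTree.shared_subset_cluster _ _ _ ⟨x, y, hxy, ⟨Set.mem_iUnion_of_mem e hv.1,
        Set.mem_iUnion_of_mem e' hv.2⟩⟩), fun x e => ⟨fun e' hee' v hv =>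
      (isScope_groundPerms body η x.1 e).cluster_subset_near (h.child x)
        (DTree.shared_subset_cluster _ _ _ ⟨e, e', hee', hv⟩), ?_⟩⟩
    exact ih _ _ ((h.child x).child e)

end Liftable

/-! ### Symmetries of grounded trees -/

section Symmetry

variable {L V : Type}

/-- The second tree arises from the first one by renaming the random variables by `f`, and by
reordering children. -/
inductive DTree.Renames (f : V → V) : DTree L V → DTree L V → Prop
  | leaf (l l' : L) (i : ℕ) (args : List V) : Renames f (.leaf l i args) (.leaf l' i (args.map f))
  | node (l l' : L) {ι ι' : Type} [Fintype ι] [Fintype ι'] {ch : ι → DTree L V}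
      {ch' : ι' → DTree L V} (ε : ι ≃ ι') (h : ∀ i, Renames f (ch i) (ch' (ε i))) :
      Renames f (.node l ι ch) (.node l' ι' ch')

namespace DTree.Renames

variable {f : V → V} {D D' : DTree L V}

theorem rv_eq (h : Renames f D D') : D'.rv = f '' D.rv := by
  induction h with
  | leaf l l' i args =>
    ext v
    simp [DTree.rv]
  | node l l' ε h ih =>
    simp only [DTree.rv, Set.image_iUnion, ← ih]
    exact (ε.surjective.iUnion_comp fun i => (_ : DTree L V).rv).symm

theorem weight_eq (h : Renames f D D') (Φ : ℕ → List ℕ → ℝ) (τ : V → ℕ) :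
    D'.weight Φ τ = D.weight Φ (τ ∘ f) := by
  induction h with
  | leaf l l' i args => simp [DTree.weight]
  | node l l' ε h ih =>
    simp only [DTree.weight, ← ih]
    exact (Fintype.prod_equiv ε _ _ fun _ => rfl).symm

theorem mem_shared_iff (h : Renames f D D') (hf : Function.Injective f) (v : V) :
    f v ∈ D'.shared ↔ v ∈ D.shared := by
  cases h with
  | leaf l l' i args => rfl
  | @node l l' ι ι' _ _ ch ch' ε h =>
    have key : ∀ i, f v ∈ (ch' (ε i)).rv ↔ v ∈ (ch i).rv := fun i => by
      rw [(h i).rv_eq, hf.mem_set_image]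
    constructor
    · rintro ⟨i, j, hij, hi, hj⟩
      obtain ⟨i, rfl⟩ := ε.surjective i
      obtain ⟨j, rfl⟩ := ε.surjective j
      exact ⟨i, j, fun e => hij (e ▸ rfl), (key i).1 hi, (key j).1 hj⟩
    · rintro ⟨i, j, hij, hi, hj⟩
      exact ⟨ε i, ε j, ε.injective.ne hij, (key i).2 hi, (key j).2 hj⟩

theorem mem_cutset_iff (h : Renames f D D') (hf : Function.Injective f) {acut acut' : Set V}
    (ha : ∀ v, f v ∈ acut' ↔ v ∈ acut) (v : V) : f v ∈ D'.cutset acut' ↔ v ∈ D.cutset acut :=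
  and_congr (h.mem_shared_iff hf v) (not_congr (ha v))

theorem mem_rv_iff (h : Renames f D D') (hf : Function.Injective f) (v : V) :
    f v ∈ D'.rv ↔ v ∈ D.rv := by
  rw [h.rv_eq, hf.mem_set_image]

theorem mem_cluster_iff (h : Renames f D D') (hf : Function.Injective f) {acut acut' : Set V}
    (ha : ∀ v, f v ∈ acut' ↔ v ∈ acut) (v : V) : f v ∈ D'.cluster acut' ↔ v ∈ D.cluster acut := by
  cases h with
  | leaf l l' i args => exact (Renames.leaf l l' i args).mem_rv_iff hf v
  | node l l' ε h =>
    have h' := Renames.node l l' ε h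
    exact or_congr (h'.mem_cutset_iff hf ha v) (and_congr (h'.mem_rv_iff hf v) (ha v))

end DTree.Renames

variable {σ : Vocabulary} {n : Fin σ.numDoms → ℕ}

/-- The permutation of all objects that consists of permutations of the domains. -/
abbrev permObj (π : ∀ s, Equiv.Perm (Dom σ n s)) : Equiv.Perm (Obj σ n) := Equiv.sigmaCongrRight π

/-- The bijection between a set of objects and its image. -/
def imageEquiv {α : Type} (p : Equiv.Perm α) (x : Finset α) : x ≃ x.map p.toEmbedding :=
  p.subtypeEquiv fun _ => (Finset.mem_map' p.toEmbedding).symm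

theorem permObj_extend (π : ∀ s, Equiv.Perm (Dom σ n s)) {m k : ℕ} {s : Fin σ.numDoms}
    (η : Fin m → Obj σ n) {x : Finset (Dom σ n s)} (e : Fin k ≃ x) :
    extend (fun i => permObj π (η i)) (e.trans (imageEquiv (π s) x)) =
      fun i => permObj π (extend η e i) := by
  funext i
  induction i using Fin.addCases with
  | left i => simp [extend]
  | right i => simp [extend, imageEquiv]

theorem renames_groundPerms (π : ∀ s, Equiv.Perm (Dom σ n s)) {m k : ℕ} {s : Fin σ.numDoms}
    {body : FODTree σ (m + k)}
    (h : ∀ η, DTree.Renames (Pattern.rename (permObj π)) (body.ground η)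
      (body.ground fun i => permObj π (η i))) (η : Fin m → Obj σ n) (x : Finset (Dom σ n s)) :
    DTree.Renames (Pattern.rename (permObj π)) (groundPerms body η x)
      (groundPerms body (fun i => permObj π (η i)) (x.map (π s).toEmbedding)) := by
  refine .node _ _ ((Equiv.refl _).equivCongr (imageEquiv (π s) x)) fun e => ?_
  have := h (extend η e)
  rwa [← permObj_extend π η e] at this

theorem map_mem_candidates_iff (π : ∀ s, Equiv.Perm (Dom σ n s))
    (hπ : ∀ s c, π s (.inl c) = .inl c) {m : ℕ} (η : Fin m → Obj σ n) {s : Fin σ.numDoms}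
    (excl : Finset (Fin (σ.numConsts s))) (u : Dom σ n s) :
    π s u ∈ candidates (fun i => permObj π (η i)) s excl ↔ u ∈ candidates η s excl := by
  simp only [candidates, Finset.mem_filter, Finset.mem_univ, true_and]
  refine and_congr (forall₂_congr fun c _ => ?_) (forall_congr' fun i => ?_)
  · exact not_congr ⟨fun h => (π s).injective (h.trans (hπ s c).symm), fun h => h ▸ hπ s c⟩
  · exact (permObj π).injective.ne_iff (x := η i) (y := ⟨s, u⟩)

theorem renames_ground (π : ∀ s, Equiv.Perm (Dom σ n s))
    (hπ : ∀ s c, π s (.inl c) = .inl c) {m : ℕ} (t : FODTree σ m) (η : Fin m → Obj σ n) :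
    DTree.Renames (Pattern.rename (permObj π)) (t.ground η)
      (t.ground fun i => permObj π (η i)) := by
  induction t with
  | leaf f as =>
    have h := DTree.Renames.leaf (f := Pattern.rename (permObj π))
      (FODTree.ground (.leaf f as) η).label
      (FODTree.ground (.leaf f as) fun i => permObj π (η i)).label f (as.map fun a => a.ground η)
    rw [List.map_map] at h
    refine (congrArg (DTree.Renames _ _) (congrArg (DTree.leaf _ _) ?_)).mp h
    refine List.map_congr_left fun a _ => ?_
    simp only [Atom.ground, Function.comp_apply, Pattern.rename]
    congr 1
    funext j
    cases a.args j with
    | inl c => exact congrArg (Sigma.mk c.1) (hπ c.1 c.2)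
    | inr i => rfl
  | node j ch ih => exact .node _ _ (Equiv.refl _) fun i => ih i η
  | dpg s k excl body ih =>
    refine .node _ _ ((π s).finsetCongr.subtypeEquiv fun x => ?_) fun x =>
      renames_groundPerms π ih η x.1
    rw [Finset.mem_powersetCard, Finset.mem_powersetCard, Equiv.finsetCongr_apply,
      Finset.card_map]
    refine and_congr_left fun _ => ⟨fun h u hu => ?_, fun h u hu => ?_⟩
    · obtain ⟨u, hu', rfl⟩ := Finset.mem_map.1 hu
      exact (map_mem_candidates_iff π hπ η excl u).2 (h hu')
    · exact (map_mem_candidates_iff π hπ η excl u).1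
        (h (Finset.mem_map_of_mem (π s).toEmbedding hu))

/-- The permutations `π` of the domains fix all objects in `K`. -/
def Fixes (π : ∀ s, Equiv.Perm (Dom σ n s)) (K : Set (Obj σ n)) : Prop :=
  ∀ u ∈ K, permObj π u = u

theorem Fixes.renames_ground {π : ∀ s, Equiv.Perm (Dom σ n s)} {m : ℕ} {η : Fin m → Obj σ n}
    (h : Fixes π (fixedObjs η)) (t : FODTree σ m) :
    DTree.Renames (Pattern.rename (permObj π)) (t.ground η) (t.ground η) := by
  have h1 := FODtrees.renames_ground π
    (fun s c => eq_of_heq (Sigma.mk.inj (h ⟨s, .inl c⟩ (.inl ⟨⟨s, c⟩, rfl⟩))).2) t η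
  rwa [show (fun i => permObj π (η i)) = η from funext fun i => h _ (.inr ⟨i, rfl⟩)] at h1

theorem Fixes.renames_groundPerms {π : ∀ s, Equiv.Perm (Dom σ n s)} {m k : ℕ}
    {η : Fin m → Obj σ n} {s : Fin σ.numDoms} {x : Finset (Dom σ n s)}
    (h : ∀ e : Fin k ≃ x, Fixes π (fixedObjs (extend η e))) (body : FODTree σ (m + k)) :
    DTree.Renames (Pattern.rename (permObj π)) (groundPerms body η x) (groundPerms body η x) :=
  .node _ _ (Equiv.refl _) fun e => (h e).renames_ground body

/-- The subtree `D` and the union `acut` of the cutsets above it are invariant under all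
permutations of the domains that fix the objects in `K`. -/
structure IsSymmetric (D : DTree (Label σ n) (RandVar σ n)) (acut : Set (RandVar σ n))
    (K : Set (Obj σ n)) : Prop where
  renames : ∀ π, Fixes π K → DTree.Renames (Pattern.rename (permObj π)) D D
  acut : ∀ π, Fixes π K → ∀ v, Pattern.rename (permObj π) v ∈ acut ↔ v ∈ acut

theorem IsSymmetric.child_acut {D : DTree (Label σ n) (RandVar σ n)} {acut : Set (RandVar σ n)}
    {K : Set (Obj σ n)} (h : IsSymmetric D acut K) (π : ∀ s, Equiv.Perm (Dom σ n s))
    (hπ : Fixes π K) (v : RandVar σ n) :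
    Pattern.rename (permObj π) v ∈ acut ∪ D.cutset acut ↔ v ∈ acut ∪ D.cutset acut :=
  or_congr (h.acut π hπ v) ((h.renames π hπ).mem_cutset_iff
    (Pattern.rename_injective (permObj π).injective) (h.acut π hπ) v)

/-- At every node, the objects that count as fixed there are boundedly many, and all permutations
that fix these are symmetries of the subtree below the node and of the cutsets above it. -/
theorem exists_symmetric_of_mem_nodes {m : ℕ} (t : FODTree σ m) :
    ∃ B : ℕ, ∀ (n : Fin σ.numDoms → ℕ) (η : Fin m → Obj σ n) (acut : Set (RandVar σ n)),
      (∀ π, Fixes π (fixedObjs η) → ∀ v, Pattern.rename (permObj π) v ∈ acut ↔ v ∈ acut) →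
      HasLiftableClusters (t.ground η) acut →
      ∀ N ∈ (t.ground η).nodes acut, ∃ m' ≤ B, ∃ η' : Fin m' → Obj σ n,
        N.1.cluster N.2 ⊆ Near (fixedObjs η') ∧ IsSymmetric N.1 N.2 (fixedObjs η') := by
  induction t with
  | @leaf m f as =>
    refine ⟨m, fun n η acut ha h N hN => ?_⟩
    obtain rfl : N = _ := hN
    exact ⟨_, le_rfl, η, (isScope_ground _ η).cluster_subset_near h,
      fun π hπ => hπ.renames_ground (.leaf f as), ha⟩
  | @node m j ch ih =>
    choose B hB using ih
    refine ⟨m + ∑ i, B i, fun n η acut ha h N hN => ?_⟩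
    have hsym : IsSymmetric (FODTree.ground (.node j ch) η) acut (fixedObjs η) :=
      ⟨fun π hπ => hπ.renames_ground (.node j ch), ha⟩
    rcases hN with hN | hN
    · obtain rfl : N = _ := hN
      exact ⟨m, Nat.le_add_right _ _, η, (isScope_ground (.node j ch) η).cluster_subset_near h,
        hsym⟩
    · obtain ⟨i, hi⟩ := Set.mem_iUnion.1 hN
      obtain ⟨m', hm', h'⟩ := hB i n η _ hsym.child_acut (h.child i) N hi
      refine ⟨m', hm'.trans ?_, h'⟩
      exact (Finset.single_le_sum (fun _ _ => Nat.zero_le _) (Finset.mem_univ i)).trans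
        (Nat.le_add_left _ _)
  | @dpg m s k excl body ih =>
    obtain ⟨B, hB⟩ := ih
    refine ⟨m + k + B, fun n η acut ha h N hN => ?_⟩
    have hsym : IsSymmetric (FODTree.ground (.dpg s k excl body) η) acut (fixedObjs η) :=
      ⟨fun π hπ => hπ.renames_ground (.dpg s k excl body), ha⟩
    rcases hN with hN | hN
    · obtain rfl : N = _ := hN
      exact ⟨m, by omega, η, (isScope_ground (.dpg s k excl body) η).cluster_subset_near h, hsym⟩
    obtain ⟨x, hx⟩ := Set.mem_iUnion.1 hN
    have e₀ : Fin k ≃ x.1 := (Finset.equivFinOfCardEq (Finset.mem_powersetCard.1 x.2).2).symm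
    have hfix : ∀ π (e : Fin k ≃ x.1), Fixes π (fixedObjs (extend η e)) → Fixes π (fixedObjs η) :=
      fun π e hπ u hu => hπ u (by rw [fixedObjs_extend]; exact .inl hu)
    have hsym' : ∀ e : Fin k ≃ x.1, IsSymmetric (groundPerms body η x.1)
        (acut ∪ (FODTree.ground (.dpg s k excl body) η).cutset acut) (fixedObjs (extend η e)) := by
      intro e
      refine ⟨fun π hπ => Fixes.renames_groundPerms (fun e' => ?_) body,
        fun π hπ => hsym.child_acut π (hfix π e hπ)⟩
      rwa [fixedObjs_extend, ← fixedObjs_extend η e]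
    rcases hx with hN | hN
    · obtain rfl : N = _ := hN
      exact ⟨m + k, by omega, extend η e₀,
        (isScope_groundPerms body η x.1 e₀).cluster_subset_near (h.child x), hsym' e₀⟩
    · obtain ⟨e, he⟩ := Set.mem_iUnion.1 hN
      obtain ⟨m', hm', h'⟩ := hB n (extend η e) _ (hsym' e).child_acut ((h.child x).child e) N he
      exact ⟨m', by omega, h'⟩

end Symmetry

/-! ### Counting partitions of the clusters -/

section SumOut

open scoped Classical

variable {L V : Type} [Fintype V] {r : V → ℕ} {D : DTree L V} {S : Set V}

theorem mem_piFinset_iff_of_sumOut {τ ω : V → ℕ} :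
    τ ∈ Fintype.piFinset (fun v => if v ∈ S then Finset.range (r v) else {ω v}) ↔
      (∀ v ∈ S, τ v < r v) ∧ ∀ v ∉ S, τ v = ω v := by
  rw [Fintype.mem_piFinset, ← forall_and]
  refine forall_congr' fun v => ?_
  by_cases hv : v ∈ S <;> simp [hv]

/-- Only the values of the random variables in the tree that are not summed out matter. -/
theorem DTree.sumOut_congr {ω ω' : V → ℕ} (h : ∀ v ∈ D.rv, v ∉ S → ω v = ω' v)
    (Φ : ℕ → List ℕ → ℝ) : D.sumOut r Φ S ω = D.sumOut r Φ S ω' := by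
  refine Finset.sum_nbij' (fun τ => S.piecewise τ ω') (fun τ => S.piecewise τ ω) ?_ ?_ ?_ ?_ ?_
  · intro τ hτ
    rw [mem_piFinset_iff_of_sumOut] at hτ ⊢
    exact ⟨fun v hv => by simpa [hv] using hτ.1 v hv, fun v hv => by simp [hv]⟩
  · intro τ hτ
    rw [mem_piFinset_iff_of_sumOut] at hτ ⊢
    exact ⟨fun v hv => by simpa [hv] using hτ.1 v hv, fun v hv => by simp [hv]⟩
  · intro τ hτ
    rw [mem_piFinset_iff_of_sumOut] at hτ
    funext v
    by_cases hv : v ∈ S <;> simp [hv, hτ.2 v]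
  · intro τ hτ
    rw [mem_piFinset_iff_of_sumOut] at hτ
    funext v
    by_cases hv : v ∈ S <;> simp [hv, hτ.2 v]
  · intro τ hτ
    rw [mem_piFinset_iff_of_sumOut] at hτ
    refine D.weight_congr Φ fun v hv => ?_
    by_cases hS : v ∈ S
    · simp [hS]
    · simp [hS, hτ.2 v hS, h v hv hS]

/-- Symmetries of the tree are symmetries of its value. -/
theorem DTree.sumOut_comp {f : V → V} (hf : Function.Injective f) (hr : ∀ v, r (f v) = r v)
    (hS : ∀ v, f v ∈ S ↔ v ∈ S) {Φ : ℕ → List ℕ → ℝ}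
    (hw : ∀ τ, D.weight Φ (τ ∘ f) = D.weight Φ τ) (ω : V → ℕ) :
    D.sumOut r Φ S (ω ∘ f) = D.sumOut r Φ S ω := by
  obtain ⟨e, rfl⟩ : ∃ e : V ≃ V, ⇑e = f :=
    ⟨Equiv.ofBijective f (Finite.injective_iff_bijective.1 hf), rfl⟩
  refine Finset.sum_nbij' (fun τ => τ ∘ e.symm) (fun τ => τ ∘ e) ?_ ?_ ?_ ?_ ?_
  · intro τ hτ
    refine Fintype.mem_piFinset.2 fun v => ?_
    obtain ⟨v, rfl⟩ := e.surjective v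
    simpa [hr, hS] using Fintype.mem_piFinset.1 hτ v
  · intro τ hτ
    refine Fintype.mem_piFinset.2 fun v => ?_
    simpa [hr, hS] using Fintype.mem_piFinset.1 hτ (e v)
  · intro τ _
    funext v
    simp
  · intro τ _
    funext v
    simp
  · intro τ _
    rw [← hw (τ ∘ e.symm)]
    congr 1
    funext v
    simp

end SumOut

section Partition

open scoped Classical

variable {σ : Vocabulary} {n : Fin σ.numDoms → ℕ} {K : Set (Obj σ n)}

/-- The permutation of one domain, and the identity on all others. -/
noncomputable def onDom (s : Fin σ.numDoms) (p : Equiv.Perm (Dom σ n s)) :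
    ∀ s, Equiv.Perm (Dom σ n s) :=
  Function.update (fun _ => 1) s p

theorem permObj_onDom_self {s : Fin σ.numDoms} (p : Equiv.Perm (Dom σ n s)) (u : Dom σ n s) :
    permObj (onDom s p) ⟨s, u⟩ = ⟨s, p u⟩ := by
  simp [onDom]

theorem permObj_onDom_of_ne {s : Fin σ.numDoms} (p : Equiv.Perm (Dom σ n s)) {u : Obj σ n}
    (hu : u.1 ≠ s) : permObj (onDom s p) u = u := by
  obtain ⟨s', u⟩ := u
  simp [onDom, Function.update_of_ne (show s' ≠ s from hu)]

theorem fixes_onDom {s : Fin σ.numDoms} {p : Equiv.Perm (Dom σ n s)}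
    (hp : ∀ u : Dom σ n s, (⟨s, u⟩ : Obj σ n) ∈ K → p u = u) : Fixes (onDom s p) K := by
  rintro ⟨s', u⟩ hu
  by_cases hs : s' = s
  · subst hs
    rw [permObj_onDom_self, hp u hu]
  · exact permObj_onDom_of_ne p hs

theorem Fixes.rename_withObj {π : ∀ s, Equiv.Perm (Dom σ n s)} (hπ : Fixes π K) (u : Obj σ n)
    (a : Pattern σ (Option K)) :
    Pattern.rename (permObj π) (Pattern.rename (withObj Subtype.val u) a) =
      Pattern.rename (withObj Subtype.val (permObj π u)) a := by
  simp only [Pattern.rename]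
  congr 1
  funext j
  cases a.2 j with
  | none => rfl
  | some b => exact hπ _ b.2

theorem Fixes.rename_val {π : ∀ s, Equiv.Perm (Dom σ n s)} (hπ : Fixes π K) (a : Pattern σ K) :
    Pattern.rename (permObj π) (Pattern.rename Subtype.val a) = Pattern.rename Subtype.val a := by
  simp only [Pattern.rename]
  congr 1
  funext j
  exact hπ _ (a.2 j).2

/-- If the random variables in the cluster have at most one object outside `K`, and permutations
that fix `K` are symmetries, then the atoms over `K` in the cluster are left alone, and for
every domain there is one group, with one tuple for each object `u` of the domain outside `K`,
which consists of the random variables in the cluster that contain `u` and otherwise only objects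
in `K`. -/
theorem hasCountingPartition {D : DTree (Label σ n) (RandVar σ n)} {acut : Set (RandVar σ n)}
    (hnear : D.cluster acut ⊆ Near K) (hsym : IsSymmetric D acut K) {w : ℕ}
    (hw : Nat.card (Pattern σ K) ≤ w) (hw' : σ.numDoms ≤ w)
    (hw'' : Nat.card (OpenPattern σ K) ≤ w) : HasCountingPartition w D acut := by
  have hinj : ∀ π : ∀ s, Equiv.Perm (Dom σ n s),
      Function.Injective (Pattern.rename (σ := σ) (permObj π)) :=
    fun π => Pattern.rename_injective (permObj π).injective
  have hclus : ∀ π, Fixes π K → ∀ v,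
      Pattern.rename (permObj π) v ∈ D.cluster acut ↔ v ∈ D.cluster acut := fun π hπ v =>
    (hsym.renames π hπ).mem_cluster_iff (hinj π) (hsym.acut π hπ) v
  let A : Type := {a : Pattern σ K // Pattern.rename Subtype.val a ∈ D.cluster acut}
  let Q : Fin σ.numDoms → Type := fun s => {a : OpenPattern σ K // ∀ u : Dom σ n s,
    (⟨s, u⟩ : Obj σ n) ∉ K → Pattern.rename (withObj Subtype.val ⟨s, u⟩) a.1 ∈ D.cluster acut}
  let U : Fin σ.numDoms → Type := fun s => {u : Dom σ n s // (⟨s, u⟩ : Obj σ n) ∉ K}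
  let eA : Fin (Nat.card A) ≃ A := (Finite.equivFin A).symm
  let eQ : ∀ s, Fin (Nat.card (Q s)) ≃ Q s := fun s => (Finite.equivFin (Q s)).symm
  let eU : ∀ s, Fin (Nat.card (U s)) ≃ U s := fun s => (Finite.equivFin (U s)).symm
  let single : Fin (Nat.card A) → RandVar σ n := fun i => Pattern.rename Subtype.val (eA i).1
  let tup : ∀ s, Fin (Nat.card (U s)) → Fin (Nat.card (Q s)) → RandVar σ n := fun s a b =>
    Pattern.rename (withObj Subtype.val ⟨s, (eU s a).1⟩) (eQ s b).1.1
  have hbij : Set.BijOn (Sum.elim single fun t : (Σ s, Fin (Nat.card (U s)) × Fin (Nat.card (Q s)))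
      => tup t.1 t.2.1 t.2.2) Set.univ (D.cluster acut) := by
    refine ⟨?_, Function.Injective.injOn ?_, ?_⟩
    · rintro (i | ⟨s, a, b⟩) -
      exacts [(eA i).2, (eQ s b).2 _ (eU s a).2]
    · have h1 := sumElim_rename_injective (σ := σ) (Subtype.val_injective (p := (· ∈ K)))
      have hU : ∀ s a, (⟨s, (eU s a).1⟩ : Obj σ n) ∉ Set.range (Subtype.val : K → Obj σ n) :=
        fun s a => by rw [Subtype.range_coe]; exact (eU s a).2
      let J : Fin (Nat.card A) ⊕ (Σ s, Fin (Nat.card (U s)) × Fin (Nat.card (Q s))) →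
          Pattern σ K ⊕ OpenPattern σ K × Unnamed (Subtype.val : K → Obj σ n) :=
        Sum.map (fun i => (eA i).1) fun t => ((eQ t.1 t.2.2).1, ⟨⟨t.1, (eU t.1 t.2.1).1⟩, hU _ _⟩)
      have hJ : Function.Injective J := by
        refine Function.Injective.sumMap (Subtype.val_injective.comp eA.injective) ?_
        rintro ⟨s, a, b⟩ ⟨s', a', b'⟩ h
        have h2 := congrArg (fun p => p.2.1) h
        obtain rfl : s = s' := congrArg Sigma.fst h2
        obtain rfl : a = a' :=
          (eU s).injective (Subtype.ext (eq_of_heq (Sigma.mk.inj h2).2))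
        obtain rfl : b = b' := (eQ s).injective (Subtype.ext (congrArg Prod.fst h))
        rfl
      convert h1.comp hJ using 1
      funext t
      rcases t with i | t <;> rfl
    · intro v hv
      have hv' := hnear hv
      rw [← Subtype.range_coe (s := K)] at hv'
      rcases exists_rename_of_mem_near hv' with ⟨b, rfl⟩ | ⟨⟨s, u⟩, hu, b, rfl⟩
      · exact ⟨.inl (eA.symm ⟨b, hv⟩), trivial, by simp [single]⟩
      · rw [Subtype.range_coe] at hu
        -- Transpositions show that the cluster contains the same atoms for all objects of a domain.
        have hb : ∀ u' : Dom σ n s, (⟨s, u'⟩ : Obj σ n) ∉ K →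
            Pattern.rename (withObj Subtype.val ⟨s, u'⟩) b.1 ∈ D.cluster acut := by
          intro u' hu'
          have hfix : Fixes (onDom s (Equiv.swap u u')) K := fixes_onDom fun x hx =>
            Equiv.swap_apply_of_ne_of_ne (fun h => hu (h ▸ hx)) fun h => hu' (h ▸ hx)
          have h2 := (hclus _ hfix _).2 hv
          rwa [hfix.rename_withObj, permObj_onDom_self, Equiv.swap_apply_left] at h2
        exact ⟨.inr ⟨s, (eU s).symm ⟨u, hu⟩, (eQ s).symm ⟨b, hb⟩⟩, trivial, by simp [tup]⟩
  refine ⟨Nat.card A, σ.numDoms, fun s => Nat.card (U s), fun s => Nat.card (Q s), single, tup,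
    (Finite.card_subtype_le _).trans hw, hw', fun s => (Finite.card_subtype_le _).trans hw'', hbij,
    fun s a a' b => rfl, fun Φ s π ω ω' hω hω' => ?_⟩
  let p : Equiv.Perm (Dom σ n s) := Equiv.Perm.ofSubtype ((eU s).permCongr π)
  have hfix : Fixes (onDom s p) K := fixes_onDom fun u hu =>
    Equiv.Perm.ofSubtype_apply_of_not_mem _ (not_not.2 hu)
  have hp : ∀ a, p (eU s a).1 = (eU s (π a)).1 := fun a => by simp [p]
  have hne : ∀ x y, x ≠ y →
      Sum.elim single (fun t : (Σ s, Fin (Nat.card (U s)) × Fin (Nat.card (Q s))) =>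
        tup t.1 t.2.1 t.2.2) x ≠ Sum.elim single (fun t => tup t.1 t.2.1 t.2.2) y :=
    fun x y hxy h => hxy (hbij.injOn trivial trivial h)
  rw [← DTree.sumOut_comp (hinj (onDom s p)) (fun v => rfl) (fun v => ?_) (fun τ => ?_) ω]
  · refine DTree.sumOut_congr (fun v hv hvS => ?_) Φ
    have hvC : v ∈ D.cluster acut := not_not.1 fun h => hvS ⟨hv, h⟩
    obtain ⟨x, -, rfl⟩ := hbij.surjOn hvC
    rcases x with i | ⟨s', a, b⟩
    · rw [hω' _ fun a b => hne (.inl i) (.inr ⟨s, a, b⟩) (by simp)]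
      exact congrArg ω (hfix.rename_val (eA i).1).symm
    · change ω' (tup s' a b) = ω (Pattern.rename (permObj (onDom s p)) (tup s' a b))
      have hren : Pattern.rename (permObj (onDom s p)) (tup s' a b) = Pattern.rename
          (withObj Subtype.val (permObj (onDom s p) ⟨s', (eU s' a).1⟩)) (eQ s' b).1.1 :=
        hfix.rename_withObj _ _
      rw [hren]
      by_cases hs : s' = s
      · subst hs
        rw [hω, permObj_onDom_self, hp]
      · rw [permObj_onDom_of_ne p hs, hω' (tup s' a b) fun a' b' =>
          hne (.inr ⟨s', a, b⟩) (.inr ⟨s, a', b'⟩) fun h => hs (by cases h; rfl)]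
  · exact and_congr ((hsym.renames _ hfix).mem_rv_iff (hinj _) v) (not_congr (hclus _ hfix v))
  · exact ((hsym.renames _ hfix).weight_eq Φ τ).symm

theorem card_pattern_le {α : Type} [Finite α] {M : ℕ} (h : Nat.card α ≤ M) :
    Nat.card (Pattern σ α) ≤ ∑ p, M ^ σ.arity p := by
  have := Fintype.ofFinite α
  rw [Nat.card_sigma]
  refine Finset.sum_le_sum fun p _ => ?_
  rw [Nat.card_fun, Nat.card_fin]
  exact Nat.pow_le_pow_left h _

theorem card_fixedObjs_le {m : ℕ} (η : Fin m → Obj σ n) :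
    Nat.card (fixedObjs η) ≤ ∑ s, σ.numConsts s + m := by
  rw [Nat.card_coe_set_eq]
  refine (Set.ncard_union_le _ _).trans (Nat.add_le_add ?_ ?_)
  · rw [← Nat.card_coe_set_eq]
    refine (Finite.card_range_le _).trans ?_
    simp
  · rw [← Nat.card_coe_set_eq]
    exact (Finite.card_range_le _).trans (by simp)

theorem exists_hasCountingPartition (T : FODTree σ 0) (hT : T.Liftable) :
    ∃ w : ℕ, ∀ n : Fin σ.numDoms → ℕ, ∀ N ∈ (T.toDTree n).nodes ∅,
      HasCountingPartition w N.1 N.2 := by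
  obtain ⟨B, hB⟩ := exists_symmetric_of_mem_nodes T
  let M : ℕ := ∑ s, σ.numConsts s + B + 1
  refine ⟨σ.numDoms + ∑ p, M ^ σ.arity p, fun n N hN => ?_⟩
  obtain ⟨m, hm, η, hnear, hsym⟩ :=
    hB n Fin.elim0 ∅ (fun _ _ _ => Iff.rfl) (hT n) N hN
  have hM : Nat.card (fixedObjs η) + 1 ≤ M :=
    Nat.succ_le_succ ((card_fixedObjs_le η).trans (Nat.add_le_add_left hm _))
  refine hasCountingPartition hnear hsym ?_ (Nat.le_add_right _ _) ?_
  · exact (card_pattern_le ((Nat.le_succ _).trans hM)).trans (Nat.le_add_left _ _)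
  · refine (Finite.card_subtype_le _).trans ((card_pattern_le ?_).trans (Nat.le_add_left _ _))
    rwa [Finite.card_option]

end Partition

/-! ### The sum over all joint values -/

section Root

open scoped Classical BigOperators

/-- The potential functions that are `1` if all arguments are zero, and `0` otherwise. -/
noncomputable def zeroIndicator (_ : ℕ) (vs : List ℕ) : ℝ := if ∀ v ∈ vs, v = 0 then 1 else 0

theorem weight_zeroIndicator {L V : Type} (D : DTree L V) (τ : V → ℕ) :
    D.weight zeroIndicator τ = if ∀ v ∈ D.rv, τ v = 0 then 1 else 0 := by
  induction D with
  | leaf l f args =>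
    simp only [DTree.weight, DTree.rv, zeroIndicator, List.forall_mem_map, Set.mem_ofPred_eq]
    congr
  | node l ι ch ih =>
    simp only [DTree.weight, DTree.rv, ih, Set.mem_iUnion]
    split_ifs with h
    · exact Finset.prod_eq_one fun i _ => if_pos fun v hv => h v ⟨i, hv⟩
    · push Not at h
      obtain ⟨v, ⟨i, hi⟩, hv⟩ := h
      exact Finset.prod_eq_zero (Finset.mem_univ i) (if_neg fun h => hv (h v hi))

section SumProduct

variable {L V : Type} [Fintype V] {r : V → ℕ}

/-- Up to a factor that does not depend on the potential functions, the sum over all joint values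
of the random variables in a tree is an average over all assignments. -/
theorem average_univ_weight (hr : ∀ v, 0 < r v) (D : DTree L V) (Φ : ℕ → List ℕ → ℝ)
    (ω : ∀ v, Fin (r v)) :
    average Set.univ (fun τ : ∀ v, Fin (r v) => D.weight Φ fun v => τ v) ω =
      D.sumProduct r Φ / Nat.card (∀ v : D.rv, Fin (r v)) := by
  have : ∀ v, Nonempty (Fin (r v)) := fun v => ⟨⟨0, hr v⟩⟩
  let F : (∀ v : D.rv, Fin (r v)) → ℝ := fun τ =>
    D.weight Φ fun v => if h : v ∈ D.rv then (τ ⟨v, h⟩ : ℕ) else 0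
  have h1 : average Set.univ (fun τ : ∀ v, Fin (r v) => D.weight Φ fun v => τ v) ω =
      𝔼 τ : ∀ v, Fin (r v), F fun v => τ v := by
    refine Finset.expect_congr rfl fun τ _ => D.weight_congr Φ fun v hv => ?_
    simp [hv]
  have h2 : 𝔼 τ : ∀ v, Fin (r v), F (fun v => τ v) = 𝔼 τ, F τ := by
    convert expect_comp_injective (D := fun v => Fin (r v)) (j := fun v : D.rv => v.1)
      Subtype.val_injective F
  rw [h1, h2, Fintype.expect_eq_sum_div_card, Nat.card_eq_fintype_card]
  congr 1
  · refine Finset.sum_bij' (fun τ _ v => if h : v ∈ D.rv then (τ ⟨v, h⟩ : ℕ) else 0)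
      (fun τ hτ v => ⟨τ v.1, (mem_piFinset_iff_of_sumOut.1 hτ).1 v.1 v.2⟩)
      (fun τ _ => mem_piFinset_iff_of_sumOut.2 ⟨?_, ?_⟩) (fun _ _ => Finset.mem_univ _)
      (fun τ _ => ?_) (fun τ hτ => ?_) (fun τ _ => rfl)
    · intro v hv
      simp [hv]
    · intro v hv
      simp [hv]
    · funext v
      simp
    · funext v
      by_cases hv : v ∈ D.rv
      · simp [hv]
      · simp [hv, (mem_piFinset_iff_of_sumOut.1 hτ).2 v hv]

theorem sumProduct_zeroIndicator (hr : ∀ v, 0 < r v) (D : DTree L V) :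
    D.sumProduct r zeroIndicator = 1 := by
  simp only [DTree.sumProduct, DTree.sumOut, weight_zeroIndicator]
  rw [Finset.sum_eq_single fun _ => 0]
  · simp
  · intro τ hτ hne
    refine if_neg fun h => hne (funext fun v => ?_)
    by_cases hv : v ∈ D.rv
    · exact h v hv
    · exact (mem_piFinset_iff_of_sumOut.1 hτ).2 v hv
  · exact fun h => (h (mem_piFinset_iff_of_sumOut.2 ⟨fun v _ => hr v, fun v _ => rfl⟩)).elim

end SumProduct

variable {σ : Vocabulary} {n : Fin σ.numDoms → ℕ}

/-- Averages determine the sum over all joint values: the number of assignments, which is not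
polynomially bounded, cancels when dividing by the average for other potential functions. -/
theorem sumProduct_eq_div {L : Type} (D : DTree L (RandVar σ n)) (Φ : ℕ → List ℕ → ℝ)
    (ω : Assignment σ (Obj σ n)) : D.sumProduct (fun v => σ.range v.1) Φ =
      average Set.univ (treeValue D Φ) ω / average Set.univ (treeValue D zeroIndicator) ω := by
  have hr : ∀ v : RandVar σ n, 0 < σ.range v.1 := fun v => σ.range_pos v.1
  have h : (Nat.card (∀ v : D.rv, Fin (σ.range v.1.1)) : ℝ) ≠ 0 :=
    Nat.cast_ne_zero.2 Nat.card_pos.ne'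
  have havg := fun Φ => average_univ_weight hr D Φ ω
  change _ = average Set.univ (fun τ : Assignment σ (Obj σ n) => D.weight Φ fun v => τ v) ω /
    average Set.univ (fun τ : Assignment σ (Obj σ n) =>
      D.weight zeroIndicator fun v => τ v) ω
  rw [havg, havg, sumProduct_zeroIndicator hr]
  field_simp

/-- The assignment of zero to all atoms. -/
def zeroAssignment (σ : Vocabulary) (α : Type) : Assignment σ α := fun a => ⟨0, σ.range_pos a.1⟩

/-- The naming of the constants by themselves. -/
def constNaming (σ : Vocabulary) (n : Fin σ.numDoms → ℕ) (c : Σ s, Fin (σ.numConsts s)) :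
    Obj σ n := ⟨c.1, .inl c.2⟩

theorem typeHist_zeroAssignment (t : ObjType σ (Σ s, Fin (σ.numConsts s))) :
    typeHist (constNaming σ n) (zeroAssignment σ (Obj σ n)) t =
      if t.2 = fun a => ⟨0, σ.range_pos a.1.1⟩ then domSize σ n t.1 - σ.numConsts t.1 else 0 := by
  obtain ⟨s, a⟩ := t
  rw [typeHist, hist]
  split_ifs with h
  · obtain rfl : a = _ := h
    rw [domSize, Nat.add_sub_cancel_left, ← Nat.card_fin (n s)]
    symm
    refine Nat.card_congr (Equiv.ofBijective
      (fun i => ⟨⟨⟨s, .inr i⟩, ?_⟩, rfl⟩) ⟨fun i j hij => ?_, ?_⟩)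
    · rintro ⟨c, hc⟩
      obtain ⟨s', c⟩ := c
      obtain rfl : s' = s := congrArg Sigma.fst hc
      simpa using eq_of_heq (Sigma.mk.inj hc).2
    · have := eq_of_heq (Sigma.mk.inj (congrArg (fun x => x.1.1) hij)).2
      exact Sum.inr.inj this
    · rintro ⟨⟨⟨s', u⟩, hu⟩, hs⟩
      obtain rfl : s' = s := congrArg Prod.fst hs
      rcases u with c | i
      · exact (hu ⟨⟨s', c⟩, rfl⟩).elim
      · exact ⟨i, rfl⟩
  · rw [Nat.card_eq_zero]
    refine .inl ⟨fun u => h ?_⟩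
    exact (congrArg Prod.snd u.2).symm

theorem isFrame_constNaming (n : Fin σ.numDoms → ℕ) :
    IsFrame id Sigma.fst (constNaming σ n) where
  injective := by
    rintro ⟨s, c⟩ ⟨s', c'⟩ h
    obtain rfl : s = s' := congrArg Sigma.fst h
    exact congrArg _ (Sum.inl.inj (eq_of_heq (Sigma.mk.inj h).2))
  dom _ := rfl
  const _ := rfl

/-- The average of the product of all factors is computable in time polynomial in the domain
sizes. -/
theorem exists_average_computable (T : FODTree σ 0) (hT : T.Liftable) :
    ∃ f : (Fin σ.numDoms → ℕ) → (ℕ → List ℕ → ℝ) → ℝ, RealComputable f ∧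
      ∀ (n : Fin σ.numDoms → ℕ) (Φ : ℕ → List ℕ → ℝ), f (domSize σ n) Φ =
        average Set.univ (treeValue (T.toDTree n) Φ) (zeroAssignment σ (Obj σ n)) := by
  choose F hF hval using computes T (Σ s, Fin (σ.numConsts s)) id Sigma.fst Fin.elim0
  obtain ⟨G, hG, hGval⟩ :=
    exists_average_eq (σ := σ) (Σ s, Fin (σ.numConsts s)) Set.univ Set.univ hF
  let h : ObjType σ (Σ s, Fin (σ.numConsts s)) → (Fin σ.numDoms → ℕ) → ℕ := fun t ρ =>
    if t.2 = fun a => ⟨0, σ.range_pos a.1.1⟩ then ρ t.1 - σ.numConsts t.1 else 0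
  have hh : ∀ t, NatComputable (h t) := fun t => by
    simp only [h]
    split_ifs
    exacts [(NatComputable.var _).tsub (.const _), .const 0]
  refine ⟨_, (hG (zeroAssignment σ _)).comp hh, fun n Φ => ?_⟩
  have hhist : typeHist (constNaming σ n) (zeroAssignment σ (Obj σ n)) =
      fun t => h t (domSize σ n) := funext fun t => typeHist_zeroAssignment t
  change G (Assignment.pull (constNaming σ n) (zeroAssignment σ (Obj σ n)))
    (fun t => h t (domSize σ n)) Φ = _
  rw [← hhist, ← hGval n (constNaming σ n) Set.univ (isFrame_constNaming n).injective
    (fun _ => iff_of_true trivial trivial) (fun _ _ _ => iff_of_true trivial trivial)]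
  refine Eq.trans ?_ (average_average (Set.subset_univ (Near (Set.range (constNaming σ n)))ᶜ) _ _)
  have hη : (fun i : Fin 0 => constNaming σ n (Fin.elim0 i)) = Fin.elim0 := Subsingleton.elim _ _
  refine average_congr fun τ _ => ?_
  have := hval (Assignment.pull (constNaming σ n) τ) n (constNaming σ n) τ Φ
    (isFrame_constNaming n) (by rw [hη]; exact separated_of_hasLiftableClusters T _ ∅ (hT n)) rfl
  rw [hη] at this
  exact this.symm

theorem RealComputable.exists_prog {f : (Fin σ.numDoms → ℕ) → (ℕ → List ℕ → ℝ) → ℝ}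
    (hf : RealComputable f) : ∃ (P : Prog) (q : MvPolynomial (Fin σ.numDoms) ℕ),
      ∀ (n : Fin σ.numDoms → ℕ) (Φ : ℕ → List ℕ → ℝ),
        (P.run Φ (startState σ n)).1.real 0 = f (domSize σ n) Φ ∧
          (P.run Φ (startState σ n)).2 ≤ MvPolynomial.eval (domSize σ n) q := by
  obtain ⟨q, hf⟩ := hf
  obtain ⟨P, hP⟩ := hf (fun s => s) σ.numDoms 0 fun s => s.2
  have hstart : ∀ n : Fin σ.numDoms → ℕ, (fun s : Fin σ.numDoms => (startState σ n).nat s) =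
      domSize σ n := fun n => funext fun s => dif_pos s.2
  refine ⟨P, Polynomial.aeval (∑ s, MvPolynomial.X s) q, fun n Φ => ⟨?_, ?_⟩⟩
  · rw [hP.val, hstart]
  · have heval : MvPolynomial.eval (domSize σ n) (Polynomial.aeval (∑ s, MvPolynomial.X s) q) =
        q.eval (∑ s, domSize σ n s) := by
      rw [Polynomial.aeval_def, Polynomial.hom_eval₂, map_sum]
      simp only [MvPolynomial.eval_X]
      rw [Polynomial.eval, Subsingleton.elim (RingHom.comp _ _) (RingHom.id ℕ)]
    rw [heval]
    refine hP.cost Φ _ _ fun s => ?_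
    rw [congrFun (hstart n) s]
    exact Finset.single_le_sum (fun _ _ => Nat.zero_le _) (Finset.mem_univ s)

theorem exists_prog_sumProduct (T : FODTree σ 0) (hT : T.Liftable) :
    ∃ (P : Prog) (q : MvPolynomial (Fin σ.numDoms) ℕ),
      ∀ (n : Fin σ.numDoms → ℕ) (Φ : ℕ → List ℕ → ℝ),
        (P.run Φ (startState σ n)).1.real 0 =
            (T.toDTree n).sumProduct (fun v => σ.range v.1) Φ ∧
          (P.run Φ (startState σ n)).2 ≤ MvPolynomial.eval (domSize σ n) q := by
  obtain ⟨f, hf, hval⟩ := exists_average_computable T hT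
  obtain ⟨P, q, hP⟩ := (hf.div (hf.specialize zeroIndicator fun _ vs => by
    rw [zeroIndicator]; split_ifs <;> simp)).exists_prog
  refine ⟨P, q, fun n Φ => ⟨(hP n Φ).1.trans ?_, (hP n Φ).2⟩⟩
  rw [hval, hval, ← sumProduct_eq_div]

end Root
end FODtrees

theorem theorem1 (σ : FODtrees.Vocabulary) (T : FODtrees.FODTree σ 0) (hT : T.WellFormed)
    (hlift : T.Liftable) :
    (∃ w : ℕ, ∀ n : Fin σ.numDoms → ℕ, ∀ N ∈ (T.toDTree n).nodes ∅,
      FODtrees.HasCountingPartition w N.1 N.2) ∧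
    ∃ (P : FODtrees.Prog) (q : MvPolynomial (Fin σ.numDoms) ℕ),
      ∀ (n : Fin σ.numDoms → ℕ) (Φ : ℕ → List ℕ → ℝ),
        (P.run Φ (FODtrees.startState σ n)).1.real 0 =
            (T.toDTree n).sumProduct (fun v => σ.range v.1) Φ ∧
          (P.run Φ (FODtrees.startState σ n)).2 ≤
            MvPolynomial.eval (FODtrees.domSize σ n) q :=
  ⟨FODtrees.exists_hasCountingPartition T hlift, FODtrees.exists_prog_sumProduct T hlift⟩
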